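/- Let $E$ be a smooth real vector bundle of finite rank $r$ over a smooth $n$-dimensional manifold $M$ (Hausdorff, second countable, without boundary), and let $k\ge 0$. For $U\subseteq M$ open put $\mathcal X(U)=C^\infty(U)\otimes_{\mathbb R}\Gamma_E(U)$, a $C^\infty(U)$-module by $f\triangleright(g\otimes\psi)=(fg)\otimes\psi$; for $f\in C^\infty(U)$ let $\delta_f(g\otimes\psi)=(fg)\otimes\psi-g\otimes(f\psi)$, and let $\mathcal V_{(k)}(U)\subseteq\mathcal X(U)$ be the submodule spanned by all $\delta_{f_1}\cdots\delta_{f_{k+1}}(g\otimes\psi)$. Let $P$ be the presheaf of $C^\infty_M$-modules $U\mapsto\mathcal X(U)/\mathcal V_{(k)}(U)$, let $P^{\bullet}(U)=\bigcap_{q\in\mathbb N}\bigcap_{a\in U}(\mathcal J^a(U))^q\triangleright P(U)$, where $\mathcal J^a(U)\subseteq C^\infty(U)$ is the ideal of functions vanishing at $a$, and let $\mathcal J\mathrm{et}^k_E$ be the sheafification of $U\mapsto P(U)/P^\bullet(U)$. For $h\in C^\infty(U)$, $\psi\in\Gamma_E(U)$ denote by $[h\otimes\psi]$ the induced section of $\mathcal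 J\mathrm{et}^k_E$ over $U$. Write $C^\infty_{M,a}$, $\Gamma_{E,a}$, $\mathcal J\mathrm{et}^k_{E,a}$ for stalks at $a\in M$ and $\mathfrak m_a\subseteq C^\infty_{M,a}$ for the ideal of germs vanishing at $a$. Then: (1) there is a smooth vector bundle $\mathfrak J^k_E$ over $M$, with fibers $(\mathfrak J^k_E)_a=\mathcal J\mathrm{et}^k_{E,a}/(\mathfrak m_a\triangleright\mathcal J\mathrm{et}^k_{E,a})$, whose sheaf of smooth sections is $\mathcal J\mathrm{et}^k_E$: for every open $U$, the map $\sigma\mapsto(a\mapsto\sigma|_a)$ is a bijection from $\mathcal J\mathrm{et}^k_E(U)$ onto the smooth sections of $\mathfrak J^k_E$ over $U$; (2) there is a smooth vector bundle $\overline{\mathfrak J}{}^k_E=\bigsqcup_{a\in M}\Gamma_{E,a}/\mathfrak m_a^{k+1}\Gamma_{E,a}$ over $M$ (the classical $k$-th jet bundle) for which every chart $(U,\varphi)$ of $M$ together with a local frame $\{\Phi_\lambda\}_{\lambda=1}^r$ of $E$ over $U$ gives a smooth local trivialization $j^k_a\psi\mapsto\bigl(a,((\partial_{\mathbf I}\psi^\lambda)(a))_{\lambda,|\mathbf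 I|\le k}\bigr)$ over $U$, where $\psi=\psi^\lambda\Phi_\lambda$, $j^k_a\psi$ is the class of the germ of $\psi$ at $a$, and $\partial_{\mathbf I}$ are the partial derivatives in the chart; (3) there is a canonical isomorphism of smooth vector bundles $\Psi:\mathfrak J^k_E\to\overline{\mathfrak J}{}^k_E$ over $\mathrm{id}_M$: the fiberwise linear map determined uniquely by $\Psi_a([h\otimes\psi]|_a)=h(a)\,j^k_a\psi$ for all open $U\ni a$, $h\in C^\infty(U)$, $\psi\in\Gamma_E(U)$ exists, is a linear isomorphism on each fiber, and $\Psi$ and $\Psi^{-1}$ are smooth. -/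

import Mathlib

open Set TopologicalSpace Bundle
open scoped Manifold ContDiff Bundle TensorProduct

noncomputable section

namespace JetLimit

/-! ### Smooth functions on open sets, their germs -/

section Functions

variable (n : ℕ) {M : Type*} [TopologicalSpace M] [ChartedSpace (EuclideanSpace ℝ (Fin n)) M]

/-- The algebra `C^∞(U)` of smooth real functions on an open subset of an `n`-manifold. -/
abbrev Cinf (U : Opens M) : Type _ := C^∞⟮𝓡 n, U; 𝓘(ℝ), ℝ⟯

/-- Restriction of smooth functions. -/
def resFun {U V : Opens M} (h : V ≤ U) : Cinf n U →ₐ[ℝ] Cinf n V :=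
  { ContMDiffMap.restrictRingHom (𝓡 n) 𝓘(ℝ) ℝ h with
    commutes' := fun _ => rfl }

@[simp] theorem resFun_apply {U V : Opens M} (h : V ≤ U) (f : Cinf n U) (x : V) :
    resFun n h f x = f ⟨x.1, h x.2⟩ := rfl

/-- The ideal of smooth functions on `U` that vanish at `a`. -/
def vanishingIdeal (U : Opens M) (a : U) : Ideal (Cinf n U) :=
  RingHom.ker (ContMDiffMap.evalRingHom a : Cinf n U →+* ℝ)

theorem mem_vanishingIdeal {U : Opens M} {a : U} {f : Cinf n U} :
    f ∈ vanishingIdeal n U a ↔ f a = 0 := Iff.rfl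

/-- The transition maps of the directed system `U ↦ C^∞(U)` over the open neighbourhoods of `a`,
ordered by reverse inclusion. -/
abbrev resFunNhds (a : M) (U V : (OpenNhdsOf a)ᵒᵈ) (h : U ≤ V) :
    Cinf n (OrderDual.ofDual U).toOpens →ₐ[ℝ] Cinf n (OrderDual.ofDual V).toOpens :=
  resFun n (show (OrderDual.ofDual V).toOpens ≤ (OrderDual.ofDual U).toOpens from h)

instance (a : M) : DirectedSystem
    (fun U : (OpenNhdsOf a)ᵒᵈ => Cinf n (OrderDual.ofDual U).toOpens)
    (fun U V h => resFunNhds n a U V h) where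
  map_self _ _ := rfl
  map_map _ _ _ _ _ _ := rfl

/-- The stalk `C^∞_{M,a}`, i.e. the colimit of `C^∞(U)` over the open `U ∋ a`. -/
abbrev FunStalk (a : M) : Type _ :=
  DirectLimit (fun U : (OpenNhdsOf a)ᵒᵈ => Cinf n (OrderDual.ofDual U).toOpens) (resFunNhds n a)

theorem funStalk_eq (a : M) {U V : (OpenNhdsOf a)ᵒᵈ} (h : U ≤ V)
    (f : Cinf n (OrderDual.ofDual U).toOpens) :
    (⟦⟨U, f⟩⟧ : FunStalk n a) = ⟦⟨V, resFunNhds n a U V h f⟩⟧ :=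
  DirectLimit.eq_of_le (F := fun U : (OpenNhdsOf a)ᵒᵈ =>
    Cinf n (OrderDual.ofDual U).toOpens) (f := resFunNhds n a) ⟨U, f⟩ V h

/-- The germ at `a` of a smooth function on an open `U ∋ a`. -/
def funGerm (U : Opens M) (a : U) : Cinf n U →+* FunStalk n (a : M) where
  toFun f := ⟦⟨OrderDual.toDual ⟨U, a.2⟩, f⟩⟧
  map_one' := (DirectLimit.one_def _).symm
  map_mul' _ _ := (DirectLimit.mul_def _ _ _).symm
  map_zero' := (DirectLimit.zero_def _).symm
  map_add' _ _ := (DirectLimit.add_def _ _ _).symm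

theorem funGerm_res {U V : Opens M} (h : V ≤ U) (a : V) (f : Cinf n U) :
    funGerm n V a (resFun n h f) = funGerm n U ⟨a.1, h a.2⟩ f :=
  (funStalk_eq n (a : M) (U := OrderDual.toDual ⟨U, h a.2⟩) (V := OrderDual.toDual ⟨V, a.2⟩)
    h f).symm

/-- The value at `a` of a germ of smooth functions. -/
def evalStalk (a : M) : FunStalk n a →+* ℝ where
  toFun := DirectLimit.lift _ (fun U f => f ⟨a, (OrderDual.ofDual U).mem⟩) (fun _ _ _ _ => rfl)
  map_one' := by rw [DirectLimit.one_def (OrderDual.toDual ⊤)]; rfl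
  map_zero' := by rw [DirectLimit.zero_def (OrderDual.toDual ⊤)]; rfl
  map_mul' x y := by
    induction x, y using DirectLimit.induction₂ with
    | ih U f g => rw [DirectLimit.mul_def]; rfl
  map_add' x y := by
    induction x, y using DirectLimit.induction₂ with
    | ih U f g => rw [DirectLimit.add_def]; rfl

/-- The maximal ideal `{[f]_a | f(a) = 0}` of `C^∞_{M,a}`. -/
def maxIdeal (a : M) : Ideal (FunStalk n a) := RingHom.ker (evalStalk n a)

end Functions

/-- The additive map between quotient modules induced by an additive map. -/
def quotMap {R S A B : Type*} [Ring R] [Ring S] [AddCommGroup A] [AddCommGroup B] [Module R A]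
    [Module S B] (p : Submodule R A) (q : Submodule S B) (f : A →+ B)
    (h : ∀ x ∈ p, f x ∈ q) : A ⧸ p →+ B ⧸ q :=
  QuotientAddGroup.map p.toAddSubgroup q.toAddSubgroup f h

/-! ### Presheaves of `C^∞`-modules: stalks, fibers, geometrization, sheafification -/

section Presheaves

variable (n : ℕ) (M : Type*) [TopologicalSpace M] [ChartedSpace (EuclideanSpace ℝ (Fin n)) M]

/-- A presheaf of `C^∞_M`-modules. -/
structure ModPresheaf where
  obj : Opens M → Type*
  [grp : ∀ U, AddCommGroup (obj U)]
  [mod : ∀ U, Module (Cinf n U) (obj U)]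
  res : ∀ {U V : Opens M}, V ≤ U → obj U →+ obj V
  res_id : ∀ (U : Opens M) (s : obj U), res le_rfl s = s
  res_res : ∀ {U V W : Opens M} (h : V ≤ U) (h' : W ≤ V) (s : obj U),
    res h' (res h s) = res (h'.trans h) s
  res_smul : ∀ {U V : Opens M} (h : V ≤ U) (f : Cinf n U) (s : obj U),
    res h (f • s) = resFun n h f • res h s

attribute [instance] ModPresheaf.grp ModPresheaf.mod

variable {n M}

namespace ModPresheaf

variable (P : ModPresheaf n M)

/-- The transition maps of the directed system `U ↦ P(U)` over the open neighbourhoods of `a`. -/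
abbrev resNhds (a : M) (U V : (OpenNhdsOf a)ᵒᵈ) (h : U ≤ V) :
    P.obj (OrderDual.ofDual U).toOpens →+ P.obj (OrderDual.ofDual V).toOpens :=
  P.res (show (OrderDual.ofDual V).toOpens ≤ (OrderDual.ofDual U).toOpens from h)

instance (a : M) : DirectedSystem
    (fun U : (OpenNhdsOf a)ᵒᵈ => P.obj (OrderDual.ofDual U).toOpens)
    (fun U V h => P.resNhds a U V h) where
  map_self _ _ := P.res_id _ _
  map_map _ _ _ _ _ _ := P.res_res _ _ _

/-- The stalk `P_a`. -/
abbrev Stalk (a : M) : Type _ :=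
  DirectLimit (fun U : (OpenNhdsOf a)ᵒᵈ => P.obj (OrderDual.ofDual U).toOpens) (P.resNhds a)

theorem stalk_eq (a : M) {U V : (OpenNhdsOf a)ᵒᵈ} (h : U ≤ V)
    (s : P.obj (OrderDual.ofDual U).toOpens) :
    (⟦⟨U, s⟩⟧ : P.Stalk a) = ⟦⟨V, P.resNhds a U V h s⟩⟧ :=
  DirectLimit.eq_of_le (F := fun U : (OpenNhdsOf a)ᵒᵈ =>
    P.obj (OrderDual.ofDual U).toOpens) (f := P.resNhds a) ⟨U, s⟩ V h

/-- The germ at `a` of an element of `P(U)`, for `U ∋ a`. -/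
def germ (U : Opens M) (a : U) : P.obj U →+ P.Stalk (a : M) where
  toFun s := ⟦⟨OrderDual.toDual ⟨U, a.2⟩, s⟩⟧
  map_zero' := (DirectLimit.zero_def _).symm
  map_add' _ _ := (DirectLimit.add_def _ _ _).symm

theorem germ_res {U V : Opens M} (h : V ≤ U) (a : V) (s : P.obj U) :
    P.germ V a (P.res h s) = P.germ U ⟨a.1, h a.2⟩ s :=
  (P.stalk_eq (a : M) (U := OrderDual.toDual ⟨U, h a.2⟩) (V := OrderDual.toDual ⟨V, a.2⟩)
    h s).symm

instance (a : M) : SMul (FunStalk n a) (P.Stalk a) where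
  smul := DirectLimit.map₂ _ _ _ (fun _ f s => f • s) (fun _ _ _ f s => P.res_smul _ f s)

theorem stalk_smul_def (a : M) (U : (OpenNhdsOf a)ᵒᵈ)
    (f : Cinf n (OrderDual.ofDual U).toOpens) (s : P.obj (OrderDual.ofDual U).toOpens) :
    ((⟦⟨U, f⟩⟧ : FunStalk n a) • (⟦⟨U, s⟩⟧ : P.Stalk a)) = ⟦⟨U, f • s⟩⟧ :=
  DirectLimit.map₂_def _ _ _ _ _ _ _ _

/-- The stalk `P_a` is a `C^∞_{M,a}`-module via `[f]_a • [s]_a = [f • s]_a`. -/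
instance (a : M) : Module (FunStalk n a) (P.Stalk a) where
  one_smul x := by
    induction x using DirectLimit.induction with
    | ih U s => rw [DirectLimit.one_def U, stalk_smul_def, one_smul]
  mul_smul x y z := by
    obtain ⟨U, f, g, s, rfl, rfl, rfl⟩ : ∃ U f g s, x = ⟦⟨U, f⟩⟧ ∧ y = ⟦⟨U, g⟩⟧ ∧ z = ⟦⟨U, s⟩⟧ := by
      obtain ⟨U, f, g, rfl, rfl⟩ := DirectLimit.exists_eq_mk₂ _ x y
      obtain ⟨V, s, rfl⟩ := DirectLimit.exists_eq_mk _ z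
      obtain ⟨W, hU, hV⟩ := exists_ge_ge U V
      exact ⟨W, _, _, _, funStalk_eq n a hU f, funStalk_eq n a hU g, P.stalk_eq a hV s⟩
    rw [DirectLimit.mul_def, stalk_smul_def, stalk_smul_def, stalk_smul_def, mul_smul]
  smul_zero x := by
    induction x using DirectLimit.induction with
    | ih U f => rw [DirectLimit.zero_def U, stalk_smul_def, smul_zero]
  zero_smul x := by
    induction x using DirectLimit.induction with
    | ih U s => rw [DirectLimit.zero_def U, DirectLimit.zero_def U, stalk_smul_def, zero_smul]
  smul_add x y z := by
    obtain ⟨U, s, t, rfl, rfl⟩ := DirectLimit.exists_eq_mk₂ _ y z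
    obtain ⟨V, f, rfl⟩ := DirectLimit.exists_eq_mk _ x
    obtain ⟨W, hU, hV⟩ := exists_ge_ge U V
    rw [P.stalk_eq a hU s, P.stalk_eq a hU t, funStalk_eq n a hV f,
      DirectLimit.add_def, stalk_smul_def, stalk_smul_def,
      stalk_smul_def, DirectLimit.add_def, smul_add]
  add_smul x y z := by
    obtain ⟨U, f, g, rfl, rfl⟩ := DirectLimit.exists_eq_mk₂ _ x y
    obtain ⟨V, s, rfl⟩ := DirectLimit.exists_eq_mk _ z
    obtain ⟨W, hU, hV⟩ := exists_ge_ge U V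
    rw [funStalk_eq n a hU f, funStalk_eq n a hU g, P.stalk_eq a hV s,
      DirectLimit.add_def, stalk_smul_def, stalk_smul_def,
      stalk_smul_def, DirectLimit.add_def, add_smul]

theorem germ_smul {U : Opens M} (a : U) (f : Cinf n U) (s : P.obj U) :
    P.germ U a (f • s) = funGerm n U a f • P.germ U a s :=
  (P.stalk_smul_def (a : M) (OrderDual.toDual ⟨U, a.2⟩) f s).symm

/-- The fiber `P_a / (J_a • P_a)`, where `J_a` is the maximal ideal of `C^∞_{M,a}`. -/
def Fiber (a : M) : Type _ := P.Stalk a ⧸ (maxIdeal n a • ⊤ : Submodule (FunStalk n a) (P.Stalk a))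

instance (a : M) : AddCommGroup (P.Fiber a) :=
  inferInstanceAs (AddCommGroup (P.Stalk a ⧸ _))

instance (a : M) : Module (FunStalk n a) (P.Fiber a) :=
  inferInstanceAs (Module (FunStalk n a) (P.Stalk a ⧸ _))

instance (a : M) : Module ℝ (P.Fiber a) := Module.compHom _ (algebraMap ℝ (FunStalk n a))

/-- The value `s|_a` in the fiber at `a` of an element of `P(U)`. -/
def value (U : Opens M) (a : U) (s : P.obj U) : P.Fiber (a : M) :=
  Submodule.Quotient.mk (P.germ U a s)

/-! #### Geometrization -/

/-- The submodule `P(U)^• = ⋂_{q, a} (J^a(U))^q P(U)` of elements vanishing at all points to all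
orders. -/
def bullet (U : Opens M) : Submodule (Cinf n U) (P.obj U) :=
  ⨅ (q : ℕ) (a : U), (vanishingIdeal n U a ^ q) • (⊤ : Submodule (Cinf n U) (P.obj U))

theorem res_mem_bullet {U V : Opens M} (h : V ≤ U) {s : P.obj U} (hs : s ∈ P.bullet U) :
    P.res h s ∈ P.bullet V := by
  simp only [bullet, Submodule.mem_iInf] at hs ⊢
  intro q a
  refine Submodule.smul_induction_on (hs q ⟨a.1, h a.2⟩) (fun f hf t _ => ?_) (fun x y hx hy => ?_)
  · rw [P.res_smul]
    refine Submodule.smul_mem_smul ?_ Submodule.mem_top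
    have h1 : (vanishingIdeal n U ⟨a.1, h a.2⟩).map (resFun n h) ≤ vanishingIdeal n V a := by
      rw [Ideal.map_le_iff_le_comap]
      intro g hg
      exact hg
    have h2 := Ideal.mem_map_of_mem (resFun n h) hf
    rw [Ideal.map_pow] at h2
    exact Ideal.pow_right_mono h1 q h2
  · rw [map_add]
    exact add_mem hx hy

/-- The geometrization of `P`: `U ↦ P(U) / P(U)^•`. -/
def geo : ModPresheaf n M where
  obj U := P.obj U ⧸ P.bullet U
  res {U V} h := quotMap (P.bullet U) (P.bullet V) (P.res h) (fun _ hs => P.res_mem_bullet h hs)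
  res_id U s := by
    obtain ⟨s, rfl⟩ := Submodule.Quotient.mk_surjective _ s
    exact congrArg Submodule.Quotient.mk (P.res_id U s)
  res_res {U V W} h h' s := by
    obtain ⟨s, rfl⟩ := Submodule.Quotient.mk_surjective _ s
    exact congrArg Submodule.Quotient.mk (P.res_res h h' s)
  res_smul {U V} h f s := by
    obtain ⟨s, rfl⟩ := Submodule.Quotient.mk_surjective _ s
    exact congrArg Submodule.Quotient.mk (P.res_smul h f s)

/-- The geometric class `[s]^•` of `s ∈ P(U)`. -/
def toGeo (U : Opens M) : P.obj U →ₗ[Cinf n U] P.geo.obj U := (P.bullet U).mkQ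

/-! #### Sheafification -/

/-- `C^∞(U)` acts on families of germs over `U` through its germs. -/
instance familyModule (U : Opens M) : Module (Cinf n U) (∀ a : U, P.Stalk (a : M)) :=
  Module.compHom _ (RingHom.pi fun a : U => funGerm n U a)

theorem family_smul_apply {U : Opens M} (f : Cinf n U) (s : ∀ a : U, P.Stalk (a : M)) (a : U) :
    (f • s) a = funGerm n U a f • s a := rfl

/-- The families of germs over `U` that are locally the germs of an element of the presheaf. -/
def sheafSections (U : Opens M) : Submodule (Cinf n U) (∀ a : U, P.Stalk (a : M)) where
  carrier := {s | ∀ a : U, ∃ (V : Opens M) (h : V ≤ U) (t : P.obj V), (a : M) ∈ V ∧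
    ∀ b : V, s ⟨b.1, h b.2⟩ = P.germ V b t}
  zero_mem' a := ⟨U, le_rfl, 0, a.2, fun b => (map_zero _).symm⟩
  add_mem' {s s'} hs hs' a := by
    obtain ⟨V, h, t, ha, ht⟩ := hs a
    obtain ⟨V', h', t', ha', ht'⟩ := hs' a
    refine ⟨V ⊓ V', inf_le_left.trans h, P.res inf_le_left t + P.res inf_le_right t', ⟨ha, ha'⟩,
      fun b => ?_⟩
    rw [map_add, germ_res, germ_res, ← ht ⟨b.1, b.2.1⟩, ← ht' ⟨b.1, b.2.2⟩]
    rfl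
  smul_mem' f s hs a := by
    obtain ⟨V, h, t, ha, ht⟩ := hs a
    refine ⟨V, h, resFun n h f • t, ha, fun b => ?_⟩
    rw [germ_smul, ← ht b, family_smul_apply]
    rw [funGerm_res]

/-- The sheafification of `P`. -/
def sff : ModPresheaf n M where
  obj U := P.sheafSections U
  res {U V} h :=
    { toFun := fun s => ⟨fun a => s.1 ⟨a.1, h a.2⟩, fun a => by
        obtain ⟨W, hW, t, ha, ht⟩ := s.2 ⟨a.1, h a.2⟩
        refine ⟨W ⊓ V, inf_le_right, P.res inf_le_left t, ⟨ha, a.2⟩, fun b => ?_⟩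
        rw [germ_res, ← ht ⟨b.1, b.2.1⟩]⟩
      map_zero' := rfl
      map_add' := fun _ _ => rfl }
  res_id _ _ := rfl
  res_res _ _ _ := rfl
  res_smul {U V} h f s := by
    apply Subtype.ext
    funext a
    change funGerm n U ⟨a.1, h a.2⟩ f • s.1 ⟨a.1, h a.2⟩ =
      funGerm n V a (resFun n h f) • s.1 ⟨a.1, h a.2⟩
    rw [funGerm_res]

/-- The canonical morphism from a presheaf to its sheafification. -/
def toSff (U : Opens M) : P.obj U →ₗ[Cinf n U] P.sff.obj U where
  toFun t := ⟨fun a => P.germ U a t, fun a => ⟨U, le_rfl, t, a.2, fun _ => rfl⟩⟩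
  map_add' s t := Subtype.ext (funext fun a => map_add (P.germ U a) s t)
  map_smul' f t := Subtype.ext (funext fun a => P.germ_smul a f t)

end ModPresheaf

end Presheaves

/-! ### Smooth sections of a vector bundle over open sets -/

section Bundles

variable (n : ℕ) {M : Type*} [TopologicalSpace M] [ChartedSpace (EuclideanSpace ℝ (Fin n)) M]
  (F : Type*) [NormedAddCommGroup F] [NormedSpace ℝ F]
  (E : M → Type*) [TopologicalSpace (TotalSpace F E)] [∀ x, TopologicalSpace (E x)]
  [FiberBundle F E]

variable {E} in
/-- `s` is a smooth section over the open set `U` of the bundle `E`. -/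
def IsSmoothSection (U : Opens M) (s : ∀ x : U, E (x : M)) : Prop :=
  ContMDiff (𝓡 n) ((𝓡 n).prod 𝓘(ℝ, F)) ∞ (fun x : U => TotalSpace.mk' F (x : M) (s x))

variable [∀ x, AddCommGroup (E x)] [∀ x, Module ℝ (E x)] [VectorBundle ℝ F E]

variable {n F E} in
theorem IsSmoothSection.add {U : Opens M} {s t : ∀ x : U, E (x : M)}
    (hs : IsSmoothSection n F U s) (ht : IsSmoothSection n F U t) :
    IsSmoothSection n F U (s + t) := by
  intro x
  have h1 := (contMDiffAt_totalSpace.1 (hs x))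
  have h2 := (contMDiffAt_totalSpace.1 (ht x))
  refine contMDiffAt_totalSpace.2 ⟨h1.1, (h1.2.add h2.2).congr_of_eventuallyEq ?_⟩
  have hb : ∀ᶠ y : U in nhds x, (y : M) ∈ (trivializationAt F E (x : M)).baseSet :=
    continuous_subtype_val.continuousAt.eventually
      ((trivializationAt F E (x : M)).open_baseSet.mem_nhds (mem_baseSet_trivializationAt F E _))
  filter_upwards [hb] with y hy
  exact ((trivializationAt F E (x : M)).linear ℝ hy).map_add (s y) (t y)

variable {n F E} in
theorem IsSmoothSection.smul {U : Opens M} {s : ∀ x : U, E (x : M)} {f : U → ℝ}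
    (hf : ContMDiff (𝓡 n) 𝓘(ℝ) ∞ f) (hs : IsSmoothSection n F U s) :
    IsSmoothSection n F U (fun x => f x • s x) := by
  intro x
  have h1 := (contMDiffAt_totalSpace.1 (hs x))
  refine contMDiffAt_totalSpace.2 ⟨h1.1, ((hf x).smul h1.2).congr_of_eventuallyEq ?_⟩
  have hb : ∀ᶠ y : U in nhds x, (y : M) ∈ (trivializationAt F E (x : M)).baseSet :=
    continuous_subtype_val.continuousAt.eventually
      ((trivializationAt F E (x : M)).open_baseSet.mem_nhds (mem_baseSet_trivializationAt F E _))
  filter_upwards [hb] with y hy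
  exact ((trivializationAt F E (x : M)).linear ℝ hy).map_smul (f y) (s y)

theorem isSmoothSection_zero (U : Opens M) :
    IsSmoothSection n F U (0 : ∀ x : U, E (x : M)) := by
  intro x
  refine contMDiffAt_totalSpace.2 ⟨contMDiff_subtype_val x,
    (contMDiffAt_const (c := (0 : F))).congr_of_eventuallyEq ?_⟩
  have hb : ∀ᶠ y : U in nhds x, (y : M) ∈ (trivializationAt F E (x : M)).baseSet :=
    continuous_subtype_val.continuousAt.eventually
      ((trivializationAt F E (x : M)).open_baseSet.mem_nhds (mem_baseSet_trivializationAt F E _))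
  filter_upwards [hb] with y hy
  exact ((trivializationAt F E (x : M)).linear ℝ hy).map_zero

/-- The space `Γ_E(U)` of smooth sections of `E` over `U`. -/
def Sections (U : Opens M) : Submodule ℝ (∀ x : U, E (x : M)) where
  carrier := {s | IsSmoothSection n F U s}
  zero_mem' := isSmoothSection_zero n F E U
  add_mem' hs ht := hs.add ht
  smul_mem' c _ hs := hs.smul (f := fun _ => c) contMDiff_const

/-- Pointwise multiplication of sections by smooth functions. -/
instance (U : Opens M) : Module (Cinf n U) (Sections n F E U) where
  smul f s := ⟨fun x => f x • s.1 x, IsSmoothSection.smul f.contMDiff s.2⟩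
  one_smul s := Subtype.ext (funext fun x => one_smul ℝ (s.1 x))
  mul_smul f g s := Subtype.ext (funext fun x => mul_smul (f x) (g x) (s.1 x))
  smul_zero f := Subtype.ext (funext fun x => smul_zero (f x))
  zero_smul s := Subtype.ext (funext fun x => zero_smul ℝ (s.1 x))
  smul_add f s t := Subtype.ext (funext fun x => smul_add (f x) (s.1 x) (t.1 x))
  add_smul f g s := Subtype.ext (funext fun x => add_smul (f x) (g x) (s.1 x))

theorem sections_smul_apply {U : Opens M} (f : Cinf n U) (s : Sections n F E U) (x : U) :
    (f • s).1 x = f x • s.1 x := rfl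

/-- Restriction of sections. -/
def resSec {U V : Opens M} (h : V ≤ U) : Sections n F E U →ₗ[ℝ] Sections n F E V where
  toFun s := ⟨fun x => s.1 ⟨x.1, h x.2⟩,
    (show IsSmoothSection n F U s.1 from s.2).comp (contMDiff_inclusion h)⟩
  map_add' _ _ := rfl
  map_smul' _ _ := rfl

/-- The sheaf `Γ_E` of smooth sections of `E`. -/
def secSheaf : ModPresheaf n M where
  obj U := Sections n F E U
  res h := (resSec n F E h).toAddMonoidHom
  res_id _ _ := rfl
  res_res _ _ _ := rfl
  res_smul _ _ _ := rfl

/-! ### The sheaf of jets -/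

/-- `𝒳(U) = C^∞(U) ⊗_ℝ Γ_E(U)`; its `C^∞(U)`-module structure is `f ▷ (g ⊗ ψ) = (f g) ⊗ ψ`. -/
abbrev XX (U : Opens M) : Type _ := Cinf n U ⊗[ℝ] Sections n F E U

/-- Multiplication of sections by `f` as an `ℝ`-linear map. -/
def mulSec {U : Opens M} (f : Cinf n U) : Sections n F E U →ₗ[ℝ] Sections n F E U where
  toFun s := f • s
  map_add' := smul_add f
  map_smul' c s := Subtype.ext (funext fun x => smul_comm (f x) c (s.1 x))

/-- `δ_f(g ⊗ ψ) = (f g) ⊗ ψ - g ⊗ (f ψ)`. -/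
def delta {U : Opens M} (f : Cinf n U) : Module.End (Cinf n U) (XX n F E U) :=
  f • LinearMap.id - TensorProduct.AlgebraTensorModule.map LinearMap.id (mulSec n F E f)

theorem delta_tmul {U : Opens M} (f g : Cinf n U) (ψ : Sections n F E U) :
    delta n F E f (g ⊗ₜ ψ) = (f * g) ⊗ₜ ψ - g ⊗ₜ (f • ψ) := rfl

/-- `δ_{f_1} ∘ ⋯ ∘ δ_{f_j}`. -/
def deltaComp {U : Opens M} {j : ℕ} (f : Fin j → Cinf n U) :
    Module.End (Cinf n U) (XX n F E U) :=
  (List.ofFn fun i => delta n F E (f i)).prod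

/-- The `ℝ`-span `𝒱_(k)(U)` of all `δ_{f_1} ⋯ δ_{f_{k+1}} (g ⊗ ψ)`, which is a
`C^∞(U)`-submodule of `𝒳(U)`. -/
def VV (k : ℕ) (U : Opens M) : Submodule (Cinf n U) (XX n F E U) :=
  { Submodule.span ℝ {x : XX n F E U | ∃ (f : Fin (k + 1) → Cinf n U) (g : Cinf n U)
      (ψ : Sections n F E U), x = deltaComp n F E f (g ⊗ₜ ψ)} with
    smul_mem' := by
      intro h x hx
      refine Submodule.span_induction (p := fun x _ => h • x ∈ Submodule.span ℝ
        {x : XX n F E U | ∃ (f : Fin (k + 1) → Cinf n U) (g : Cinf n U)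
          (ψ : Sections n F E U), x = deltaComp n F E f (g ⊗ₜ ψ)}) ?_ ?_ ?_ ?_ hx
      · rintro _ ⟨f, g, ψ, rfl⟩
        refine Submodule.subset_span ⟨f, h * g, ψ, ?_⟩
        rw [← map_smul]
        rfl
      · rw [smul_zero]
        exact Submodule.zero_mem _
      · intro x y _ _ hx hy
        rw [smul_add]
        exact Submodule.add_mem _ hx hy
      · intro c x _ hx
        rw [smul_comm]
        exact Submodule.smul_mem _ c hx }

/-- Restriction `𝒳(U) → 𝒳(V)`. -/
def resXX {U V : Opens M} (h : V ≤ U) : XX n F E U →ₗ[ℝ] XX n F E V :=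
  TensorProduct.map (resFun n h).toLinearMap (resSec n F E h)

theorem resXX_delta {U V : Opens M} (h : V ≤ U) (f : Cinf n U) (x : XX n F E U) :
    resXX n F E h (delta n F E f x) = delta n F E (resFun n h f) (resXX n F E h x) := by
  induction x using TensorProduct.induction_on with
  | zero => simp
  | tmul g ψ => rw [delta_tmul, map_sub]; rfl
  | add x y hx hy => simp only [map_add, hx, hy]

theorem resXX_deltaComp {U V : Opens M} (h : V ≤ U) {j : ℕ} (f : Fin j → Cinf n U)
    (x : XX n F E U) :
    resXX n F E h (deltaComp n F E f x) =
      deltaComp n F E (fun i => resFun n h (f i)) (resXX n F E h x) := by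
  induction j with
  | zero => rfl
  | succ j ih =>
    simp only [deltaComp, List.ofFn_succ, List.prod_cons, Module.End.mul_apply, resXX_delta]
    congr 1
    exact ih (fun i => f i.succ)

theorem resXX_mem (k : ℕ) {U V : Opens M} (h : V ≤ U) {x : XX n F E U} (hx : x ∈ VV n F E k U) :
    resXX n F E h x ∈ VV n F E k V := by
  have : Submodule.span ℝ {x : XX n F E U | ∃ (f : Fin (k + 1) → Cinf n U) (g : Cinf n U)
      (ψ : Sections n F E U), x = deltaComp n F E f (g ⊗ₜ ψ)} ≤
      (Submodule.span ℝ {x : XX n F E V | ∃ (f : Fin (k + 1) → Cinf n V) (g : Cinf n V)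
      (ψ : Sections n F E V), x = deltaComp n F E f (g ⊗ₜ ψ)}).comap (resXX n F E h) := by
    rw [Submodule.span_le]
    rintro _ ⟨f, g, ψ, rfl⟩
    exact Submodule.subset_span ⟨fun i => resFun n h (f i), resFun n h g, resSec n F E h ψ,
      resXX_deltaComp n F E h f _⟩
  exact this hx

theorem resXX_smul {U V : Opens M} (h : V ≤ U) (f : Cinf n U) (x : XX n F E U) :
    resXX n F E h (f • x) = resFun n h f • resXX n F E h x := by
  induction x using TensorProduct.induction_on with
  | zero => simp
  | tmul g ψ =>
    rw [TensorProduct.smul_tmul']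
    change resFun n h (f * g) ⊗ₜ[ℝ] resSec n F E h ψ =
      (resFun n h f * resFun n h g) ⊗ₜ[ℝ] resSec n F E h ψ
    rw [map_mul]
  | add x y hx hy => simp only [map_add, smul_add, hx, hy]

theorem resXX_self (U : Opens M) (x : XX n F E U) : resXX n F E (le_refl U) x = x := by
  induction x using TensorProduct.induction_on with
  | zero => simp
  | tmul g ψ => rfl
  | add x y hx hy => simp only [map_add, hx, hy]

theorem resXX_resXX {U V W : Opens M} (h : V ≤ U) (h' : W ≤ V) (x : XX n F E U) :
    resXX n F E h' (resXX n F E h x) = resXX n F E (h'.trans h) x := by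
  induction x using TensorProduct.induction_on with
  | zero => simp
  | tmul g ψ => rfl
  | add x y hx hy => simp only [map_add, hx, hy]

/-- The presheaf `U ↦ 𝒳(U) / 𝒱_(k)(U)`, with the module structure induced by `▷`. -/
def preJet (k : ℕ) : ModPresheaf n M where
  obj U := XX n F E U ⧸ VV n F E k U
  res {U V} h := quotMap (VV n F E k U) (VV n F E k V)
    (resXX n F E h).toAddMonoidHom (fun _ hx => resXX_mem n F E k h hx)
  res_id U s := by
    obtain ⟨s, rfl⟩ := Submodule.Quotient.mk_surjective _ s
    exact congrArg Submodule.Quotient.mk (resXX_self n F E U s)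
  res_res {U V W} h h' s := by
    obtain ⟨s, rfl⟩ := Submodule.Quotient.mk_surjective _ s
    exact congrArg Submodule.Quotient.mk (resXX_resXX n F E h h' s)
  res_smul {U V} h f s := by
    obtain ⟨s, rfl⟩ := Submodule.Quotient.mk_surjective _ s
    exact congrArg Submodule.Quotient.mk (resXX_smul n F E h f s)

/-- The sheaf of `k`-th order jets: the sheafification of the geometrization of `preJet`. -/
def jetSheaf (k : ℕ) : ModPresheaf n M := (preJet n F E k).geo.sff

/-- The section of the sheaf of jets over `U` given by the class of `h ⊗ ψ`. -/
def jetClass (k : ℕ) (U : Opens M) (h : Cinf n U) (ψ : Sections n F E U) :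
    (jetSheaf n F E k).obj U :=
  (preJet n F E k).geo.toSff U ((preJet n F E k).toGeo U (Submodule.Quotient.mk (h ⊗ₜ ψ)))

/-- The fiber at `a` of the jet bundle determined by the sheaf of `k`-th order jets. -/
abbrev JetFiber (k : ℕ) (a : M) : Type _ := (jetSheaf n F E k).Fiber a

/-! ### The classical jet bundle -/

/-- The `k`-th order jet space `Γ_{E,a} / (J_a)^{k+1} Γ_{E,a}` at `a`. -/
def JetSpace (k : ℕ) (a : M) : Type _ := (secSheaf n F E).Stalk a ⧸
  ((maxIdeal n a) ^ (k + 1) • ⊤ : Submodule (FunStalk n a) ((secSheaf n F E).Stalk a))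

instance (k : ℕ) (a : M) : AddCommGroup (JetSpace n F E k a) :=
  inferInstanceAs (AddCommGroup ((secSheaf n F E).Stalk a ⧸ _))

instance (k : ℕ) (a : M) : Module (FunStalk n a) (JetSpace n F E k a) :=
  inferInstanceAs (Module (FunStalk n a) ((secSheaf n F E).Stalk a ⧸ _))

instance (k : ℕ) (a : M) : Module ℝ (JetSpace n F E k a) :=
  Module.compHom _ (algebraMap ℝ (FunStalk n a))

/-- The `k`-jet at `a` of a section defined on an open `U ∋ a`. -/
def jetAt (k : ℕ) (U : Opens M) (a : U) (ψ : Sections n F E U) : JetSpace n F E k (a : M) :=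
  Submodule.Quotient.mk ((secSheaf n F E).germ U a ψ)

/-- Multi-indices `I = (i_1, …, i_n)` with `i_1 + ⋯ + i_n ≤ k`. -/
abbrev JetIndex (n k : ℕ) : Type := {I : Fin n → Fin (k + 1) // ∑ A, (I A : ℕ) ≤ k}

/-- The typical fiber `ℝ^ℓ`, `ℓ = r * binom (n + k) k`, `r` the rank, of the jet bundle. -/
abbrev JetModel (k : ℕ) : Type := Fin (Module.finrank ℝ F) × JetIndex n k → ℝ

/-- The partial derivative `∂_I = (∂_1)^{i_1} ∘ ⋯ ∘ (∂_n)^{i_n}` of a function on `ℝ^n`. -/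
def multiPartial (I : Fin n → ℕ) (f : EuclideanSpace ℝ (Fin n) → ℝ) :
    EuclideanSpace ℝ (Fin n) → ℝ :=
  (List.finRange n).foldr
    (fun A g => (fun u y => fderiv ℝ u y (EuclideanSpace.single A 1))^[I A] g) f

open scoped Classical in
/-- The numbers `(∂_I ψ^λ)(a)`, where `ψ = ∑ ψ^λ Φ_λ` with respect to the local frame `Φ` over the
domain of the chart `e`, and the derivatives are taken in the chart `e`. -/
def jetCoord (k : ℕ) (e : OpenPartialHomeomorph M (EuclideanSpace ℝ (Fin n)))
    {Φ : Fin (Module.finrank ℝ F) → (x : M) → E x}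
    (hΦ : IsLocalFrameOn (𝓡 n) F ∞ Φ e.source) (U : Opens M) (a : U) (ψ : Sections n F E U) :
    JetModel n F k := fun p =>
  multiPartial n (fun A => (p.2.1 A : ℕ))
    (fun y => hΦ.coeff p.1 (e.symm y) (if h : e.symm y ∈ U then ψ.1 ⟨e.symm y, h⟩ else 0))
    (e (a : M))

/-- The bundle structure on the jet spaces is the one of the classical jet bundle: every chart `e`
of `M` with a local frame `Φ` of `E` over its domain induces the local trivialization
`j^k_a ψ ↦ (a, (∂_I ψ^λ (a)))` over the domain of `e`. -/
def HasJetTrivializations (k : ℕ)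
    [TopologicalSpace (TotalSpace (JetModel n F k) (JetSpace n F E k))]
    [∀ a, TopologicalSpace (JetSpace n F E k a)]
    [FiberBundle (JetModel n F k) (JetSpace n F E k)] : Prop :=
  ∀ e ∈ IsManifold.maximalAtlas (𝓡 n) ∞ M,
    ∀ (Φ : Fin (Module.finrank ℝ F) → (x : M) → E x)
      (hΦ : IsLocalFrameOn (𝓡 n) F ∞ Φ e.source),
    ∃ t ∈ trivializationAtlas (JetModel n F k) (JetSpace n F E k),
      t.baseSet = e.source ∧
      ∀ (U : Opens M) (a : U), (a : M) ∈ e.source → ∀ ψ : Sections n F E U,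
        t ⟨(a : M), jetAt n F E k U a ψ⟩ = ((a : M), jetCoord n F E k e hΦ U a ψ)

variable {n} in
/-- The smooth sections of a bundle with fibers `P_a / (J_a • P_a)` are exactly the sections of the
presheaf `P`: over each open `U`, evaluation `σ ↦ (a ↦ σ|_a)` is a bijection from `P(U)` onto the
smooth sections over `U`. -/
def IsSheafOfSections (P : ModPresheaf n M) (K : Type*) [NormedAddCommGroup K] [NormedSpace ℝ K]
    [TopologicalSpace (TotalSpace K P.Fiber)] [∀ a, TopologicalSpace (P.Fiber a)]
    [FiberBundle K P.Fiber] : Prop :=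
  ∀ U : Opens M, Set.BijOn (fun (σ : P.obj U) (a : U) => P.value U a σ) Set.univ
    {s | IsSmoothSection n K U s}

end Bundles

end JetLimit

end

open JetLimit

/-! Everything rests on the map Θ_a : g ⊗ ψ ↦ g(a) j^k_a ψ (`thetaX`). It factors through the
evaluation g ⊗ ψ ↦ g(a)ψ (`evX`), which turns δ_f into multiplication by f(a) - f (`evX_delta`). So
k+1 operators δ produce a factor in the (k+1)-st power of the ideal of a, and Θ_a kills 𝒱_(k). It
also kills J^a ▷ 𝒳, and therefore descends to the geometrization, to its sheafification and to the
fiber at a, where it becomes Ψ_a (`thetaFiber`). Surjectivity is seen on the elements 1 ⊗ ψ.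

For injectivity, 1 ⊗ fψ lies in 𝒱_(k) + J^a ▷ 𝒳 as soon as f is in the (k+1)-st power of the ideal
of a (`one_tmul_smul_mem`). Over a chart onto ℝ^n with a local frame Φ, Taylor's formula then writes
every x in 𝒳(U), modulo 𝒱_(k) + J^a ▷ 𝒳, as a real combination of the finitely many elements (I!)⁻¹
∏ (-δ_{x_A})^{i_A} (1 ⊗ Φ_λ) (`jetFrame`, `exists_jetFrame_decomp`). These do not depend on a, yet
at every a of the chart Θ_a sends them to the basis of jets dual to the coordinates ∂_I ψ^λ. So Θ_a
x = 0 forces all coefficients to vanish.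

Geometrization enters for sections. Let Q = 𝒳/𝒱_(k) over such a chart and let N be the span of the
jet frame. Then Q = N + J^a Q, hence Q = N + (J^a)^q Q for all q. If s = Σ c_p b_p + r with r in
(J^a)^q Q has vanishing coordinates, C^∞-linearity of the coordinates shows that each c_p is minus a
coordinate of r, so it lies in (J^a)^q, and s lies in (J^a)^q Q. As q and a are arbitrary, s is in
Q^•, which is exactly what is divided out (`mem_bullet_of_coordP_eq_zero`). Thus a section of the
sheaf of jets is determined by its field of jets (`thetaSec_injective`), and every field with smooth
coordinates is locally a C^∞-combination of the jet frame. These local lifts glue because they are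
unique.

Coordinate changes between framed charts are smooth, because the jet frame of one chart consists of
fixed elements of 𝒳, whose jets have smooth coordinates in any other chart. The sheaf fibers receive
the bundle structure transported along Ψ, so in matching trivializations Ψ and its inverse are the
identity. -/

noncomputable section

set_option linter.unusedSectionVars false

namespace JetLimit

/-! ### Hadamard's lemma on `ℝ^n` -/

/-- The integral of a `C^1` function over a parameter may be differentiated under the integral. -/
theorem hasFDerivAt_intervalIntegral_param {E G : Type*} [NormedAddCommGroup E] [NormedSpace ℝ E]
    [FiniteDimensional ℝ E] [NormedAddCommGroup G] [NormedSpace ℝ G] {f : E × ℝ → G}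
    (hf : ContDiff ℝ 1 f) (x₀ : E) :
    HasFDerivAt (fun x => ∫ t in (0 : ℝ)..1, f (x, t))
      (∫ t in (0 : ℝ)..1, (fderiv ℝ f (x₀, t)).comp (ContinuousLinearMap.inl ℝ E ℝ)) x₀ := by
  have hc : Continuous fun p : E × ℝ => (fderiv ℝ f p).comp (ContinuousLinearMap.inl ℝ E ℝ) :=
    (hf.continuous_fderiv one_ne_zero).clm_comp continuous_const
  -- Finite dimension makes the closed ball compact, so a constant dominates the derivative.
  obtain ⟨C, hC⟩ := ((isCompact_closedBall x₀ (1 : ℝ)).prod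
    (isCompact_Icc (a := (0 : ℝ)) (b := 1))).exists_bound_of_continuousOn hc.continuousOn
  refine intervalIntegral.hasFDerivAt_integral_of_dominated_of_fderiv_le
    (F := fun x t => f (x, t))
    (F' := fun x t => (fderiv ℝ f (x, t)).comp (ContinuousLinearMap.inl ℝ E ℝ))
    (bound := fun _ => C) (Metric.closedBall_mem_nhds x₀ one_pos) ?_ ?_ ?_ ?_ ?_ ?_
  · exact Filter.Eventually.of_forall fun x =>
      (hf.continuous.comp (by fun_prop : Continuous fun t : ℝ => (x, t))).aestronglyMeasurable
  · exact (hf.continuous.comp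
      (by fun_prop : Continuous fun t : ℝ => (x₀, t))).intervalIntegrable _ _
  · exact (hc.comp (by fun_prop : Continuous fun t : ℝ => (x₀, t))).aestronglyMeasurable
  · refine Filter.Eventually.of_forall fun t ht x hx => hC (x, t) ⟨hx, ?_⟩
    rw [uIoc_of_le zero_le_one] at ht
    exact ⟨ht.1.le, ht.2⟩
  · exact intervalIntegrable_const
  · refine Filter.Eventually.of_forall fun t _ x _ => ?_
    exact ((hf.differentiable one_ne_zero) (x, t)).hasFDerivAt.comp x
      ((hasFDerivAt_id x).prodMk (hasFDerivAt_const t x))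

/-- The derivative of such an integral is an integral of the same kind with values in `E →L[ℝ] G`.
The induction on `m` therefore has to treat all targets `G` at once, and the common universe of `E`
and `G` keeps the new target in range. -/
theorem contDiff_intervalIntegral_param_nat {E : Type} [NormedAddCommGroup E] [NormedSpace ℝ E]
    [FiniteDimensional ℝ E] (m : ℕ) : ∀ {G : Type} [NormedAddCommGroup G] [NormedSpace ℝ G]
    {f : E × ℝ → G}, ContDiff ℝ ∞ f → ContDiff ℝ m (fun x => ∫ t in (0 : ℝ)..1, f (x, t)) := by
  induction m with
  | zero =>
    intro G _ _ f hf
    refine contDiff_zero.2 ?_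
    exact intervalIntegral.continuous_parametric_intervalIntegral_of_continuous'
      (f := fun x t => f (x, t)) hf.continuous 0 1
  | succ m ih =>
    intro G _ _ f hf
    have h := contDiff_succ_iff_hasFDerivAt (𝕜 := ℝ) (n := m)
      (f := fun x => ∫ t in (0 : ℝ)..1, f (x, t))
    push_cast
    rw [h]
    refine ⟨_, ih (f := fun p => (fderiv ℝ f p).comp (ContinuousLinearMap.inl ℝ E ℝ)) ?_,
      fun x => hasFDerivAt_intervalIntegral_param (hf.of_le (by simp)) x⟩
    exact (hf.fderiv_right (by simp)).clm_comp contDiff_const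

/-- Smooth dependence on a parameter of the integral of a smooth function. -/
theorem contDiff_intervalIntegral_param {E : Type} [NormedAddCommGroup E] [NormedSpace ℝ E]
    [FiniteDimensional ℝ E] {G : Type} [NormedAddCommGroup G] [NormedSpace ℝ G]
    {f : E × ℝ → G} (hf : ContDiff ℝ ∞ f) :
    ContDiff ℝ ∞ (fun x => ∫ t in (0 : ℝ)..1, f (x, t)) :=
  contDiff_infty.2 fun m => contDiff_intervalIntegral_param_nat m hf

/-- The fundamental theorem of calculus along the segment from `p` to `x`, with g_A(x) = ∫₀¹ ∂_A f(p
+ t(x - p)) dt. All of ℝ^n is star-shaped about every `p`, which is why charts onto ℝ^n are used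
later. -/
theorem hadamard_lemma {n : ℕ} {f : EuclideanSpace ℝ (Fin n) → ℝ} (hf : ContDiff ℝ ∞ f)
    (p : EuclideanSpace ℝ (Fin n)) :
    ∃ g : Fin n → EuclideanSpace ℝ (Fin n) → ℝ, (∀ A, ContDiff ℝ ∞ (g A)) ∧
      ∀ x, f x = f p + ∑ A, (x A - p A) * g A x := by
  have hfd : ContDiff ℝ ∞ (fderiv ℝ f) := hf.fderiv_right (by simp)
  have hline : ContDiff ℝ ∞ (fun q : EuclideanSpace ℝ (Fin n) × ℝ => p + q.2 • (q.1 - p)) := by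
    fun_prop
  refine ⟨fun A x => ∫ t in (0 : ℝ)..1,
    fderiv ℝ f (p + t • (x - p)) (EuclideanSpace.single A 1), fun A => ?_, fun x => ?_⟩
  · exact contDiff_intervalIntegral_param (f := fun q : EuclideanSpace ℝ (Fin n) × ℝ =>
      fderiv ℝ f (p + q.2 • (q.1 - p)) (EuclideanSpace.single A 1))
      ((hfd.comp hline).clm_apply contDiff_const)
  · have hcont : ∀ A : Fin n, Continuous fun t : ℝ =>
        fderiv ℝ f (p + t • (x - p)) (EuclideanSpace.single A 1) := fun A =>
      ((hfd.continuous.comp (by fun_prop : Continuous fun t : ℝ => p + t • (x - p))).clm_apply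
        continuous_const)
    have hsum : ∀ t : ℝ, fderiv ℝ f (p + t • (x - p)) (x - p) =
        ∑ A, (x A - p A) * fderiv ℝ f (p + t • (x - p)) (EuclideanSpace.single A 1) := by
      intro t
      have hx : x - p = ∑ A, (x A - p A) • EuclideanSpace.single A (1 : ℝ) := by
        ext B
        simp [Finset.sum_apply, Pi.single_apply]
      have h := congrArg (fderiv ℝ f (p + t • (x - p))) hx
      rw [map_sum] at h
      simpa only [map_smul, smul_eq_mul] using h
    have hderiv : ∀ t ∈ uIcc (0 : ℝ) 1, HasDerivAt (fun t : ℝ => f (p + t • (x - p)))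
        (fderiv ℝ f (p + t • (x - p)) (x - p)) t := by
      intro t _
      have h1 : HasDerivAt (fun t : ℝ => p + t • (x - p)) (x - p) t := by
        simpa using ((hasDerivAt_id t).smul_const (x - p)).const_add p
      exact ((hf.differentiable (by simp)) (p + t • (x - p))).hasFDerivAt.comp_hasDerivAt t h1
    have hftc := intervalIntegral.integral_eq_sub_of_hasDerivAt hderiv (by
      simp_rw [hsum]
      exact (continuous_finsetSum _ fun A _ =>
        continuous_const.mul (hcont A)).intervalIntegrable _ _)
    simp_rw [hsum] at hftc
    rw [intervalIntegral.integral_finsetSum (f := fun A t => (x A - p A) *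
        fderiv ℝ f (p + t • (x - p)) (EuclideanSpace.single A 1))
      (fun A _ => (continuous_const.mul (hcont A)).intervalIntegrable _ _)] at hftc
    simp_rw [intervalIntegral.integral_const_mul] at hftc
    rw [hftc]
    simp

/-! ### Taylor expansion in the ring of smooth functions on `ℝ^n` -/

section Taylor

variable (n : ℕ)

/-- The ring of smooth functions on `ℝ^n`. -/
abbrev EucFun : Type := C^∞⟮𝓡 n, EuclideanSpace ℝ (Fin n); 𝓘(ℝ), ℝ⟯

variable {n}

theorem EucFun.contDiff (f : EucFun n) : ContDiff ℝ ∞ f := contMDiff_iff_contDiff.1 f.contMDiff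

/-- A smooth function on `ℝ^n`, bundled. -/
def EucFun.mk (f : EuclideanSpace ℝ (Fin n) → ℝ) (hf : ContDiff ℝ ∞ f) : EucFun n :=
  ⟨f, contMDiff_iff_contDiff.2 hf⟩

@[simp] theorem EucFun.mk_apply (f : EuclideanSpace ℝ (Fin n) → ℝ) (hf : ContDiff ℝ ∞ f)
    (x : EuclideanSpace ℝ (Fin n)) : EucFun.mk f hf x = f x := rfl

/-- The ideal of smooth functions on `ℝ^n` vanishing at `p`. -/
def eucIdeal (p : EuclideanSpace ℝ (Fin n)) : Ideal (EucFun n) :=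
  RingHom.ker (ContMDiffMap.evalRingHom p : EucFun n →+* ℝ)

theorem mem_eucIdeal {p : EuclideanSpace ℝ (Fin n)} {f : EucFun n} :
    f ∈ eucIdeal p ↔ f p = 0 := Iff.rfl

/-- The shifted coordinate function `x_A - p_A`. -/
def eucCoord (p : EuclideanSpace ℝ (Fin n)) (A : Fin n) : EucFun n :=
  EucFun.mk (fun x => x A - p A) (by fun_prop)

@[simp] theorem eucCoord_apply (p x : EuclideanSpace ℝ (Fin n)) (A : Fin n) :
    eucCoord p A x = x A - p A := rfl

theorem eucCoord_mem (p : EuclideanSpace ℝ (Fin n)) (A : Fin n) :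
    eucCoord p A ∈ eucIdeal p := by
  simp [mem_eucIdeal]

/-- The partial derivative `∂_A` on the ring of smooth functions. -/
def eucPartial (A : Fin n) (f : EucFun n) : EucFun n :=
  EucFun.mk (fun y => fderiv ℝ f y (EuclideanSpace.single A 1))
    ((f.contDiff.fderiv_right (by simp)).clm_apply contDiff_const)

theorem eucPartial_mul (A : Fin n) (f g : EucFun n) :
    eucPartial A (f * g) = f * eucPartial A g + g * eucPartial A f := by
  ext y
  have hf := (f.contDiff.differentiable (by simp)) y
  have hg := (g.contDiff.differentiable (by simp)) y
  change fderiv ℝ (fun y => f y * g y) y _ = f y * fderiv ℝ g y _ + g y * fderiv ℝ f y _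
  rw [fderiv_fun_mul hf hg]
  simp

theorem eucPartial_smul (A : Fin n) (c : ℝ) (f : EucFun n) :
    eucPartial A (c • f) = c • eucPartial A f := by
  ext y
  have hf := (f.contDiff.differentiable (by simp)) y
  change fderiv ℝ (fun y => c • f y) y _ = c • fderiv ℝ f y _
  rw [fderiv_fun_const_smul hf]
  simp

theorem eucPartial_add (A : Fin n) (f g : EucFun n) :
    eucPartial A (f + g) = eucPartial A f + eucPartial A g := by
  ext y
  have hf := (f.contDiff.differentiable (by simp)) y
  have hg := (g.contDiff.differentiable (by simp)) y
  change fderiv ℝ (fun y => f y + g y) y _ = fderiv ℝ f y _ + fderiv ℝ g y _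
  rw [fderiv_fun_add hf hg]
  simp

theorem eucPartial_one (A : Fin n) : eucPartial A (1 : EucFun n) = 0 := by
  ext y
  change fderiv ℝ (fun _ => (1 : ℝ)) y _ = 0
  simp

theorem eucPartial_coord (A B : Fin n) (p : EuclideanSpace ℝ (Fin n)) :
    eucPartial A (eucCoord p B) = if A = B then 1 else 0 := by
  ext y
  change fderiv ℝ (fun x : EuclideanSpace ℝ (Fin n) => x B - p B) y (EuclideanSpace.single A 1) = _
  have h : HasFDerivAt (fun x : EuclideanSpace ℝ (Fin n) => x B - p B)
      (EuclideanSpace.proj B : EuclideanSpace ℝ (Fin n) →L[ℝ] ℝ) y :=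
    (EuclideanSpace.proj B : EuclideanSpace ℝ (Fin n) →L[ℝ] ℝ).hasFDerivAt.sub_const _
  rw [h.fderiv]
  by_cases hAB : A = B
  · subst hAB; simp
  · simp [hAB, Ne.symm hAB]

/-- By the Leibniz rule a derivation lowers the power of an ideal by at most one. -/
theorem eucPartial_mem_pow (A : Fin n) (p : EuclideanSpace ℝ (Fin n)) (j : ℕ) :
    ∀ {f : EucFun n}, f ∈ eucIdeal p ^ (j + 1) → eucPartial A f ∈ eucIdeal p ^ j := by
  induction j with
  | zero => intro f _; simp
  | succ j ih =>
    intro f hf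
    rw [pow_succ'] at hf
    refine Submodule.mul_induction_on hf (fun a ha b hb => ?_) (fun a b ha hb => ?_)
    · rw [eucPartial_mul]
      refine add_mem ?_ (Ideal.mul_mem_right _ _ hb)
      rw [pow_succ']
      exact Ideal.mul_mem_mul ha (ih hb)
    · rw [eucPartial_add]
      exact add_mem ha hb

theorem eucPartial_mem_pow_sub (A : Fin n) (p : EuclideanSpace ℝ (Fin n)) (j i : ℕ)
    {f : EucFun n} (hf : f ∈ eucIdeal p ^ j) : (eucPartial A)^[i] f ∈ eucIdeal p ^ (j - i) := by
  induction i with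
  | zero => exact hf
  | succ i ih =>
    rw [Function.iterate_succ_apply']
    rcases Nat.lt_or_ge i j with h | h
    · have h' : j - i = (j - (i + 1)) + 1 := by omega
      rw [h'] at ih
      exact eucPartial_mem_pow A p _ ih
    -- Once `i` reaches `j` the truncated exponent is 0 and the power is the whole ring.
    · rw [Nat.sub_eq_zero_of_le (by omega)]
      simp

/-- The partial derivative `∂_I` taken along a list of coordinates. -/
def eucPartialList (I : Fin n → ℕ) (l : List (Fin n)) (f : EucFun n) : EucFun n :=
  l.foldr (fun A g => (eucPartial A)^[I A] g) f

/-- Links the iterated `fderiv` of `multiPartial` with operators on the ring of smooth functions, so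
that arguments with ideals apply to partial derivatives. -/
theorem eucPartialList_coe (I : Fin n → ℕ) (l : List (Fin n)) (f : EucFun n) :
    ⇑(eucPartialList I l f) = l.foldr
      (fun A g => (fun u y => fderiv ℝ u y (EuclideanSpace.single A 1))^[I A] g) ⇑f := by
  induction l with
  | nil => rfl
  | cons A l ih =>
    simp only [eucPartialList, List.foldr_cons] at ih ⊢
    rw [← ih]
    generalize List.foldr (fun A g => (eucPartial A)^[I A] g) f l = g
    induction I A with
    | zero => rfl
    | succ i ih' =>
      rw [Function.iterate_succ_apply', Function.iterate_succ_apply', ← ih']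
      rfl

theorem multiPartial_eq (I : Fin n → ℕ) (f : EucFun n) :
    multiPartial n I f = eucPartialList I (List.finRange n) f :=
  (eucPartialList_coe I _ f).symm

theorem eucPartialList_mem (I : Fin n → ℕ) (p : EuclideanSpace ℝ (Fin n)) (j : ℕ)
    {f : EucFun n} (hf : f ∈ eucIdeal p ^ j) (l : List (Fin n)) :
    eucPartialList I l f ∈ eucIdeal p ^ (j - (l.map I).sum) := by
  induction l with
  | nil => exact hf
  | cons A l ih =>
    have := eucPartial_mem_pow_sub A p _ (I A) ih
    rwa [Nat.sub_sub, add_comm _ (I A), ← List.sum_cons, ← List.map_cons] at this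

/-- Differentiating |I| ≤ k times leaves an exponent of at least 1. -/
theorem multiPartial_eq_zero_of_mem {I : Fin n → ℕ} {k : ℕ} (hI : ∑ A, I A ≤ k)
    {p : EuclideanSpace ℝ (Fin n)} {f : EucFun n} (hf : f ∈ eucIdeal p ^ (k + 1)) :
    multiPartial n I f p = 0 := by
  have h := eucPartialList_mem I p (k + 1) hf (List.finRange n)
  have hs : ((List.finRange n).map I).sum = ∑ A, I A := by
    rw [Fin.sum_univ_def]
  rw [hs] at h
  have h1 : k + 1 - ∑ A, I A ≠ 0 := by omega
  rw [multiPartial_eq]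
  exact mem_eucIdeal.1 (Ideal.pow_le_self h1 h)

/-- The monomial `(x - p)^I`. -/
def eucMonomial (p : EuclideanSpace ℝ (Fin n)) (I : Fin n → ℕ) : EucFun n :=
  ∏ A, eucCoord p A ^ I A

theorem eucMonomial_apply_self (p : EuclideanSpace ℝ (Fin n)) (I : Fin n → ℕ) :
    eucMonomial p I p = if I = 0 then 1 else 0 := by
  have h : eucMonomial p I p = ∏ A, (eucCoord p A p) ^ I A := by
    have := map_prod (ContMDiffMap.evalRingHom p : EucFun n →+* ℝ)
      (fun A => eucCoord p A ^ I A) Finset.univ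
    simp only [map_pow] at this
    exact this
  rw [h]
  split_ifs with h0
  · simp [h0]
  · obtain ⟨A, hA⟩ := Function.ne_iff.1 h0
    exact Finset.prod_eq_zero (Finset.mem_univ A) (by simpa using hA)

theorem eucPartial_coord_pow (A B : Fin n) (p : EuclideanSpace ℝ (Fin n)) (i : ℕ) :
    eucPartial A (eucCoord p B ^ i) =
      if A = B then (i : ℝ) • eucCoord p B ^ (i - 1) else 0 := by
  induction i with
  | zero => simp [eucPartial_one]
  | succ i ih =>
    rw [pow_succ, eucPartial_mul, ih, eucPartial_coord]
    split_ifs with h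
    · rcases i with _ | i
      · simp
      · ext y
        simp
        ring
    · simp

theorem eucPartial_prod_coord (A : Fin n) (p : EuclideanSpace ℝ (Fin n)) (I : Fin n → ℕ)
    (s : Finset (Fin n)) (hs : A ∉ s) : eucPartial A (∏ B ∈ s, eucCoord p B ^ I B) = 0 := by
  induction s using Finset.induction_on with
  | empty => simp [eucPartial_one]
  | insert B s hB ih =>
    rw [Finset.mem_insert, not_or] at hs
    rw [Finset.prod_insert hB, eucPartial_mul, ih hs.2, eucPartial_coord_pow, if_neg hs.1]
    simp

theorem eucMonomial_eq (A : Fin n) (p : EuclideanSpace ℝ (Fin n)) (I : Fin n → ℕ) :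
    eucMonomial p I = eucCoord p A ^ I A * ∏ B ∈ Finset.univ.erase A, eucCoord p B ^ I B :=
  (Finset.mul_prod_erase _ _ (Finset.mem_univ A)).symm

theorem eucPartial_monomial (A : Fin n) (p : EuclideanSpace ℝ (Fin n)) (I : Fin n → ℕ) :
    eucPartial A (eucMonomial p I) =
      (I A : ℝ) • eucMonomial p (Function.update I A (I A - 1)) := by
  have h : ∏ B ∈ Finset.univ.erase A, eucCoord p B ^ (Function.update I A (I A - 1) B) =
      ∏ B ∈ Finset.univ.erase A, eucCoord p B ^ I B :=
    Finset.prod_congr rfl fun B hB => by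
      rw [Function.update_of_ne (Finset.ne_of_mem_erase hB)]
  rw [eucMonomial_eq A p I, eucMonomial_eq A p (Function.update _ _ _), h, eucPartial_mul,
    eucPartial_prod_coord _ _ _ _ (Finset.notMem_erase _ _), eucPartial_coord_pow, if_pos rfl,
    Function.update_self]
  rw [mul_zero, zero_add, mul_smul_comm, mul_comm]

theorem eucPartial_iterate_smul (A : Fin n) (i : ℕ) (c : ℝ) (f : EucFun n) :
    (eucPartial A)^[i] (c • f) = c • (eucPartial A)^[i] f := by
  induction i with
  | zero => rfl
  | succ i ih =>
    rw [Function.iterate_succ_apply', Function.iterate_succ_apply', ih, eucPartial_smul]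

/-- The truncated exponent `I A - i` is harmless: the descending factorial vanishes when `i` exceeds
`I A`. -/
theorem eucPartial_iterate_monomial (A : Fin n) (p : EuclideanSpace ℝ (Fin n)) (I : Fin n → ℕ)
    (i : ℕ) : (eucPartial A)^[i] (eucMonomial p I) =
      ((I A).descFactorial i : ℝ) • eucMonomial p (Function.update I A (I A - i)) := by
  induction i with
  | zero => simp
  | succ i ih =>
    rw [Function.iterate_succ_apply', ih, eucPartial_smul, eucPartial_monomial, smul_smul,
      Nat.descFactorial_succ]
    simp only [Function.update_self, Function.update_idem, Nat.sub_sub]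
    push_cast
    rw [mul_comm]

theorem eucPartialList_monomial (J I : Fin n → ℕ) (p : EuclideanSpace ℝ (Fin n))
    (l : List (Fin n)) (hl : l.Nodup) : eucPartialList J l (eucMonomial p I) =
      (((l.map fun A => (I A).descFactorial (J A)).prod : ℕ) : ℝ) •
        eucMonomial p (fun A => if A ∈ l then I A - J A else I A) := by
  induction l with
  | nil => simp [eucPartialList]
  | cons A l ih =>
    rw [List.nodup_cons] at hl
    have : eucPartialList J (A :: l) (eucMonomial p I) =
      (eucPartial A)^[J A] (eucPartialList J l (eucMonomial p I)) := rfl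
    rw [this, ih hl.2, eucPartial_iterate_smul, eucPartial_iterate_monomial, smul_smul, if_neg hl.1,
      List.map_cons, List.prod_cons, Nat.cast_mul, mul_comm]
    congr 2
    funext B
    by_cases h : B = A
    · subst h; simp
    · simp [h]

/-- Up to I!, monomials centred at `p` and partial derivatives at `p` are dual to each other. This
makes Taylor coefficients unique and later makes the jet frame a basis. -/
theorem multiPartial_monomial (J I : Fin n → ℕ) (p : EuclideanSpace ℝ (Fin n)) :
    multiPartial n J (eucMonomial p I) p = if J = I then ∏ A, ((I A).factorial : ℝ) else 0 := by
  have h1 : (((List.finRange n).map fun A => (I A).descFactorial (J A)).prod : ℕ) =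
      ∏ A, (I A).descFactorial (J A) := by
    rw [Fin.prod_univ_def]
  rw [multiPartial_eq, eucPartialList_monomial J I p _ (List.nodup_finRange n), h1]
  change ((∏ A, (I A).descFactorial (J A) : ℕ) : ℝ) * eucMonomial p _ p = _
  rw [eucMonomial_apply_self]
  split_ifs with h h' h'
  · subst h'
    simp [Nat.descFactorial_self]
  -- All remaining exponents are 0, so `J` dominates `I`. Since they differ, some `J A` exceeds `I
  -- A` and its descending factorial is 0.
  · obtain ⟨A, hA⟩ := Function.ne_iff.1 h'
    have h2 : I A - J A = 0 := by simpa using congrFun h A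
    rw [mul_one, Nat.cast_eq_zero]
    exact Finset.prod_eq_zero (Finset.mem_univ A) (Nat.descFactorial_of_lt (by omega))
  · exact absurd (by funext A; simp [h']) h
  · simp

variable (k : ℕ)

/-- The exponents of a multi-index. -/
def JetIndex.exp {k : ℕ} (I : JetIndex n k) : Fin n → ℕ := fun A => (I.1 A : ℕ)

theorem JetIndex.exp_injective : Function.Injective (JetIndex.exp (n := n) (k := k)) := by
  intro I J h
  apply Subtype.ext
  funext A
  exact Fin.ext (congrFun h A)

theorem JetIndex.exists_exp {I : Fin n → ℕ} (hI : ∑ A, I A ≤ k) :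
    ∃ J : JetIndex n k, J.exp = I := by
  have h : ∀ A, I A < k + 1 := fun A => Nat.lt_succ_of_le
    ((Finset.single_le_sum (fun _ _ => Nat.zero_le _) (Finset.mem_univ A)).trans hI)
  exact ⟨⟨fun A => ⟨I A, h A⟩, hI⟩, rfl⟩

/-- The product `∏ i_A!` of a multi-index. -/
def JetIndex.fact {k : ℕ} (I : JetIndex n k) : ℝ := ∏ A, ((I.exp A).factorial : ℝ)

theorem JetIndex.fact_ne_zero {k : ℕ} (I : JetIndex n k) : I.fact ≠ 0 :=
  Finset.prod_ne_zero_iff.2 fun _ _ => Nat.cast_ne_zero.2 (Nat.factorial_ne_zero _)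

/-- The polynomials of degree at most `k` in `x - p`. -/
def eucPoly (p : EuclideanSpace ℝ (Fin n)) : Submodule ℝ (EucFun n) :=
  Submodule.span ℝ (range fun I : JetIndex n k => eucMonomial p I.exp)

theorem eucCoord_mul_mem_eucPoly (p : EuclideanSpace ℝ (Fin n)) (A : Fin n) {f : EucFun n}
    (hf : f ∈ eucPoly k p) : eucCoord p A * f ∈ eucPoly (k + 1) p := by
  induction hf using Submodule.span_induction with
  | mem f hf =>
    obtain ⟨I, rfl⟩ := hf
    obtain ⟨J, hJ⟩ := JetIndex.exists_exp (k + 1) (I := I.exp + Pi.single A 1) (by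
      simp only [Pi.add_apply, Finset.sum_add_distrib, Finset.sum_pi_single']
      simp only [Finset.mem_univ, if_true]
      exact Nat.add_le_add_right I.2 1)
    refine Submodule.subset_span ⟨J, ?_⟩
    simp only [hJ, eucMonomial, Pi.add_apply, pow_add, Finset.prod_mul_distrib]
    rw [mul_comm]
    congr 1
    rw [Finset.prod_eq_single A (fun B _ hB => by simp [hB]) (by simp)]
    simp
  | zero => simp
  | add f g _ _ hf hg => rw [mul_add]; exact add_mem hf hg
  | smul c f _ hf => rw [mul_smul_comm]; exact Submodule.smul_mem _ c hf

theorem eucIdeal_decomp (p : EuclideanSpace ℝ (Fin n)) (f : EucFun n) :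
    ∃ g : Fin n → EucFun n, f = algebraMap ℝ (EucFun n) (f p) + ∑ A, eucCoord p A * g A := by
  obtain ⟨g, hg, h⟩ := hadamard_lemma f.contDiff p
  refine ⟨fun A => EucFun.mk (g A) (hg A), ?_⟩
  ext x
  rw [h x]
  have h1 := map_sum (ContMDiffMap.evalRingHom x : EucFun n →+* ℝ)
    (fun A => eucCoord p A * EucFun.mk (g A) (hg A)) Finset.univ
  exact congrArg (f p + ·) h1.symm

/-- Taylor's formula: a smooth function is a polynomial of degree `k` modulo the functions
vanishing to order `k`. -/
theorem exists_taylor (p : EuclideanSpace ℝ (Fin n)) (f : EucFun n) :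
    ∃ q ∈ eucPoly k p, f - q ∈ eucIdeal p ^ (k + 1) := by
  have hconst : ∀ (k : ℕ) (c : ℝ), algebraMap ℝ (EucFun n) c ∈ eucPoly k p := by
    intro k c
    obtain ⟨J, hJ⟩ := JetIndex.exists_exp (n := n) k (I := 0) (by simp)
    rw [Algebra.algebraMap_eq_smul_one]
    refine Submodule.smul_mem _ c (Submodule.subset_span ⟨J, ?_⟩)
    simp [hJ, eucMonomial]
  induction k generalizing f with
  | zero =>
    refine ⟨algebraMap ℝ _ (f p), hconst 0 _, ?_⟩
    rw [zero_add, pow_one, mem_eucIdeal]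
    exact sub_self (f p)
  | succ k ih =>
    -- Hadamard's lemma followed by the order `k` formula for each `g A`: multiplying the error `g A
    -- - q A` by x_A - p_A raises its order by one.
    obtain ⟨g, hg⟩ := eucIdeal_decomp p f
    choose q hq hq' using fun A => ih (g A)
    refine ⟨algebraMap ℝ _ (f p) + ∑ A, eucCoord p A * q A, add_mem (hconst _ _)
      (Submodule.sum_mem _ fun A _ => eucCoord_mul_mem_eucPoly k p A (hq A)), ?_⟩
    have : f - (algebraMap ℝ _ (f p) + ∑ A, eucCoord p A * q A) =
        ∑ A, eucCoord p A * (g A - q A) := by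
      simp only [mul_sub, Finset.sum_sub_distrib]
      rw [← sub_sub, sub_left_inj, sub_eq_iff_eq_add, add_comm]
      exact hg
    rw [this]
    refine Ideal.sum_mem _ fun A _ => ?_
    rw [pow_succ']
    exact Ideal.mul_mem_mul (eucCoord_mem p A) (hq' A)

theorem exists_taylor_coeff (p : EuclideanSpace ℝ (Fin n)) (f : EucFun n) :
    ∃ c : JetIndex n k → ℝ,
      f - ∑ I, c I • eucMonomial p I.exp ∈ eucIdeal p ^ (k + 1) := by
  obtain ⟨q, hq, h⟩ := exists_taylor k p f
  obtain ⟨c, rfl⟩ := (Submodule.mem_span_range_iff_exists_fun ℝ).1 hq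
  exact ⟨c, h⟩

theorem multiPartial_add (I : Fin n → ℕ) (f g : EucFun n) (p : EuclideanSpace ℝ (Fin n)) :
    multiPartial n I ⇑(f + g) p = multiPartial n I f p + multiPartial n I g p := by
  have hA : ∀ (A : Fin n) (i : ℕ) (f g : EucFun n), (eucPartial A)^[i] (f + g) =
      (eucPartial A)^[i] f + (eucPartial A)^[i] g := by
    intro A i f g
    induction i with
    | zero => rfl
    | succ i ih => simp only [Function.iterate_succ_apply', ih, eucPartial_add]
  have hl : ∀ l : List (Fin n), eucPartialList I l (f + g) =
      eucPartialList I l f + eucPartialList I l g := by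
    intro l
    induction l with
    | nil => rfl
    | cons A l ih =>
      simp only [eucPartialList, List.foldr_cons] at ih ⊢
      rw [ih, hA]
  rw [multiPartial_eq, multiPartial_eq, multiPartial_eq, hl]
  rfl

theorem multiPartial_smul (I : Fin n → ℕ) (c : ℝ) (f : EucFun n)
    (p : EuclideanSpace ℝ (Fin n)) :
    multiPartial n I ⇑(c • f) p = c * multiPartial n I f p := by
  have hl : ∀ l : List (Fin n), eucPartialList I l (c • f) = c • eucPartialList I l f := by
    intro l
    induction l with
    | nil => rfl
    | cons A l ih =>
      simp only [eucPartialList, List.foldr_cons] at ih ⊢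
      rw [ih, eucPartial_iterate_smul]
  rw [multiPartial_eq, multiPartial_eq, hl]
  rfl

/-- Evaluation at `p` of the partial derivative `∂_I` as a linear form. -/
def multiPartialHom (I : Fin n → ℕ) (p : EuclideanSpace ℝ (Fin n)) : EucFun n →ₗ[ℝ] ℝ where
  toFun f := multiPartial n I f p
  map_add' f g := multiPartial_add I f g p
  map_smul' c f := multiPartial_smul I c f p

/-- For the converse, duality with the monomials reads off the coefficients of the Taylor polynomial
as partial derivatives, so only the remainder survives. This translates between the algebraic and
the analytic notion of a jet. -/
theorem mem_eucIdeal_pow_iff (p : EuclideanSpace ℝ (Fin n)) (f : EucFun n) :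
    f ∈ eucIdeal p ^ (k + 1) ↔ ∀ I : JetIndex n k, multiPartial n I.exp f p = 0 := by
  refine ⟨fun hf I => multiPartial_eq_zero_of_mem I.2 hf, fun hf => ?_⟩
  obtain ⟨c, hc⟩ := exists_taylor_coeff k p f
  have hc0 : ∀ J, c J = 0 := by
    intro J
    have h1 : multiPartialHom J.exp p (f - ∑ I, c I • eucMonomial p I.exp) = 0 :=
      multiPartial_eq_zero_of_mem J.2 hc
    have h2 : multiPartialHom J.exp p f = 0 := hf J
    have h3 : ∀ I : JetIndex n k, multiPartialHom J.exp p (eucMonomial p I.exp) =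
        if J = I then I.fact else 0 := fun I => by
      refine (multiPartial_monomial J.exp I.exp p).trans ?_
      simp only [(JetIndex.exp_injective k).eq_iff]
      rfl
    rw [map_sub, h2, map_sum] at h1
    simp only [map_smul, h3, smul_eq_mul, mul_ite, mul_zero, Finset.sum_ite_eq, Finset.mem_univ,
      if_true, zero_sub, neg_eq_zero, mul_eq_zero] at h1
    exact h1.resolve_right J.fact_ne_zero
  simpa [hc0] using hc

/-- Derivatives are local, so the default values in `jetCoord` away from the domain of the section
do not matter. -/
theorem multiPartial_congr (I : Fin n → ℕ) {f g : EuclideanSpace ℝ (Fin n) → ℝ}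
    {p : EuclideanSpace ℝ (Fin n)} (h : f =ᶠ[nhds p] g) :
    multiPartial n I f p = multiPartial n I g p := by
  have hA : ∀ (A : Fin n) (i : ℕ) {f g : EuclideanSpace ℝ (Fin n) → ℝ}, f =ᶠ[nhds p] g →
      (fun u y => fderiv ℝ u y (EuclideanSpace.single A 1))^[i] f =ᶠ[nhds p]
      (fun u y => fderiv ℝ u y (EuclideanSpace.single A 1))^[i] g := by
    intro A i f g h
    induction i with
    | zero => exact h
    | succ i ih =>
      simp only [Function.iterate_succ_apply']
      exact (ih.fderiv (𝕜 := ℝ)).mono fun y hy =>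
        congrArg (fun L => L (EuclideanSpace.single A 1)) hy
  have hl : ∀ l : List (Fin n),
      l.foldr (fun A g => (fun u y => fderiv ℝ u y (EuclideanSpace.single A 1))^[I A] g) f
        =ᶠ[nhds p]
      l.foldr (fun A g => (fun u y => fderiv ℝ u y (EuclideanSpace.single A 1))^[I A] g) g := by
    intro l
    induction l with
    | nil => exact h
    | cons A l ih => exact hA A _ ih
  exact (hl _).eq_of_nhds

end Taylor

/-! ### Smoothness of frame coefficients -/

section FrameCoefficients

variable {n : ℕ} {M : Type*} [TopologicalSpace M] [ChartedSpace (EuclideanSpace ℝ (Fin n)) M]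
  {F : Type*} [NormedAddCommGroup F] [NormedSpace ℝ F] [FiniteDimensional ℝ F]
  {E : M → Type*} [TopologicalSpace (TotalSpace F E)] [∀ x, TopologicalSpace (E x)]
  [∀ x, AddCommGroup (E x)] [∀ x, Module ℝ (E x)] [FiberBundle F E] [VectorBundle ℝ F E]

/-- The coefficients of a smooth section in a smooth local frame are smooth. -/
theorem contMDiffAt_frame_coeff {ι : Type*} [Fintype ι] {s : ι → (x : M) → E x} {u : Set M}
    (hs : IsLocalFrameOn (𝓡 n) F ∞ s u) {x : M} (hu : u ∈ nhds x) {t : ∀ x, E x}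
    (ht : ContMDiffAt (𝓡 n) ((𝓡 n).prod 𝓘(ℝ, F)) ∞ (fun y => TotalSpace.mk' F y (t y)) x)
    (i : ι) : ContMDiffAt (𝓡 n) 𝓘(ℝ) ∞ (fun y => hs.coeff i y (t y)) x := by
  set e := trivializationAt F E x with he
  have hxe : x ∈ e.baseSet := mem_baseSet_trivializationAt F E x
  let φ : ι → M → F := fun i y => (e ⟨y, s i y⟩).2
  let τ : M → F := fun y => (e ⟨y, t y⟩).2
  have hφ : ∀ i, ContMDiffAt (𝓡 n) 𝓘(ℝ, F) ∞ (φ i) x := fun i =>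
    (contMDiffAt_section x).1 ((hs.contMDiffOn i).contMDiffAt hu)
  have hτ : ContMDiffAt (𝓡 n) 𝓘(ℝ, F) ∞ τ x := (contMDiffAt_section x).1 ht
  -- `L y` is the matrix of the frame in the trivialization, c ↦ Σ c_i φ_i(y). It is invertible
  -- where frame and trivialization are both defined, and the coefficients are its inverse applied
  -- to `τ y`; inversion is smooth at invertible maps.
  let L : M → ((ι → ℝ) →L[ℝ] F) := fun y =>
    ∑ i, (ContinuousLinearMap.smulRightL ℝ (ι → ℝ) F (ContinuousLinearMap.proj i)) (φ i y)
  have hL : ContMDiffAt (𝓡 n) 𝓘(ℝ, (ι → ℝ) →L[ℝ] F) ∞ L x := by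
    have hS : ContDiff ℝ ∞ (fun v : ι → F => ∑ i,
        (ContinuousLinearMap.smulRightL ℝ (ι → ℝ) F (ContinuousLinearMap.proj i)) (v i)) := by
      refine ContDiff.sum fun i _ => ?_
      exact (ContinuousLinearMap.contDiff _).comp (contDiff_apply ℝ F i)
    exact hS.contMDiff.contMDiffAt.comp x (contMDiffAt_pi_space.2 hφ)
  have hbij : ∀ y (hy : y ∈ u) (hye : y ∈ e.baseSet), L y =
      (((hs.toBasisAt hy).equivFun.symm.trans
        (e.linearEquivAt ℝ y hye)).toContinuousLinearEquiv : (ι → ℝ) →L[ℝ] F) := by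
    intro y hy hye
    ext c
    have h1 : L y c = ∑ i, c i • φ i y := by
      simp [L]
    rw [h1]
    simp only [ContinuousLinearEquiv.coe_coe, LinearEquiv.coe_toContinuousLinearEquiv',
      LinearEquiv.trans_apply, Module.Basis.equivFun_symm_apply, map_sum, map_smul,
      IsLocalFrameOn.toBasisAt_coe]
    rfl
  have key : ∀ y (hy : y ∈ u) (hye : y ∈ e.baseSet) (j : ι),
      hs.coeff j y (t y) = (L y).inverse (τ y) j := by
    intro y hy hye j
    rw [hbij y hy hye, ContinuousLinearMap.inverse_equiv, hs.coeff_apply_of_mem hy]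
    change _ = (((hs.toBasisAt hy).equivFun.symm.trans (e.linearEquivAt ℝ y hye)).symm) _ j
    have : τ y = (e.linearEquivAt ℝ y hye) (t y) := rfl
    rw [this, LinearEquiv.trans_symm, LinearEquiv.trans_apply, LinearEquiv.symm_apply_apply]
    rfl
  have hev : (fun y => hs.coeff i y (t y)) =ᶠ[nhds x] fun y => (L y).inverse (τ y) i := by
    filter_upwards [hu, e.open_baseSet.mem_nhds hxe] with y hy hye using key y hy hye i
  refine ContMDiffAt.congr_of_eventuallyEq ?_ hev
  have hinv : ContMDiffAt (𝓡 n) 𝓘(ℝ, F →L[ℝ] (ι → ℝ)) ∞ (fun y => (L y).inverse) x := by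
    have h2 : ContDiffAt ℝ ∞ ContinuousLinearMap.inverse (L x) := by
      rw [hbij x (mem_of_mem_nhds hu) hxe]
      exact contDiffAt_map_inverse _
    exact h2.contMDiffAt.comp x hL
  exact contMDiffAt_pi_space.1 (hinv.clm_apply hτ) i

variable (n F E) in
open scoped Classical in
/-- The extension by zero of a section. -/
def extendSec (U : Opens M) (ψ : Sections n F E U) : ∀ x, E x :=
  fun x => if h : x ∈ U then ψ.1 ⟨x, h⟩ else 0

theorem extendSec_apply {U : Opens M} (ψ : Sections n F E U) {x : M} (h : x ∈ U) :
    extendSec n F E U ψ x = ψ.1 ⟨x, h⟩ := dif_pos h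

theorem contMDiffAt_extendSec {U : Opens M} (ψ : Sections n F E U) {x : M} (h : x ∈ U) :
    ContMDiffAt (𝓡 n) ((𝓡 n).prod 𝓘(ℝ, F)) ∞
      (fun y => TotalSpace.mk' F y (extendSec n F E U ψ y)) x := by
  have h1 := (show IsSmoothSection n F U ψ.1 from ψ.2) ⟨x, h⟩
  refine (contMDiffAt_subtype_iff (U := U) (x := ⟨x, h⟩)).1 (h1.congr_of_eventuallyEq ?_)
  exact Filter.Eventually.of_forall fun y => by
    simp [extendSec_apply ψ y.2]

/-- A smooth function at all points of `U` restricts to an element of `C^∞(U)`. -/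
def cinfOfContMDiffAt (U : Opens M) (f : M → ℝ)
    (hf : ∀ x ∈ U, ContMDiffAt (𝓡 n) 𝓘(ℝ) ∞ f x) : Cinf n U :=
  ⟨fun x => f x, fun x => contMDiffAt_subtype_iff.2 (hf x x.2)⟩

variable {ι : Type*} [Fintype ι] {s : ι → (x : M) → E x} {u : Set M}
  (hs : IsLocalFrameOn (𝓡 n) F ∞ s u) {U : Opens M} (hU : (U : Set M) ⊆ u)

/-- The sections of a local frame over an open subset of its domain. -/
def frameSec (i : ι) : Sections n F E U :=
  ⟨fun x => s i x, fun x =>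
    (contMDiffAt_subtype_iff (f := fun x => TotalSpace.mk' F x (s i x))).2
      ((hs.mono hU).contMDiffAt U.2 x.2 i)⟩

/-- The coefficient functions of a section in a local frame. -/
def frameCoeff (ψ : Sections n F E U) (i : ι) : Cinf n U :=
  cinfOfContMDiffAt U (fun y => hs.coeff i y (extendSec n F E U ψ y)) fun _ hx =>
    contMDiffAt_frame_coeff hs (Filter.mem_of_superset (U.2.mem_nhds hx) hU)
      (contMDiffAt_extendSec ψ hx) i

theorem frameCoeff_apply (ψ : Sections n F E U) (i : ι) (x : U) :
    frameCoeff hs hU ψ i x = hs.coeff i x (ψ.1 x) := by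
  change hs.coeff i x (extendSec n F E U ψ x) = _
  rw [extendSec_apply ψ x.2]

variable (n F E) in
/-- Evaluation of sections at a point. -/
def evalSec (x : U) : Sections n F E U →+ E (x : M) where
  toFun ψ := ψ.1 x
  map_zero' := rfl
  map_add' _ _ := rfl

theorem sum_frameCoeff_smul (ψ : Sections n F E U) :
    ∑ i, frameCoeff hs hU ψ i • frameSec hs hU i = ψ := by
  apply Subtype.ext
  funext x
  change evalSec n F E x (∑ i, frameCoeff hs hU ψ i • frameSec hs hU i) = _
  rw [map_sum]
  have h := hs.coeff_sum_eq (extendSec n F E U ψ) (hU x.2)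
  rw [extendSec_apply ψ x.2] at h
  rw [h]
  refine Finset.sum_congr rfl fun i _ => ?_
  change frameCoeff hs hU ψ i x • s i x = _
  rw [frameCoeff_apply]

theorem coeff_sum_smul_frameSec (f : ι → Cinf n U) (i : ι) (x : U) :
    hs.coeff i x ((∑ j, f j • frameSec hs hU j : Sections n F E U).1 x) = f i x := by
  have h : (∑ j, f j • frameSec hs hU j : Sections n F E U).1 x = ∑ j, f j x • s j x :=
    map_sum (evalSec n F E x) _ _
  classical
  have hc : hs.coeff i (x : M) = (hs.toBasisAt (hU x.2)).coord i := dif_pos (hU x.2)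
  rw [h, hc]
  have h' : ∀ j, s j x = hs.toBasisAt (hU x.2) j := fun j => by simp
  simp only [h', map_sum, map_smul, Module.Basis.coord_apply, Module.Basis.repr_self]
  simp [Finsupp.single_apply]

end FrameCoefficients

/-! ### Functions in a chart -/

section Charts

variable {n : ℕ}

/-- A function that is smooth near a point agrees near that point with a globally smooth one. -/
theorem exists_eucFun_eventuallyEq {f : EuclideanSpace ℝ (Fin n) → ℝ}
    {s : Set (EuclideanSpace ℝ (Fin n))} (hs : IsOpen s) (hf : ContDiffOn ℝ ∞ f s)
    {y : EuclideanSpace ℝ (Fin n)} (hy : y ∈ s) : ∃ g : EucFun n, ⇑g =ᶠ[nhds y] f := by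
  obtain ⟨r, hr, hrs⟩ := Metric.nhds_basis_closedBall.mem_iff.1 (hs.mem_nhds hy)
  -- The cutoff is 1 near `y` and its closed support, a ball of radius `r`, lies in `s`, so the
  -- product extends by zero.
  let b : ContDiffBump y := ⟨r / 2, r, by linarith, by linarith⟩
  refine ⟨EucFun.mk (fun x => b x * f x) (contDiff_iff_contDiffAt.2 fun x => ?_), ?_⟩
  · by_cases hx : x ∈ s
    · exact b.contDiff.contDiffAt.mul (hf.contDiffAt (hs.mem_nhds hx))
    · have h1 : (tsupport b)ᶜ ∈ nhds x := by
        refine (isClosed_tsupport _).isOpen_compl.mem_nhds fun h => hx (hrs ?_)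
        rwa [b.tsupport_eq] at h
      refine (contDiffAt_const (c := (0 : ℝ))).congr_of_eventuallyEq ?_
      filter_upwards [h1] with z hz
      rw [image_eq_zero_of_notMem_tsupport hz, zero_mul]
  · filter_upwards [b.eventuallyEq_one] with z hz
    simp [hz]

/-- Near each point `f` may be replaced by a globally smooth function, for which the partial
derivatives stay in the ring. -/
theorem contDiffOn_multiPartial (I : Fin n → ℕ) {f : EuclideanSpace ℝ (Fin n) → ℝ}
    {s : Set (EuclideanSpace ℝ (Fin n))} (hs : IsOpen s) (hf : ContDiffOn ℝ ∞ f s) :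
    ContDiffOn ℝ ∞ (multiPartial n I f) s := by
  intro y hy
  obtain ⟨g, hg⟩ := exists_eucFun_eventuallyEq hs hf hy
  refine ContDiffAt.contDiffWithinAt ?_
  have h : multiPartial n I f =ᶠ[nhds y] multiPartial n I g := by
    filter_upwards [hg.eventuallyEq_nhds] with z hz
    exact (multiPartial_congr I hz).symm
  refine ContDiffAt.congr_of_eventuallyEq ?_ h
  rw [multiPartial_eq]
  exact (EucFun.contDiff _).contDiffAt

variable {M : Type*} [TopologicalSpace M] [ChartedSpace (EuclideanSpace ℝ (Fin n)) M]
  [IsManifold (𝓡 n) ∞ M]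

/-- The domain of a chart as an open set. -/
def chartOpens (e : OpenPartialHomeomorph M (EuclideanSpace ℝ (Fin n))) : Opens M :=
  ⟨e.source, e.open_source⟩

variable {e : OpenPartialHomeomorph M (EuclideanSpace ℝ (Fin n))}
  (he : e ∈ IsManifold.maximalAtlas (𝓡 n) ∞ M)

/-- The pullback of smooth functions along a chart. -/
def chartPull : EucFun n →ₐ[ℝ] Cinf n (chartOpens e) where
  toFun f := cinfOfContMDiffAt (chartOpens e) (fun x => f (e x)) fun x hx =>
    f.contMDiff.contMDiffAt.comp x (contMDiffAt_of_mem_maximalAtlas he hx)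
  map_one' := rfl
  map_mul' _ _ := rfl
  map_zero' := rfl
  map_add' _ _ := rfl
  commutes' _ := rfl

/-- Since the chart is onto ℝ^n, f ∘ e⁻¹ is defined everywhere. Taylor's formula thus applies to all
of C^∞(U) without shrinking `U`, as needed for statements about the presheaf itself. -/
theorem chartPull_surjective (htarget : e.target = univ) :
    Function.Surjective (chartPull he) := by
  intro f
  have hmem : ∀ y, e.symm y ∈ chartOpens e := fun y => e.map_target (htarget ▸ mem_univ y)
  have hsm : ContMDiff (𝓡 n) (𝓡 n) ∞ (fun y => (⟨e.symm y, hmem y⟩ : chartOpens e)) := by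
    rw [← ContMDiff.subtypeVal_comp_iff]
    exact fun y => contMDiffAt_symm_of_mem_maximalAtlas he (htarget ▸ mem_univ y)
  refine ⟨⟨fun y => f ⟨e.symm y, hmem y⟩, f.contMDiff.comp hsm⟩, ?_⟩
  ext x
  change f ⟨e.symm (e x), _⟩ = f x
  congr 1
  exact Subtype.ext (e.left_inv x.2)

variable (F : Type*) [NormedAddCommGroup F] [NormedSpace ℝ F] [FiniteDimensional ℝ F]
  (E : M → Type*) [TopologicalSpace (TotalSpace F E)] [∀ x, TopologicalSpace (E x)]
  [∀ x, AddCommGroup (E x)] [∀ x, Module ℝ (E x)] [FiberBundle F E] [VectorBundle ℝ F E]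
  [ContMDiffVectorBundle ∞ F E (𝓡 n)]

/-- Small charts onto `ℝ^n` form a basis of the topology. -/
theorem exists_chart_target_univ (x : M) {W : Set M} (hW : W ∈ nhds x) :
    ∃ e ∈ IsManifold.maximalAtlas (𝓡 n) ∞ M, x ∈ e.source ∧ e.source ⊆ W ∧
      e.target = univ := by
  set e₀ := chartAt (EuclideanSpace ℝ (Fin n)) x with he₀
  have hx : x ∈ e₀.source := mem_chart_source _ x
  have hN : e₀.target ∩ e₀.symm ⁻¹' W ∈ nhds (e₀ x) := by
    refine Filter.inter_mem (e₀.open_target.mem_nhds (e₀.map_source hx)) ?_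
    refine e₀.symm.continuousAt (e₀.map_source hx) ?_
    rwa [e₀.left_inv hx]
  obtain ⟨r, hr, hrN⟩ := Metric.mem_nhds_iff.1 hN
  -- A smooth identification of ℝ^n with a small ball inside the chart; composing with its inverse
  -- makes the chart surjective.
  set b := OpenPartialHomeomorph.univBall (e₀ x) r
  have hbt : b.target = Metric.ball (e₀ x) r := OpenPartialHomeomorph.univBall_target _ hr
  have hbs : b.source = univ := OpenPartialHomeomorph.univBall_source _ r
  have hb : ∀ y, b y ∈ Metric.ball (e₀ x) r := fun y => hbt ▸ b.map_source (hbs ▸ mem_univ y)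
  have hsrc : (e₀ ≫ₕ b.symm).source = e₀.source ∩ e₀ ⁻¹' Metric.ball (e₀ x) r := by
    rw [OpenPartialHomeomorph.trans_source, OpenPartialHomeomorph.symm_source, hbt]
  have htgt : (e₀ ≫ₕ b.symm).target = univ := by
    rw [OpenPartialHomeomorph.trans_target, OpenPartialHomeomorph.symm_target, hbs, univ_inter]
    exact eq_univ_of_forall fun y => (hrN (hb y)).1
  have he₀m : e₀ ∈ IsManifold.maximalAtlas (𝓡 n) ∞ M := IsManifold.chart_mem_maximalAtlas x
  refine ⟨e₀ ≫ₕ b.symm, OpenPartialHomeomorph.mem_maximalAtlas_of_contMDiffOn _ ?_ ?_, ?_, ?_,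
    htgt⟩
  · rw [hsrc]
    have h1 : ContMDiffOn (𝓡 n) (𝓡 n) ∞ b.symm (Metric.ball (e₀ x) r) :=
      OpenPartialHomeomorph.contDiffOn_univBall_symm.contMDiffOn
    exact h1.comp ((contMDiffOn_of_mem_maximalAtlas he₀m).mono inter_subset_left)
      inter_subset_right
  · rw [htgt]
    have h1 : ContMDiff (𝓡 n) (𝓡 n) ∞ b :=
      OpenPartialHomeomorph.contDiff_univBall.contMDiff
    exact (contMDiffOn_symm_of_mem_maximalAtlas he₀m).comp h1.contMDiffOn
      fun y _ => (hrN (hb y)).1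
  · rw [hsrc]
    exact ⟨hx, Metric.mem_ball_self hr⟩
  · rw [hsrc]
    rintro z ⟨hz, hzb⟩
    have := (hrN hzb).2
    rwa [mem_preimage, e₀.left_inv hz] at this

theorem exists_framed_chart (x : M) {W : Set M} (hW : W ∈ nhds x) :
    ∃ e ∈ IsManifold.maximalAtlas (𝓡 n) ∞ M, x ∈ e.source ∧ e.source ⊆ W ∧
      e.target = univ ∧ ∃ Φ : Fin (Module.finrank ℝ F) → (x : M) → E x,
        IsLocalFrameOn (𝓡 n) F ∞ Φ e.source := by
  set t := trivializationAt F E x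
  obtain ⟨e, he, hx, heW, htgt⟩ := exists_chart_target_univ (n := n) x
    (Filter.inter_mem hW (t.open_baseSet.mem_nhds (mem_baseSet_trivializationAt F E x)))
  exact ⟨e, he, hx, heW.trans inter_subset_left, htgt, t.localFrame (Module.finBasis ℝ F),
    (t.isLocalFrameOn_localFrame_baseSet (𝓡 n) ∞ _).mono (heW.trans inter_subset_right)⟩

end Charts

/-! ### Germs -/

section Germs

variable {n : ℕ} {M : Type*} [TopologicalSpace M] [ChartedSpace (EuclideanSpace ℝ (Fin n)) M]

namespace ModPresheaf

variable (P : ModPresheaf n M)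

theorem exists_germ {a : M} (x : P.Stalk a) :
    ∃ (U : Opens M) (ha : a ∈ U) (s : P.obj U), x = P.germ U ⟨a, ha⟩ s := by
  obtain ⟨U, s, rfl⟩ := DirectLimit.exists_eq_mk _ x
  exact ⟨_, (OrderDual.ofDual U).mem, s, rfl⟩

theorem exists_res_eq_of_germ_eq {U V : Opens M} {a : M} (hU : a ∈ U) (hV : a ∈ V) {s : P.obj U}
    {t : P.obj V} (h : P.germ U ⟨a, hU⟩ s = P.germ V ⟨a, hV⟩ t) :
    ∃ (W : Opens M) (hWU : W ≤ U) (hWV : W ≤ V), a ∈ W ∧ P.res hWU s = P.res hWV t := by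
  obtain ⟨W, h1, h2, h3⟩ := Quotient.exact h
  exact ⟨(OrderDual.ofDual W).toOpens, h1, h2, (OrderDual.ofDual W).mem, h3⟩

theorem value_surjective {a : M} (v : P.Fiber a) :
    ∃ (U : Opens M) (ha : a ∈ U) (s : P.obj U), v = P.value U ⟨a, ha⟩ s := by
  obtain ⟨x, rfl⟩ := Submodule.Quotient.mk_surjective _ v
  obtain ⟨U, ha, s, rfl⟩ := P.exists_germ x
  exact ⟨U, ha, s, rfl⟩

theorem value_res {U V : Opens M} (h : V ≤ U) (a : V) (s : P.obj U) :
    P.value V a (P.res h s) = P.value U ⟨a.1, h a.2⟩ s :=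
  congrArg Submodule.Quotient.mk (P.germ_res h a s)

theorem value_add {U : Opens M} (a : U) (s t : P.obj U) :
    P.value U a (s + t) = P.value U a s + P.value U a t := by
  unfold value
  rw [map_add]
  rfl

end ModPresheaf

theorem exists_funGerm {a : M} (x : FunStalk n a) :
    ∃ (U : Opens M) (ha : a ∈ U) (f : Cinf n U), x = funGerm n U ⟨a, ha⟩ f := by
  obtain ⟨U, s, rfl⟩ := DirectLimit.exists_eq_mk _ x
  exact ⟨_, (OrderDual.ofDual U).mem, s, rfl⟩

theorem algebraMap_funStalk (U : Opens M) (a : U) (c : ℝ) :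
    algebraMap ℝ (FunStalk n (a : M)) c = funGerm n U a (algebraMap ℝ (Cinf n U) c) :=
  DirectLimit.map₀_def (resFunNhds n (a : M))
    (fun U => algebraMap ℝ (Cinf n (OrderDual.ofDual U).toOpens) c) (fun _ _ _ => rfl)
    (OrderDual.toDual ⟨U, a.2⟩)

theorem evalStalk_algebraMap (a : M) (c : ℝ) :
    evalStalk n a (algebraMap ℝ (FunStalk n a) c) = c := by
  rw [algebraMap_funStalk ⊤ ⟨a, trivial⟩ c]
  rfl

theorem exists_open_of_eventually {a : M} {p : M → Prop} (h : ∀ᶠ x in nhds a, p x)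
    (U : Opens M) (ha : a ∈ U) : ∃ W : Opens M, W ≤ U ∧ a ∈ W ∧ ∀ x ∈ W, p x := by
  obtain ⟨s, hs, hso, has⟩ := eventually_nhds_iff.1 h
  exact ⟨⟨s, hso⟩ ⊓ U, inf_le_right, ⟨has, ha⟩, fun x hx => hs x hx.1⟩

theorem funGerm_eq {U V : Opens M} {a : M} (hU : a ∈ U) (hV : a ∈ V) {f : Cinf n U}
    {g : Cinf n V} (h : ∀ᶠ x in nhds a, ∀ (h1 : x ∈ U) (h2 : x ∈ V), f ⟨x, h1⟩ = g ⟨x, h2⟩) :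
    funGerm n U ⟨a, hU⟩ f = funGerm n V ⟨a, hV⟩ g := by
  obtain ⟨W, hW, haW, hp⟩ := exists_open_of_eventually h (U ⊓ V) ⟨hU, hV⟩
  rw [← funGerm_res n (hW.trans inf_le_left) ⟨a, haW⟩ f,
    ← funGerm_res n (hW.trans inf_le_right) ⟨a, haW⟩ g]
  congr 1
  ext x
  exact hp x x.2 _ _

variable (F : Type*) [NormedAddCommGroup F] [NormedSpace ℝ F]
  (E : M → Type*) [TopologicalSpace (TotalSpace F E)] [∀ x, TopologicalSpace (E x)]
  [∀ x, AddCommGroup (E x)] [∀ x, Module ℝ (E x)] [FiberBundle F E] [VectorBundle ℝ F E]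

variable {F E} in
theorem secGerm_eq {U V : Opens M} {a : M} (hU : a ∈ U) (hV : a ∈ V) {s : Sections n F E U}
    {t : Sections n F E V}
    (h : ∀ᶠ x in nhds a, ∀ (h1 : x ∈ U) (h2 : x ∈ V), s.1 ⟨x, h1⟩ = t.1 ⟨x, h2⟩) :
    (secSheaf n F E).germ U ⟨a, hU⟩ s = (secSheaf n F E).germ V ⟨a, hV⟩ t := by
  obtain ⟨W, hW, haW, hp⟩ := exists_open_of_eventually h (U ⊓ V) ⟨hU, hV⟩
  rw [← (secSheaf n F E).germ_res (hW.trans inf_le_left) ⟨a, haW⟩ s,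
    ← (secSheaf n F E).germ_res (hW.trans inf_le_right) ⟨a, haW⟩ t]
  congr 1
  apply Subtype.ext
  funext x
  exact hp x x.2 _ _

theorem jetAt_add (k : ℕ) (U : Opens M) (a : U) (ψ χ : Sections n F E U) :
    jetAt n F E k U a (ψ + χ) = jetAt n F E k U a ψ + jetAt n F E k U a χ := by
  unfold jetAt
  rw [show (secSheaf n F E).germ U a (ψ + χ) = (secSheaf n F E).germ U a ψ +
    (secSheaf n F E).germ U a χ from map_add ((secSheaf n F E).germ U a) ψ χ]
  rfl

theorem jetAt_smul (k : ℕ) (U : Opens M) (a : U) (c : ℝ) (ψ : Sections n F E U) :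
    jetAt n F E k U a (c • ψ) = c • jetAt n F E k U a ψ := by
  change _ = algebraMap ℝ (FunStalk n (a : M)) c • jetAt n F E k U a ψ
  rw [algebraMap_funStalk U a c]
  exact congrArg Submodule.Quotient.mk
    ((secSheaf n F E).germ_smul a (algebraMap ℝ (Cinf n U) c) ψ)

/-- The `k`-jet at a point as a linear map. -/
def jetAtHom (k : ℕ) (U : Opens M) (a : U) :
    Sections n F E U →ₗ[ℝ] JetSpace n F E k (a : M) where
  toFun := jetAt n F E k U a
  map_add' := jetAt_add F E k U a
  map_smul' := jetAt_smul F E k U a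

theorem jetAt_res (k : ℕ) {U V : Opens M} (h : V ≤ U) (a : V) (ψ : Sections n F E U) :
    jetAt n F E k V a (resSec n F E h ψ) = jetAt n F E k U ⟨a.1, h a.2⟩ ψ :=
  congrArg Submodule.Quotient.mk ((secSheaf n F E).germ_res h a ψ)

variable {F E} in
theorem exists_secGerm {a : M} (x : (secSheaf n F E).Stalk a) :
    ∃ (U : Opens M) (ha : a ∈ U) (ψ : Sections n F E U),
      x = (secSheaf n F E).germ U ⟨a, ha⟩ ψ :=
  (secSheaf n F E).exists_germ x

theorem exists_jetAt (k : ℕ) {a : M} (v : JetSpace n F E k a) :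
    ∃ (U : Opens M) (ha : a ∈ U) (ψ : Sections n F E U), v = jetAt n F E k U ⟨a, ha⟩ ψ := by
  obtain ⟨x, rfl⟩ := Submodule.Quotient.mk_surjective _ v
  obtain ⟨U, ha, s, rfl⟩ := (secSheaf n F E).exists_germ x
  exact ⟨U, ha, s, rfl⟩

end Germs

/-! ### Jets in a chart with a local frame -/

section JetCoordinates

variable {n : ℕ} {M : Type*} [TopologicalSpace M] [ChartedSpace (EuclideanSpace ℝ (Fin n)) M]
  [IsManifold (𝓡 n) ∞ M]
  {e : OpenPartialHomeomorph M (EuclideanSpace ℝ (Fin n))}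
  (he : e ∈ IsManifold.maximalAtlas (𝓡 n) ∞ M)

theorem eventually_of_chart {a : M} (ha : a ∈ e.source)
    {f g : EuclideanSpace ℝ (Fin n) → ℝ} (h : f =ᶠ[nhds (e a)] g) :
    ∀ᶠ x in nhds a, f (e x) = g (e x) :=
  (e.continuousAt ha).eventually h

theorem exists_eventually_chart_eq
    (he : e ∈ IsManifold.maximalAtlas (𝓡 n) ∞ M) {U : Opens M} (f : Cinf n U)
    {a : M} (ha : a ∈ e.source) (haU : a ∈ U) : ∃ g : EucFun n, ∀ᶠ x in nhds a, ∀ h : x ∈ U, g (e x) = f ⟨x, h⟩ := by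
  classical
  let f' : M → ℝ := fun x => if h : x ∈ U then f ⟨x, h⟩ else 0
  have hf' : ∀ x ∈ U, ContMDiffAt (𝓡 n) 𝓘(ℝ) ∞ f' x := fun x hx => by
    refine (contMDiffAt_subtype_iff (U := U) (x := ⟨x, hx⟩)).1 ?_
    refine (f.contMDiff ⟨x, hx⟩).congr_of_eventuallyEq (Filter.Eventually.of_forall fun y => ?_)
    simp [f']
  have hs : IsOpen (e.target ∩ e.symm ⁻¹' U) := e.isOpen_inter_preimage_symm U.2
  have hcont : ContDiffOn ℝ ∞ (f' ∘ e.symm) (e.target ∩ e.symm ⁻¹' U) := by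
    rw [← contMDiffOn_iff_contDiffOn]
    exact fun y hy => ((hf' _ hy.2).comp y
      (contMDiffAt_symm_of_mem_maximalAtlas he hy.1)).contMDiffWithinAt
  obtain ⟨g, hg⟩ := exists_eucFun_eventuallyEq hs hcont (y := e a)
    ⟨e.map_source ha, by rw [mem_preimage, e.left_inv ha]; exact haU⟩
  refine ⟨g, ?_⟩
  filter_upwards [eventually_of_chart ha hg, e.open_source.mem_nhds ha] with x hx hxe h
  rw [hx, Function.comp_apply, e.left_inv hxe]
  exact dif_pos h

/-- The germ at `a` of the pullback of a smooth function on `ℝ^n` along a chart. -/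
def chartGerm (a : chartOpens e) : EucFun n →+* FunStalk n (a : M) :=
  (funGerm n (chartOpens e) a).comp (chartPull he : EucFun n →+* Cinf n (chartOpens e))

theorem chartGerm_surjective (a : chartOpens e) : Function.Surjective (chartGerm he a) := by
  intro x
  obtain ⟨U, haU, f, rfl⟩ := exists_funGerm x
  obtain ⟨g, hg⟩ := exists_eventually_chart_eq he f a.2 haU
  refine ⟨g, funGerm_eq a.2 haU ?_⟩
  filter_upwards [hg] with x hx _ h2 using hx h2

/-- Every germ is the germ of a pulled back global function. Powers of the maximal ideal are hence
images of powers of `eucIdeal`, and the Taylor results carry over to stalks. -/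
theorem maxIdeal_eq_map (a : chartOpens e) :
    maxIdeal n (a : M) = (eucIdeal (e a)).map (chartGerm he a) := by
  refine le_antisymm (fun x hx => ?_) (Ideal.map_le_iff_le_comap.2 fun g hg => hg)
  obtain ⟨g, rfl⟩ := chartGerm_surjective he a x
  exact Ideal.mem_map_of_mem _ hx

variable {F : Type*} [NormedAddCommGroup F] [NormedSpace ℝ F] [FiniteDimensional ℝ F]
  {E : M → Type*} [TopologicalSpace (TotalSpace F E)] [∀ x, TopologicalSpace (E x)]
  [∀ x, AddCommGroup (E x)] [∀ x, Module ℝ (E x)] [FiberBundle F E] [VectorBundle ℝ F E]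
  {Φ : Fin (Module.finrank ℝ F) → (x : M) → E x}
  (hΦ : IsLocalFrameOn (𝓡 n) F ∞ Φ e.source)

/-- The section with components `G` in a chart with a local frame. -/
def chartSec (G : Fin (Module.finrank ℝ F) → EucFun n) : Sections n F E (chartOpens e) :=
  ∑ i, chartPull he (G i) • frameSec hΦ (U := chartOpens e) subset_rfl i

theorem chartSec_add (G H : Fin (Module.finrank ℝ F) → EucFun n) :
    chartSec he hΦ (G + H) = chartSec he hΦ G + chartSec he hΦ H := by
  simp only [chartSec, Pi.add_apply, map_add, add_smul, Finset.sum_add_distrib]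

theorem chartSec_mul (g : EucFun n) (G : Fin (Module.finrank ℝ F) → EucFun n) :
    chartSec he hΦ (fun i => g * G i) = chartPull he g • chartSec he hΦ G := by
  simp only [chartSec, map_mul, mul_smul, Finset.smul_sum]

theorem chartSec_smul (c : ℝ) (G : Fin (Module.finrank ℝ F) → EucFun n) :
    chartSec he hΦ (c • G) = c • chartSec he hΦ G := by
  have h := chartSec_mul he hΦ (algebraMap ℝ (EucFun n) c) G
  have h' : (fun i => algebraMap ℝ (EucFun n) c * G i) = c • G := by
    funext i
    rw [Pi.smul_apply, Algebra.smul_def]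
  rw [h'] at h
  rw [h, AlgHom.commutes]
  rfl

/-- Sections in a chart with a local frame in terms of their components. -/
def chartSecHom : (Fin (Module.finrank ℝ F) → EucFun n) →ₗ[ℝ] Sections n F E (chartOpens e) where
  toFun := chartSec he hΦ
  map_add' := chartSec_add he hΦ
  map_smul' := chartSec_smul he hΦ

theorem coeff_chartSec (G : Fin (Module.finrank ℝ F) → EucFun n) (i : Fin (Module.finrank ℝ F))
    (x : chartOpens e) : hΦ.coeff i x ((chartSec he hΦ G).1 x) = G i (e x) :=
  coeff_sum_smul_frameSec hΦ (U := chartOpens e) subset_rfl (fun i => chartPull he (G i)) i x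

theorem chartSec_surjective (htarget : e.target = univ) :
    Function.Surjective (chartSec he hΦ) := by
  intro ψ
  choose G hG using fun i => chartPull_surjective he htarget
    (frameCoeff hΦ (U := chartOpens e) subset_rfl ψ i)
  refine ⟨G, ?_⟩
  simp only [chartSec, hG]
  exact sum_frameCoeff_smul hΦ subset_rfl ψ

/-- The frame coefficients are cut off in the chart, so that the components become global functions
on ℝ^n without changing the germ. -/
theorem exists_germ_chartSec (a : chartOpens e) (x : (secSheaf n F E).Stalk (a : M)) :
    ∃ G, x = (secSheaf n F E).germ (chartOpens e) a (chartSec he hΦ G) := by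
  obtain ⟨U, haU, ψ, rfl⟩ := exists_secGerm x
  have hU' : ((U ⊓ chartOpens e : Opens M) : Set M) ⊆ e.source := inter_subset_right
  choose G hG using fun i => exists_eventually_chart_eq he
    (frameCoeff hΦ hU' (resSec n F E inf_le_left ψ) i) a.2 (a := (a : M)) ⟨haU, a.2⟩
  refine ⟨G, secGerm_eq haU a.2 ?_⟩
  filter_upwards [Filter.eventually_all.2 hG] with x hx h1 h2
  have h3 := hΦ.eq_of_coeff_eq h2 (t := extendSec n F E U ψ)
    (t' := extendSec n F E _ (chartSec he hΦ G)) fun i => by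
      rw [extendSec_apply _ h1, extendSec_apply _ h2, coeff_chartSec he hΦ G i ⟨x, h2⟩]
      refine Eq.trans ?_ (hx i ⟨h1, h2⟩).symm
      rw [frameCoeff_apply]
      rfl
  rwa [extendSec_apply _ h1, extendSec_apply _ h2] at h3

variable (k : ℕ)

theorem jetCoord_res {U V : Opens M} (h : V ≤ U) (a : V) (ha : (a : M) ∈ e.source)
    (ψ : Sections n F E U) :
    jetCoord n F E k e hΦ V a (resSec n F E h ψ) =
      jetCoord n F E k e hΦ U ⟨a.1, h a.2⟩ ψ := by
  funext p
  refine multiPartial_congr _ ?_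
  have h1 : ∀ᶠ y in nhds (e (a : M)), e.symm y ∈ V :=
    (e.symm.continuousAt (e.map_source ha)).eventually
      (V.2.mem_nhds (by rw [e.left_inv ha]; exact a.2))
  filter_upwards [h1] with y hy
  rw [dif_pos hy, dif_pos (h hy)]
  rfl

theorem jetCoord_eq_of_germ_eq {U V : Opens M} {a : M} (hU : a ∈ U) (hV : a ∈ V)
    (ha : a ∈ e.source) {ψ : Sections n F E U} {χ : Sections n F E V}
    (h : (secSheaf n F E).germ U ⟨a, hU⟩ ψ = (secSheaf n F E).germ V ⟨a, hV⟩ χ) :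
    jetCoord n F E k e hΦ U ⟨a, hU⟩ ψ = jetCoord n F E k e hΦ V ⟨a, hV⟩ χ := by
  obtain ⟨W, hWU, hWV, haW, hW⟩ := (secSheaf n F E).exists_res_eq_of_germ_eq hU hV h
  rw [← jetCoord_res hΦ k hWU ⟨a, haW⟩ ha ψ, ← jetCoord_res hΦ k hWV ⟨a, haW⟩ ha χ]
  exact congrArg (jetCoord n F E k e hΦ W ⟨a, haW⟩) hW

theorem jetCoord_chartSec (G : Fin (Module.finrank ℝ F) → EucFun n) (a : chartOpens e)
    (p : Fin (Module.finrank ℝ F) × JetIndex n k) :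
    jetCoord n F E k e hΦ (chartOpens e) a (chartSec he hΦ G) p =
      multiPartial n p.2.exp (G p.1) (e a) := by
  refine multiPartial_congr _ ?_
  filter_upwards [e.open_target.mem_nhds (e.map_source a.2)] with y hy
  rw [dif_pos (show e.symm y ∈ chartOpens e from e.map_target hy)]
  have := coeff_chartSec he hΦ G p.1 ⟨e.symm y, e.map_target hy⟩
  rwa [e.right_inv hy] at this

theorem germ_chartSec_mul (a : chartOpens e) (g : EucFun n)
    (G : Fin (Module.finrank ℝ F) → EucFun n) :
    (secSheaf n F E).germ (chartOpens e) a (chartSec he hΦ (fun i => g * G i)) =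
      chartGerm he a g • (secSheaf n F E).germ (chartOpens e) a (chartSec he hΦ G) := by
  rw [chartSec_mul]
  exact (secSheaf n F E).germ_smul a (chartPull he g) (chartSec he hΦ G)

theorem germ_chartSec_add (a : chartOpens e) (G H : Fin (Module.finrank ℝ F) → EucFun n) :
    (secSheaf n F E).germ (chartOpens e) a (chartSec he hΦ (G + H)) =
      (secSheaf n F E).germ (chartOpens e) a (chartSec he hΦ G) +
      (secSheaf n F E).germ (chartOpens e) a (chartSec he hΦ H) := by
  rw [chartSec_add]
  exact map_add ((secSheaf n F E).germ (chartOpens e) a) _ _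

/-- A germ has vanishing `k`-jet if and only if its components do. -/
theorem germ_chartSec_mem_iff (a : chartOpens e) (G : Fin (Module.finrank ℝ F) → EucFun n) :
    (secSheaf n F E).germ (chartOpens e) a (chartSec he hΦ G) ∈
      (maxIdeal n (a : M) ^ (k + 1) • ⊤ :
        Submodule (FunStalk n (a : M)) ((secSheaf n F E).Stalk (a : M))) ↔
      ∀ i, G i ∈ eucIdeal (e a) ^ (k + 1) := by
  constructor
  · intro h
    -- An element of the submodule is represented by some components `H` in the ideal power. `G` and
    -- `H` agree only as germs, so the conclusion for `G` passes through the partial derivatives at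
    -- the point.
    have key : ∀ x ∈ (maxIdeal n (a : M) ^ (k + 1) • ⊤ :
        Submodule (FunStalk n (a : M)) ((secSheaf n F E).Stalk (a : M))),
        ∃ H : Fin (Module.finrank ℝ F) → EucFun n,
          (∀ i, H i ∈ eucIdeal (e a) ^ (k + 1)) ∧
          x = (secSheaf n F E).germ (chartOpens e) a (chartSec he hΦ H) := by
      intro x hx
      refine Submodule.smul_induction_on hx (fun f hf s _ => ?_) ?_
      · rw [maxIdeal_eq_map he a, ← Ideal.map_pow,
          Ideal.mem_map_iff_of_surjective _ (chartGerm_surjective he a)] at hf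
        obtain ⟨g, hg, rfl⟩ := hf
        obtain ⟨H, rfl⟩ := exists_germ_chartSec he hΦ a s
        exact ⟨fun i => g * H i, fun i => Ideal.mul_mem_right _ _ hg,
          (germ_chartSec_mul he hΦ a g H).symm⟩
      · rintro x y ⟨H, hH, rfl⟩ ⟨H', hH', rfl⟩
        exact ⟨H + H', fun i => add_mem (hH i) (hH' i), (germ_chartSec_add he hΦ a H H').symm⟩
    obtain ⟨H, hH, hGH⟩ := key _ h
    have hc := jetCoord_eq_of_germ_eq hΦ k a.2 a.2 a.2 hGH
    intro i
    rw [mem_eucIdeal_pow_iff]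
    intro I
    have := congrFun hc (i, I)
    refine Eq.trans (jetCoord_chartSec he hΦ k G a (i, I)).symm (this.trans ?_)
    exact (jetCoord_chartSec he hΦ k H a (i, I)).trans (multiPartial_eq_zero_of_mem I.2 (hH i))
  · intro h
    have h1 : (secSheaf n F E).germ (chartOpens e) a (chartSec he hΦ G) =
        ∑ i, chartGerm he a (G i) • (secSheaf n F E).germ (chartOpens e) a
          (frameSec hΦ (U := chartOpens e) subset_rfl i) := by
      refine (map_sum ((secSheaf n F E).germ (chartOpens e) a) _ _).trans ?_
      exact Finset.sum_congr rfl fun i _ => (secSheaf n F E).germ_smul a _ _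
    rw [h1]
    refine Submodule.sum_mem _ fun i _ => Submodule.smul_mem_smul ?_ Submodule.mem_top
    rw [maxIdeal_eq_map he a, ← Ideal.map_pow]
    exact Ideal.mem_map_of_mem _ (h i)

theorem jetAt_chartSec_eq_zero_iff (a : chartOpens e)
    (G : Fin (Module.finrank ℝ F) → EucFun n) :
    jetAt n F E k (chartOpens e) a (chartSec he hΦ G) = 0 ↔
      ∀ i, G i ∈ eucIdeal (e a) ^ (k + 1) := by
  rw [← germ_chartSec_mem_iff he hΦ k a G]
  exact Submodule.Quotient.mk_eq_zero _

/-- The components of the polynomial section with prescribed partial derivatives at `y`. -/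
def taylorHom (y : EuclideanSpace ℝ (Fin n)) :
    JetModel n F k →ₗ[ℝ] (Fin (Module.finrank ℝ F) → EucFun n) where
  toFun v i := ∑ I, (v (i, I) / I.fact) • eucMonomial y I.exp
  map_add' v w := by
    funext i
    simp only [Pi.add_apply, add_div, add_smul, Finset.sum_add_distrib]
  map_smul' c v := by
    funext i
    simp only [Pi.smul_apply, smul_eq_mul, mul_div_assoc, mul_smul, Finset.smul_sum,
      RingHom.id_apply]

theorem multiPartial_taylorHom (y : EuclideanSpace ℝ (Fin n)) (v : JetModel n F k)
    (i : Fin (Module.finrank ℝ F)) (J : JetIndex n k) :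
    multiPartial n J.exp (taylorHom k y v i) y = v (i, J) := by
  have h3 : ∀ I : JetIndex n k, multiPartialHom J.exp y (eucMonomial y I.exp) =
      if J = I then I.fact else 0 := fun I => by
    refine (multiPartial_monomial J.exp I.exp y).trans ?_
    simp only [(JetIndex.exp_injective k).eq_iff]
    rfl
  change multiPartialHom J.exp y (∑ I, (v (i, I) / I.fact) • eucMonomial y I.exp) = _
  rw [map_sum]
  simp only [map_smul, h3, smul_eq_mul, mul_ite, mul_zero, Finset.sum_ite_eq, Finset.mem_univ,
    if_true]
  rw [div_mul_cancel₀ _ J.fact_ne_zero]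

/-- The `k`-jet with prescribed coordinates. -/
def jetOfCoord (a : chartOpens e) : JetModel n F k →ₗ[ℝ] JetSpace n F E k (a : M) :=
  (jetAtHom F E k (chartOpens e) a).comp ((chartSecHom he hΦ).comp (taylorHom k (e a)))

/-- A section and its Taylor polynomial have the same derivatives up to order `k` at the point, so
the components of their difference lie in the (k+1)-st power of the ideal. -/
theorem jetOfCoord_jetCoord (U : Opens M) {a : M} (ha : a ∈ e.source) (haU : a ∈ U)
    (ψ : Sections n F E U) :
    jetOfCoord he hΦ k ⟨a, ha⟩ (jetCoord n F E k e hΦ U ⟨a, haU⟩ ψ) =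
      jetAt n F E k U ⟨a, haU⟩ ψ := by
  obtain ⟨G, hG⟩ := exists_germ_chartSec he hΦ ⟨a, ha⟩ ((secSheaf n F E).germ U ⟨a, haU⟩ ψ)
  have h1 : jetAt n F E k U ⟨a, haU⟩ ψ =
      jetAt n F E k (chartOpens e) ⟨a, ha⟩ (chartSec he hΦ G) :=
    congrArg Submodule.Quotient.mk hG
  rw [h1, jetCoord_eq_of_germ_eq hΦ k haU ha ha hG, ← sub_eq_zero]
  change jetAtHom F E k (chartOpens e) ⟨a, ha⟩ (chartSecHom he hΦ _) -
    jetAtHom F E k (chartOpens e) ⟨a, ha⟩ (chartSecHom he hΦ _) = 0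
  rw [← map_sub, ← map_sub]
  refine (jetAt_chartSec_eq_zero_iff he hΦ k ⟨a, ha⟩ _).2 fun i => ?_
  rw [mem_eucIdeal_pow_iff]
  intro I
  change multiPartialHom I.exp (e a) (_ - _) = 0
  rw [map_sub, sub_eq_zero]
  refine (multiPartial_taylorHom k (e a) _ i I).trans ?_
  exact jetCoord_chartSec he hΦ k G ⟨a, ha⟩ (i, I)

theorem jetOfCoord_bijective (a : chartOpens e) :
    Function.Bijective (jetOfCoord he hΦ k a) := by
  constructor
  · rw [← LinearMap.ker_eq_bot, LinearMap.ker_eq_bot']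
    intro v hv
    have h := (jetAt_chartSec_eq_zero_iff he hΦ k a (taylorHom k (e a) v)).1 hv
    funext p
    rw [← Prod.mk.eta (p := p), ← multiPartial_taylorHom k (e a) v p.1 p.2]
    exact (mem_eucIdeal_pow_iff k _ _).1 (h p.1) p.2
  · intro x
    obtain ⟨U, haU, ψ, rfl⟩ := exists_jetAt F E k x
    exact ⟨_, jetOfCoord_jetCoord he hΦ k U a.2 haU ψ⟩

/-- The coordinates of `k`-jets in a chart with a local frame. -/
def jetCoordEquiv (a : chartOpens e) : JetSpace n F E k (a : M) ≃ₗ[ℝ] JetModel n F k :=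
  (LinearEquiv.ofBijective _ (jetOfCoord_bijective he hΦ k a)).symm

theorem jetCoordEquiv_jetAt (U : Opens M) {a : M} (ha : a ∈ e.source) (haU : a ∈ U)
    (ψ : Sections n F E U) :
    jetCoordEquiv he hΦ k ⟨a, ha⟩ (jetAt n F E k U ⟨a, haU⟩ ψ) =
      jetCoord n F E k e hΦ U ⟨a, haU⟩ ψ := by
  unfold jetCoordEquiv
  rw [LinearEquiv.symm_apply_eq]
  exact (jetOfCoord_jetCoord he hΦ k U ha haU ψ).symm

/-- The coordinates of the jets of a smooth section are smooth. -/
theorem contMDiff_jetCoord (he : e ∈ IsManifold.maximalAtlas (𝓡 n) ∞ M) {U : Opens M}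
    (hU : U ≤ chartOpens e) (ψ : Sections n F E U)
    (p : Fin (Module.finrank ℝ F) × JetIndex n k) :
    ContMDiff (𝓡 n) 𝓘(ℝ) ∞ (fun a : U => jetCoord n F E k e hΦ U a ψ p) := by
  intro a
  let u : EuclideanSpace ℝ (Fin n) → ℝ :=
    fun y => hΦ.coeff p.1 (e.symm y) (extendSec n F E U ψ (e.symm y))
  have hs : IsOpen (e.target ∩ e.symm ⁻¹' U) := e.isOpen_inter_preimage_symm U.2
  have hu : ContDiffOn ℝ ∞ u (e.target ∩ e.symm ⁻¹' U) := by
    rw [← contMDiffOn_iff_contDiffOn]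
    intro y hy
    exact ((contMDiffAt_frame_coeff hΦ (e.open_source.mem_nhds (e.map_target hy.1))
      (contMDiffAt_extendSec ψ hy.2) p.1).comp y
      (contMDiffAt_symm_of_mem_maximalAtlas he hy.1)).contMDiffWithinAt
  have ha : (a : M) ∈ e.source := hU a.2
  have h1 := (contDiffOn_multiPartial (fun A => (p.2.1 A : ℕ)) hs hu).contDiffAt
    (hs.mem_nhds (x := e a) ⟨e.map_source ha, by
      rw [mem_preimage, e.left_inv ha]; exact a.2⟩)
  exact (contMDiffAt_subtype_iff (f := fun x => multiPartial n _ u (e x))).2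
    (h1.contMDiffAt.comp (a : M) (contMDiffAt_of_mem_maximalAtlas he ha))

end JetCoordinates

/-! ### Two facts about powers of ideals -/

/-- Reduces claims about `I ^ j` to products of exactly `j` elements, in the list form in which
`deltaComp` is written. -/
theorem ideal_pow_le_of_ofFn_prod_mem {R : Type*} [CommRing R] (I : Ideal R) (j : ℕ) :
    ∀ K : Ideal R, (∀ g : Fin j → R, (∀ i, g i ∈ I) → (List.ofFn g).prod ∈ K) → I ^ j ≤ K := by
  induction j with
  | zero =>
    intro K h
    have := h Fin.elim0 (fun i => i.elim0)
    rw [pow_zero, Ideal.one_eq_top, top_le_iff, Ideal.eq_top_iff_one]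
    simpa using this
  | succ j ih =>
    intro K h
    rw [pow_succ', Ideal.mul_le]
    intro a ha b hb
    -- The induction hypothesis is used for the colon ideal {b | a b ∈ K}, which is why `K` varies.
    refine ih (Submodule.comap (LinearMap.mulLeft R a) K) (fun g hg => ?_) hb
    have := h (Fin.cons a g) (fun i => by refine Fin.cases ?_ (fun i => ?_) i <;> simp [ha, hg])
    simpa [List.ofFn_succ] using this

/-- The relation A = N + I A is substituted into itself `q` times. -/
theorem top_le_sup_pow_smul {R A : Type*} [CommRing R] [AddCommGroup A] [Module R A] (I : Ideal R)
    (N : Submodule R A) (h : ⊤ ≤ N ⊔ I • (⊤ : Submodule R A)) (q : ℕ) :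
    ⊤ ≤ N ⊔ I ^ q • (⊤ : Submodule R A) := by
  induction q with
  | zero => simp
  | succ q ih =>
    refine ih.trans (sup_le le_sup_left ?_)
    refine (Submodule.smul_mono le_rfl h).trans ?_
    rw [Submodule.smul_sup]
    refine sup_le (Submodule.smul_le_right.trans le_sup_left) ?_
    rw [← Submodule.mul_smul, ← pow_succ]
    exact le_sup_right

/-! ### Evaluation of `C^∞(U) ⊗ Γ_E(U)` -/

section Evaluation

variable {n : ℕ} {M : Type*} [TopologicalSpace M] [ChartedSpace (EuclideanSpace ℝ (Fin n)) M]
  (F : Type*) [NormedAddCommGroup F] [NormedSpace ℝ F]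
  (E : M → Type*) [TopologicalSpace (TotalSpace F E)] [∀ x, TopologicalSpace (E x)]
  [∀ x, AddCommGroup (E x)] [∀ x, Module ℝ (E x)] [FiberBundle F E] [VectorBundle ℝ F E]
  {U : Opens M} (a : U)

/-- Evaluation at a point as a linear form. -/
def evalLin : Cinf n U →ₗ[ℝ] ℝ where
  toFun f := f a
  map_add' _ _ := rfl
  map_smul' _ _ := rfl

/-- The map `g ⊗ ψ ↦ g(a) ψ`. -/
def evX : XX n F E U →ₗ[ℝ] Sections n F E U :=
  TensorProduct.lift ((LinearMap.lsmul ℝ (Sections n F E U)).comp (evalLin a))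

@[simp] theorem evX_tmul (g : Cinf n U) (ψ : Sections n F E U) :
    evX F E a (g ⊗ₜ ψ) = g a • ψ := rfl

theorem algebraMap_smul_sections (c : ℝ) (ψ : Sections n F E U) :
    algebraMap ℝ (Cinf n U) c • ψ = c • ψ := rfl

theorem smul_smul_sections (c : ℝ) (f : Cinf n U) (ψ : Sections n F E U) :
    (c • f) • ψ = c • f • ψ :=
  Subtype.ext (funext fun x => mul_smul c (f x) (ψ.1 x))

theorem evX_smul (f : Cinf n U) (x : XX n F E U) : evX F E a (f • x) = f a • evX F E a x := by
  induction x using TensorProduct.induction_on with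
  | zero => simp
  | tmul g ψ =>
    rw [TensorProduct.smul_tmul', evX_tmul, evX_tmul, smul_smul]
    rfl
  | add x y hx hy => rw [smul_add, map_add, hx, hy, map_add, smul_add]

/-- The key computation: on g ⊗ ψ both sides are g(a)(f(a) - f)ψ. Each δ contributes a factor
vanishing at `a`, so `k + 1` of them become invisible to the `k`-jet. -/
theorem evX_delta (f : Cinf n U) (x : XX n F E U) :
    evX F E a (delta n F E f x) = (algebraMap ℝ (Cinf n U) (f a) - f) • evX F E a x := by
  induction x using TensorProduct.induction_on with
  | zero => simp
  | tmul g ψ =>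
    rw [delta_tmul, map_sub, evX_tmul, evX_tmul, evX_tmul, sub_smul, algebraMap_smul_sections,
      smul_smul]
    congr 1
    exact smul_comm (algebraMap ℝ (Cinf n U) (g a)) f ψ
  | add x y hx hy => rw [map_add, map_add, hx, hy, map_add, smul_add]

theorem evX_deltaComp {j : ℕ} (f : Fin j → Cinf n U) (x : XX n F E U) :
    evX F E a (deltaComp n F E f x) =
      (List.ofFn fun i => algebraMap ℝ (Cinf n U) (f i a) - f i).prod • evX F E a x := by
  induction j with
  | zero => simp [deltaComp]
  | succ j ih =>
    have h : deltaComp n F E f x = delta n F E (f 0) (deltaComp n F E (fun i => f i.succ) x) := by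
      simp only [deltaComp, List.ofFn_succ, List.prod_cons, Module.End.mul_apply]
    rw [h, evX_delta, ih, List.ofFn_succ, List.prod_cons, mul_smul]

/-- On a pure tensor the difference is (g - g(a)) ▷ (1 ⊗ ψ). Hence modulo J^a ▷ 𝒳 an element is
determined by its evaluation at `a`. -/
theorem sub_one_tmul_evX_mem (x : XX n F E U) :
    x - (1 : Cinf n U) ⊗ₜ[ℝ] evX F E a x ∈
      (vanishingIdeal n U a • ⊤ : Submodule (Cinf n U) (XX n F E U)) := by
  induction x using TensorProduct.induction_on with
  | zero => simp
  | tmul g ψ =>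
    have h : g ⊗ₜ[ℝ] ψ - (1 : Cinf n U) ⊗ₜ[ℝ] evX F E a (g ⊗ₜ ψ) =
        (g - algebraMap ℝ (Cinf n U) (g a)) • ((1 : Cinf n U) ⊗ₜ[ℝ] ψ) := by
      rw [evX_tmul, TensorProduct.tmul_smul, TensorProduct.smul_tmul', TensorProduct.smul_tmul',
        ← TensorProduct.sub_tmul, smul_eq_mul, mul_one, Algebra.algebraMap_eq_smul_one]
    rw [h]
    exact Submodule.smul_mem_smul (sub_self (g a)) Submodule.mem_top
  | add x y hx hy =>
    rw [map_add, TensorProduct.tmul_add, add_sub_add_comm]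
    exact add_mem hx hy

theorem sub_mem_of_evX_eq {x y : XX n F E U} (h : evX F E a x = evX F E a y) :
    x - y ∈ (vanishingIdeal n U a • ⊤ : Submodule (Cinf n U) (XX n F E U)) := by
  have h1 := sub_mem (sub_one_tmul_evX_mem F E a x) (sub_one_tmul_evX_mem F E a y)
  rwa [h, sub_sub_sub_cancel_right] at h1

variable (k : ℕ)

theorem funGerm_mem_maxIdeal_pow (j : ℕ) {f : Cinf n U} (hf : f ∈ vanishingIdeal n U a ^ j) :
    funGerm n U a f ∈ maxIdeal n (a : M) ^ j := by
  have h1 : (vanishingIdeal n U a).map (funGerm n U a) ≤ maxIdeal n (a : M) :=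
    Ideal.map_le_iff_le_comap.2 fun g hg => hg
  have h2 := Ideal.mem_map_of_mem (funGerm n U a) hf
  rw [Ideal.map_pow] at h2
  exact Ideal.pow_right_mono h1 j h2

theorem jetAt_smul_eq_zero {f : Cinf n U} (hf : f ∈ vanishingIdeal n U a ^ (k + 1))
    (ψ : Sections n F E U) : jetAt n F E k U a (f • ψ) = 0 := by
  refine (Submodule.Quotient.mk_eq_zero _).2 ?_
  have h : (secSheaf n F E).germ U a (f • ψ) =
      funGerm n U a f • (secSheaf n F E).germ U a ψ := (secSheaf n F E).germ_smul a f ψ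
  rw [h]
  exact Submodule.smul_mem_smul (funGerm_mem_maxIdeal_pow a _ hf) Submodule.mem_top

/-- The map `g ⊗ ψ ↦ g(a) j^k_a ψ`. -/
def thetaX : XX n F E U →ₗ[ℝ] JetSpace n F E k (a : M) := (jetAtHom F E k U a).comp (evX F E a)

@[simp] theorem thetaX_tmul (g : Cinf n U) (ψ : Sections n F E U) :
    thetaX F E a k (g ⊗ₜ ψ) = g a • jetAt n F E k U a ψ :=
  (jetAtHom F E k U a).map_smul (g a) ψ

theorem thetaX_smul (f : Cinf n U) (x : XX n F E U) :
    thetaX F E a k (f • x) = f a • thetaX F E a k x := by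
  change jetAtHom F E k U a (evX F E a (f • x)) = _
  rw [evX_smul, map_smul]
  rfl

theorem thetaX_eq_zero_of_mem_VV {x : XX n F E U} (hx : x ∈ VV n F E k U) :
    thetaX F E a k x = 0 := by
  have h : Submodule.span ℝ {x : XX n F E U | ∃ (f : Fin (k + 1) → Cinf n U) (g : Cinf n U)
      (ψ : Sections n F E U), x = deltaComp n F E f (g ⊗ₜ ψ)} ≤
      LinearMap.ker (thetaX F E a k) := by
    rw [Submodule.span_le]
    rintro _ ⟨f, g, ψ, rfl⟩
    change jetAt n F E k U a (evX F E a _) = 0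
    rw [evX_deltaComp]
    refine jetAt_smul_eq_zero F E a k ?_ _
    have h1 : ∀ (j : ℕ) (g : Fin j → Cinf n U), (∀ i, g i ∈ vanishingIdeal n U a) →
        (List.ofFn g).prod ∈ vanishingIdeal n U a ^ j := by
      intro j g hg
      rw [List.prod_ofFn, ← Fin.prod_const]
      exact Ideal.prod_mem_prod fun i _ => hg i
    exact h1 _ _ fun i => sub_self (f i a)
  exact h hx

theorem thetaX_resXX {V : Opens M} (h : V ≤ U) (b : V) (x : XX n F E U) :
    thetaX F E b k (resXX n F E h x) = thetaX F E ⟨b.1, h b.2⟩ k x := by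
  induction x using TensorProduct.induction_on with
  | zero => simp
  | tmul g ψ =>
    change thetaX F E b k (resFun n h g ⊗ₜ resSec n F E h ψ) = _
    rw [thetaX_tmul, thetaX_tmul, jetAt_res]
    rfl
  | add x y hx hy => rw [map_add, map_add, hx, hy, map_add]

/-- Elements `1 ⊗ f ψ` with `f` vanishing to order `k` at `a`. -/
theorem one_tmul_smul_mem {f : Cinf n U} (hf : f ∈ vanishingIdeal n U a ^ (k + 1))
    (ψ : Sections n F E U) : (1 : Cinf n U) ⊗ₜ[ℝ] (f • ψ) ∈
      VV n F E k U ⊔ (vanishingIdeal n U a • ⊤ : Submodule (Cinf n U) (XX n F E U)) := by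
  -- Quantifying over all `ψ` makes the good `f` an ideal, so only products of `k + 1` functions
  -- vanishing at `a` need to be tested.
  let K : Ideal (Cinf n U) :=
    { carrier := {f | ∀ ψ : Sections n F E U, (1 : Cinf n U) ⊗ₜ[ℝ] (f • ψ) ∈
        VV n F E k U ⊔ (vanishingIdeal n U a • ⊤ : Submodule (Cinf n U) (XX n F E U))}
      zero_mem' := fun ψ => by rw [zero_smul, TensorProduct.tmul_zero]; exact zero_mem _
      add_mem' := fun {f g} hf hg ψ => by
        rw [add_smul, TensorProduct.tmul_add]; exact add_mem (hf ψ) (hg ψ)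
      smul_mem' := fun h f hf ψ => by
        rw [smul_eq_mul, mul_comm, mul_smul]; exact hf (h • ψ) }
  refine ideal_pow_le_of_ofFn_prod_mem _ (k + 1) K (fun g hg ψ => ?_) hf ψ
  -- As g_i(a) = 0, evaluation turns δ_{-g_i} into multiplication by g_i. This generator of 𝒱_(k)
  -- thus has the same evaluation as 1 ⊗ (∏ g_i)ψ and differs from it by an element of J^a ▷ 𝒳.
  have h1 : deltaComp n F E (fun i => -g i) ((1 : Cinf n U) ⊗ₜ[ℝ] ψ) ∈ VV n F E k U :=
    Submodule.subset_span ⟨fun i => -g i, 1, ψ, rfl⟩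
  have h3 : (fun i => algebraMap ℝ (Cinf n U) ((-g i) a) - -g i) = g := by
    funext i
    have : (-g i) a = 0 := by
      change -(g i a) = 0
      rw [(mem_vanishingIdeal n).1 (hg i), neg_zero]
    rw [this, map_zero, zero_sub, neg_neg]
  have h2 : evX F E a (deltaComp n F E (fun i => -g i) ((1 : Cinf n U) ⊗ₜ[ℝ] ψ)) =
      evX F E a ((1 : Cinf n U) ⊗ₜ[ℝ] ((List.ofFn g).prod • ψ)) := by
    rw [evX_deltaComp, h3, evX_tmul, evX_tmul]
    exact smul_comm (List.ofFn g).prod (algebraMap ℝ (Cinf n U) _) ψ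
  have h4 := sub_mem_of_evX_eq F E a h2.symm
  have h5 := add_mem (Submodule.mem_sup_right (S := VV n F E k U) h4) (Submodule.mem_sup_left h1)
  rwa [sub_add_cancel] at h5

end Evaluation

/-! ### The frame of jets determined by a chart and a local frame -/

section JetFrame

variable {n : ℕ} {M : Type*} [TopologicalSpace M] [ChartedSpace (EuclideanSpace ℝ (Fin n)) M]
  [IsManifold (𝓡 n) ∞ M]
  {e : OpenPartialHomeomorph M (EuclideanSpace ℝ (Fin n))}
  (he : e ∈ IsManifold.maximalAtlas (𝓡 n) ∞ M)
  {F : Type*} [NormedAddCommGroup F] [NormedSpace ℝ F] [FiniteDimensional ℝ F]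
  {E : M → Type*} [TopologicalSpace (TotalSpace F E)] [∀ x, TopologicalSpace (E x)]
  [∀ x, AddCommGroup (E x)] [∀ x, Module ℝ (E x)] [FiberBundle F E] [VectorBundle ℝ F E]
  {Φ : Fin (Module.finrank ℝ F) → (x : M) → E x}
  (hΦ : IsLocalFrameOn (𝓡 n) F ∞ Φ e.source) (k : ℕ)

variable (F E) in
/-- The composition of the operators `(-δ_{x_A})^{i_A}`. -/
def deltaMonomial (I : Fin n → ℕ) (l : List (Fin n)) :
    Module.End (Cinf n (chartOpens e)) (XX n F E (chartOpens e)) :=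
  (l.map fun A => (-(delta n F E (chartPull he (eucCoord 0 A)))) ^ I A).prod

/-- Evaluated at `a`, -δ_{x_A} is multiplication by x_A - x_A(a), whatever the base point of the
coordinate: additive constants cancel. One operator therefore yields monomials centred at every
point of the chart simultaneously. -/
theorem evX_deltaMonomial (a : chartOpens e) (I : Fin n → ℕ) (l : List (Fin n))
    (x : XX n F E (chartOpens e)) : evX F E a (deltaMonomial he F E I l x) =
      chartPull he ((l.map fun A => eucCoord (e a) A ^ I A).prod) • evX F E a x := by
  have h1 : ∀ A x, evX F E a ((-(delta n F E (chartPull he (eucCoord 0 A)))) x) =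
      chartPull he (eucCoord (e a) A) • evX F E a x := by
    intro A x
    rw [LinearMap.neg_apply, map_neg, evX_delta, ← neg_smul]
    congr 1
    ext y
    change -((e a A - (0 : ℝ)) - (e y A - (0 : ℝ))) = e y A - e a A
    ring
  have h2 : ∀ (A : Fin n) (i : ℕ) x,
      evX F E a (((-(delta n F E (chartPull he (eucCoord 0 A)))) ^ i) x) =
        chartPull he (eucCoord (e a) A ^ i) • evX F E a x := by
    intro A i x
    induction i with
    | zero => simp
    | succ i ih => rw [pow_succ', Module.End.mul_apply, h1, ih, pow_succ', map_mul, mul_smul]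
  induction l with
  | nil => simp [deltaMonomial]
  | cons A l ih =>
    rw [List.map_cons, List.prod_cons, map_mul, mul_smul, ← ih, ← h2]
    rfl

/-- The element `∏ (-δ_{x_A})^{i_A} (1 ⊗ Φ_i) / I!` of `C^∞(U) ⊗ Γ_E(U)`. -/
def jetFrame (p : Fin (Module.finrank ℝ F) × JetIndex n k) : XX n F E (chartOpens e) :=
  (p.2.fact)⁻¹ • deltaMonomial he F E p.2.exp (List.finRange n)
    ((1 : Cinf n (chartOpens e)) ⊗ₜ[ℝ] frameSec hΦ (U := chartOpens e) subset_rfl p.1)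

theorem evX_jetFrame (a : chartOpens e) (p : Fin (Module.finrank ℝ F) × JetIndex n k) :
    evX F E a (jetFrame he hΦ k p) =
      chartSec he hΦ (taylorHom k (e a) (Pi.single p 1)) := by
  have h1 : ∀ i, taylorHom k (e a) (Pi.single p (1 : ℝ)) i =
      if i = p.1 then p.2.fact⁻¹ • eucMonomial (e a) p.2.exp else 0 := by
    intro i
    change ∑ I, (Pi.single (M := fun _ => ℝ) p (1 : ℝ) (i, I) / I.fact) •
      eucMonomial (e a) I.exp = _
    split_ifs with h
    · subst h
      rw [Finset.sum_eq_single p.2]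
      · simp
      · intro J _ hJ
        rw [Pi.single_eq_of_ne (fun h => hJ (congrArg Prod.snd h)), zero_div, zero_smul]
      · simp
    · refine Finset.sum_eq_zero fun J _ => ?_
      rw [Pi.single_eq_of_ne (fun h' => h (congrArg Prod.fst h')), zero_div, zero_smul]
  have h2 : ((List.finRange n).map fun A => eucCoord (e a) A ^ p.2.exp A).prod =
      eucMonomial (e a) p.2.exp := by
    rw [eucMonomial, Fin.prod_univ_def]
  rw [jetFrame, map_smul, evX_deltaMonomial, h2, evX_tmul]
  change _ = ∑ i, chartPull he (taylorHom k (e a) (Pi.single p (1 : ℝ)) i) • _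
  rw [Finset.sum_eq_single p.1]
  · rw [h1, if_pos rfl, map_smul]
    change _ • _ • (1 : ℝ) • _ = _
    rw [one_smul, smul_smul_sections]
  · intro i _ hi
    rw [h1, if_neg hi, map_zero, zero_smul]
  · simp

/-- The evaluation of the frame element at `a` is its own Taylor polynomial, with a single
coefficient. Validity at all `a` makes `jetFrame` a frame of jets over the whole chart. -/
theorem jetCoordEquiv_thetaX_jetFrame (a : chartOpens e)
    (p : Fin (Module.finrank ℝ F) × JetIndex n k) :
    jetCoordEquiv he hΦ k a (thetaX F E a k (jetFrame he hΦ k p)) = Pi.single p 1 := by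
  unfold jetCoordEquiv
  rw [LinearEquiv.symm_apply_eq]
  exact congrArg (jetAt n F E k (chartOpens e) a) (evX_jetFrame he hΦ k a p)

/-- In a chart onto `ℝ^n`, the jet frame generates `C^∞(U) ⊗ Γ_E(U)` up to elements of `𝒱_(k)`
and elements vanishing at `a`. -/
theorem exists_jetFrame_decomp (htarget : e.target = univ) (a : chartOpens e)
    (x : XX n F E (chartOpens e)) : ∃ v : JetModel n F k,
      x - ∑ p, v p • jetFrame he hΦ k p ∈ VV n F E k (chartOpens e) ⊔
        (vanishingIdeal n (chartOpens e) a • ⊤ :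
          Submodule (Cinf n (chartOpens e)) (XX n F E (chartOpens e))) := by
  obtain ⟨G, hG⟩ := chartSec_surjective he hΦ htarget (evX F E a x)
  let v : JetModel n F k := fun p => multiPartial n p.2.exp (G p.1) (e a)
  refine ⟨v, ?_⟩
  have h1 : evX F E a (∑ p, v p • jetFrame he hΦ k p) =
      chartSec he hΦ (taylorHom k (e a) v) := by
    rw [map_sum]
    simp only [map_smul, evX_jetFrame]
    change ∑ p, v p • chartSecHom he hΦ (taylorHom k (e a) (Pi.single p 1)) =
      chartSecHom he hΦ (taylorHom k (e a) v)
    simp only [← map_smul, ← map_sum]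
    congr 2
    funext q
    simp [Finset.sum_apply, Pi.single_apply]
  -- The components of the Taylor remainder. Modulo J^a ▷ 𝒳 only the evaluation at `a` counts, so
  -- the difference may be replaced by 1 ⊗ (remainder section), to which `one_tmul_smul_mem`
  -- applies.
  set R := G - taylorHom k (e a) v with hR
  have hRm : ∀ i, R i ∈ eucIdeal (e a) ^ (k + 1) := by
    intro i
    rw [mem_eucIdeal_pow_iff]
    intro I
    change multiPartialHom I.exp (e a) (_ - _) = 0
    rw [map_sub, sub_eq_zero]
    exact (multiPartial_taylorHom k (e a) v i I).symm
  have h2 : evX F E a (x - ∑ p, v p • jetFrame he hΦ k p) =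
      evX F E a ((1 : Cinf n (chartOpens e)) ⊗ₜ[ℝ] chartSec he hΦ R) := by
    rw [map_sub, h1, ← hG, evX_tmul]
    change chartSecHom he hΦ _ - chartSecHom he hΦ _ = (1 : ℝ) • chartSecHom he hΦ _
    rw [one_smul, hR, map_sub]
  have h3 := sub_mem_of_evX_eq F E a h2
  have h4 : (1 : Cinf n (chartOpens e)) ⊗ₜ[ℝ] chartSec he hΦ R ∈ VV n F E k (chartOpens e) ⊔
        (vanishingIdeal n (chartOpens e) a • ⊤ :
          Submodule (Cinf n (chartOpens e)) (XX n F E (chartOpens e))) := by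
    rw [chartSec, TensorProduct.tmul_sum]
    refine Submodule.sum_mem _ fun i _ => one_tmul_smul_mem F E a k ?_ _
    have h5 : (eucIdeal (e a)).map (chartPull he) ≤ vanishingIdeal n (chartOpens e) a :=
      Ideal.map_le_iff_le_comap.2 fun g hg => hg
    have h6 := Ideal.mem_map_of_mem (chartPull he) (hRm i)
    rw [Ideal.map_pow] at h6
    exact Ideal.pow_right_mono h5 _ h6
  have h7 := add_mem (Submodule.mem_sup_right (S := VV n F E k (chartOpens e)) h3) h4
  rwa [sub_add_cancel] at h7

/-- The coordinate functions of the field of jets defined by an element of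
`C^∞(U) ⊗ Γ_E(U)`. -/
def coordX {U : Opens M} (hU : U ≤ chartOpens e) :
    XX n F E U →ₗ[Cinf n U] (Fin (Module.finrank ℝ F) × JetIndex n k → Cinf n U) where
  toFun x p := ⟨fun a => jetCoordEquiv he hΦ k ⟨a, hU a.2⟩ (thetaX F E a k x) p, by
    induction x using TensorProduct.induction_on with
    | zero =>
      simp only [map_zero]
      exact contMDiff_const
    | tmul g ψ =>
      simp only [thetaX_tmul, map_smul]
      refine (g.contMDiff.smul (contMDiff_jetCoord hΦ k he hU ψ p)).congr fun a => ?_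
      exact congrArg (fun t => g a * t)
        (congrFun (jetCoordEquiv_jetAt he hΦ k U (hU a.2) a.2 ψ) p)
    | add x y hx hy =>
      simp only [map_add]
      exact hx.add hy⟩
  map_add' x y := by
    funext p
    ext a
    change jetCoordEquiv he hΦ k ⟨a, hU a.2⟩ (thetaX F E a k (x + y)) p = _
    rw [map_add, map_add]
    rfl
  map_smul' f x := by
    funext p
    ext a
    change jetCoordEquiv he hΦ k ⟨a, hU a.2⟩ (thetaX F E a k (f • x)) p = _
    rw [thetaX_smul, map_smul]
    rfl

theorem coordX_apply {U : Opens M} (hU : U ≤ chartOpens e) (x : XX n F E U)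
    (p : Fin (Module.finrank ℝ F) × JetIndex n k) (a : U) :
    coordX he hΦ k hU x p a = jetCoordEquiv he hΦ k ⟨a, hU a.2⟩ (thetaX F E a k x) p := rfl

theorem coordX_jetFrame (p : Fin (Module.finrank ℝ F) × JetIndex n k) :
    coordX he hΦ k le_rfl (jetFrame he hΦ k p) = Pi.single p 1 := by
  funext q
  ext a
  rw [coordX_apply]
  refine (congrFun (jetCoordEquiv_thetaX_jetFrame he hΦ k a p) q).trans ?_
  by_cases h : q = p
  · subst h
    rw [Pi.single_eq_same, Pi.single_eq_same]
    rfl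
  · rw [Pi.single_eq_of_ne h, Pi.single_eq_of_ne h]
    rfl

theorem coordX_sum_jetFrame
    (c : Fin (Module.finrank ℝ F) × JetIndex n k → Cinf n (chartOpens e)) :
    coordX he hΦ k le_rfl (∑ p, c p • jetFrame he hΦ k p) = c := by
  rw [map_sum]
  simp only [map_smul, coordX_jetFrame]
  funext q
  rw [Finset.sum_apply, Finset.sum_eq_single q]
  · simp
  · intro p _ hp
    simp [Pi.single_eq_of_ne hp.symm]
  · simp

theorem coordX_eq_zero_of_mem_VV {U : Opens M} (hU : U ≤ chartOpens e) {x : XX n F E U}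
    (hx : x ∈ VV n F E k U) : coordX he hΦ k hU x = 0 := by
  funext p
  ext a
  rw [coordX_apply, thetaX_eq_zero_of_mem_VV F E a k hx, map_zero]
  rfl

end JetFrame

/-! ### Maps out of stalks, and local representation of sections of a sheafification -/

namespace ModPresheaf

variable {n : ℕ} {M : Type*} [TopologicalSpace M] [ChartedSpace (EuclideanSpace ℝ (Fin n)) M]
  (P : ModPresheaf n M)

/-- The additive map on a stalk determined by a compatible family of additive maps. -/
def stalkLift {A : Type*} [AddCommGroup A] (a : M)
    (φ : ∀ (U : Opens M), a ∈ U → P.obj U →+ A)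
    (hφ : ∀ (U V : Opens M) (h : V ≤ U) (ha : a ∈ V) (s : P.obj U),
      φ U (h ha) s = φ V ha (P.res h s)) : P.Stalk a →+ A where
  toFun := DirectLimit.lift _ (fun U s => φ _ (OrderDual.ofDual U).mem s)
    (fun U V h s => hφ _ _ h (OrderDual.ofDual V).mem s)
  map_zero' := by
    rw [DirectLimit.zero_def (OrderDual.toDual ⊤)]
    exact map_zero (φ _ _)
  map_add' x y := by
    induction x, y using DirectLimit.induction₂ with
    | ih U s t =>
      rw [DirectLimit.add_def]
      exact map_add (φ _ _) s t

theorem stalkLift_germ {A : Type*} [AddCommGroup A] (a : M)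
    (φ : ∀ (U : Opens M), a ∈ U → P.obj U →+ A)
    (hφ : ∀ (U V : Opens M) (h : V ≤ U) (ha : a ∈ V) (s : P.obj U),
      φ U (h ha) s = φ V ha (P.res h s)) (U : Opens M) (ha : a ∈ U) (s : P.obj U) :
    P.stalkLift a φ hφ (P.germ U ⟨a, ha⟩ s) = φ U ha s := rfl

theorem stalkLift_smul {A : Type*} [AddCommGroup A] [Module ℝ A] (a : M)
    (φ : ∀ (U : Opens M), a ∈ U → P.obj U →+ A)
    (hφ : ∀ (U V : Opens M) (h : V ≤ U) (ha : a ∈ V) (s : P.obj U),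
      φ U (h ha) s = φ V ha (P.res h s))
    (hs : ∀ (U : Opens M) (ha : a ∈ U) (f : Cinf n U) (s : P.obj U),
      φ U ha (f • s) = f ⟨a, ha⟩ • φ U ha s) (f : FunStalk n a) (x : P.Stalk a) :
    P.stalkLift a φ hφ (f • x) = evalStalk n a f • P.stalkLift a φ hφ x := by
  obtain ⟨U, ha, f, rfl⟩ := exists_funGerm f
  obtain ⟨V, hb, s, rfl⟩ := P.exists_germ x
  have hab : a ∈ U ⊓ V := ⟨ha, hb⟩
  rw [← funGerm_res n (inf_le_left : U ⊓ V ≤ U) ⟨a, hab⟩ f,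
    ← P.germ_res (inf_le_right : U ⊓ V ≤ V) ⟨a, hab⟩ s, ← P.germ_smul, stalkLift_germ,
    stalkLift_germ, hs]
  rfl

theorem exists_res_eq_toSff {U : Opens M} (σ : P.sff.obj U) {a : M} (ha : a ∈ U) :
    ∃ (V : Opens M) (h : V ≤ U) (t : P.obj V), a ∈ V ∧ P.sff.res h σ = P.toSff V t := by
  obtain ⟨V, h, t, haV, ht⟩ := σ.2 ⟨a, ha⟩
  exact ⟨V, h, t, haV, Subtype.ext (funext fun b => ht b)⟩

theorem sff_ext {U : Opens M} {σ τ : P.sff.obj U}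
    (h : ∀ a ∈ U, ∃ (V : Opens M) (hV : V ≤ U), a ∈ V ∧ P.sff.res hV σ = P.sff.res hV τ) :
    σ = τ := by
  refine Subtype.ext (funext fun a => ?_)
  obtain ⟨V, hV, ha, hst⟩ := h a a.2
  exact congrFun (congrArg Subtype.val hst) ⟨a, ha⟩

/-- Gluing of sections of a sheafification. -/
theorem sff_glue {U : Opens M} (V : U → Opens M) (hV : ∀ a, V a ≤ U) (ha : ∀ a : U, (a : M) ∈ V a)
    (σ : ∀ a, P.sff.obj (V a))
    (h : ∀ (a b : U) (hb : (b : M) ∈ V a), (σ a).1 ⟨b, hb⟩ = (σ b).1 ⟨b, ha b⟩) :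
    ∃ τ : P.sff.obj U, ∀ a, P.sff.res (hV a) τ = σ a := by
  refine ⟨⟨fun b => (σ b).1 ⟨b, ha b⟩, fun a => ?_⟩, fun a => ?_⟩
  · obtain ⟨W, hW, t, haW, ht⟩ := (σ a).2 ⟨a, ha a⟩
    exact ⟨W, hW.trans (hV a), t, haW, fun b =>
      (h a ⟨b.1, hV a (hW b.2)⟩ (hW b.2)).symm.trans (ht b)⟩
  · exact Subtype.ext (funext fun b => (h a ⟨b.1, hV a b.2⟩ b.2).symm)

theorem value_eq_zero_of_mem {U : Opens M} (a : U) {s : P.obj U}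
    (hs : s ∈ (vanishingIdeal n U a • ⊤ : Submodule (Cinf n U) (P.obj U))) :
    P.value U a s = 0 := by
  refine (Submodule.Quotient.mk_eq_zero _).2 ?_
  refine Submodule.smul_induction_on hs (fun f hf t _ => ?_) (fun x y hx hy => ?_)
  · rw [germ_smul]
    exact Submodule.smul_mem_smul hf Submodule.mem_top
  · rw [map_add]
    exact add_mem hx hy

end ModPresheaf

/-! ### The canonical map from the fibers of the sheaf of jets to the jet spaces -/

section Canonical

variable {n : ℕ} {M : Type*} [TopologicalSpace M] [ChartedSpace (EuclideanSpace ℝ (Fin n)) M]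
  (F : Type*) [NormedAddCommGroup F] [NormedSpace ℝ F]
  (E : M → Type*) [TopologicalSpace (TotalSpace F E)] [∀ x, TopologicalSpace (E x)]
  [∀ x, AddCommGroup (E x)] [∀ x, Module ℝ (E x)] [FiberBundle F E] [VectorBundle ℝ F E]
  (k : ℕ)

/-- The projection `𝒳(U) → 𝒳(U) / 𝒱_(k)(U)`. -/
def preJetMk (U : Opens M) : XX n F E U →ₗ[Cinf n U] (preJet n F E k).obj U :=
  (VV n F E k U).mkQ

theorem preJetMk_surjective (U : Opens M) : Function.Surjective (preJetMk (n := n) F E k U) :=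
  Submodule.Quotient.mk_surjective _

theorem preJetMk_eq_zero {U : Opens M} {x : XX n F E U} (hx : x ∈ VV n F E k U) :
    preJetMk F E k U x = 0 :=
  (Submodule.Quotient.mk_eq_zero _).2 hx

/-- The map induced by `g ⊗ ψ ↦ g(a) j^k_a ψ` on `𝒳(U) / 𝒱_(k)(U)`. -/
def thetaP {U : Opens M} (a : U) : (preJet n F E k).obj U →+ JetSpace n F E k (a : M) :=
  QuotientAddGroup.lift (VV n F E k U).toAddSubgroup (thetaX F E a k).toAddMonoidHom
    (fun _ hx => thetaX_eq_zero_of_mem_VV F E a k hx)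

theorem thetaP_mk {U : Opens M} (a : U) (x : XX n F E U) :
    thetaP F E k a (preJetMk F E k U x) = thetaX F E a k x := rfl

theorem thetaP_smul {U : Opens M} (a : U) (f : Cinf n U) (s : (preJet n F E k).obj U) :
    thetaP F E k a (f • s) = f a • thetaP F E k a s := by
  obtain ⟨x, rfl⟩ := preJetMk_surjective F E k U s
  rw [← map_smul, thetaP_mk, thetaP_mk, thetaX_smul]

theorem thetaP_res {U V : Opens M} (h : V ≤ U) (a : V) (s : (preJet n F E k).obj U) :
    thetaP F E k a ((preJet n F E k).res h s) = thetaP F E k ⟨a.1, h a.2⟩ s := by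
  obtain ⟨x, rfl⟩ := preJetMk_surjective F E k U s
  exact thetaX_resXX F E k h a x

theorem thetaP_eq_zero_of_mem {U : Opens M} (a : U) {s : (preJet n F E k).obj U}
    (hs : s ∈ (vanishingIdeal n U a • ⊤ : Submodule (Cinf n U) ((preJet n F E k).obj U))) :
    thetaP F E k a s = 0 := by
  refine Submodule.smul_induction_on hs (fun f hf t _ => ?_) (fun x y hx hy => ?_)
  · rw [thetaP_smul, (mem_vanishingIdeal n).1 hf, zero_smul]
  · rw [map_add, hx, hy, add_zero]

/-- The map induced by `g ⊗ ψ ↦ g(a) j^k_a ψ` on the geometrization. -/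
def thetaGeo {U : Opens M} (a : U) : (preJet n F E k).geo.obj U →+ JetSpace n F E k (a : M) :=
  QuotientAddGroup.lift ((preJet n F E k).bullet U).toAddSubgroup (thetaP F E k a) (by
    intro s hs
    -- Only the exponent q = 1 is needed: a jet-valued evaluation at `a` sees functions through
    -- their value at `a`.
    have h1 := (Submodule.mem_iInf _).1 ((Submodule.mem_iInf _).1 hs 1) a
    rw [pow_one] at h1
    exact thetaP_eq_zero_of_mem F E k a h1)

theorem thetaGeo_toGeo {U : Opens M} (a : U) (s : (preJet n F E k).obj U) :
    thetaGeo F E k a ((preJet n F E k).toGeo U s) = thetaP F E k a s := rfl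

theorem toGeo_surjective (P : ModPresheaf n M) (U : Opens M) :
    Function.Surjective (P.toGeo U) := Submodule.Quotient.mk_surjective _

theorem thetaGeo_smul {U : Opens M} (a : U) (f : Cinf n U) (s : (preJet n F E k).geo.obj U) :
    thetaGeo F E k a (f • s) = f a • thetaGeo F E k a s := by
  obtain ⟨x, rfl⟩ := toGeo_surjective _ U s
  rw [← map_smul, thetaGeo_toGeo, thetaGeo_toGeo, thetaP_smul]

theorem thetaGeo_res {U V : Opens M} (h : V ≤ U) (a : V) (s : (preJet n F E k).geo.obj U) :
    thetaGeo F E k a ((preJet n F E k).geo.res h s) = thetaGeo F E k ⟨a.1, h a.2⟩ s := by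
  obtain ⟨x, rfl⟩ := toGeo_surjective _ U s
  exact thetaP_res F E k h a x

/-- The map induced by `g ⊗ ψ ↦ g(a) j^k_a ψ` on the stalk of the geometrization. -/
def thetaStalk (a : M) : (preJet n F E k).geo.Stalk a →+ JetSpace n F E k a :=
  (preJet n F E k).geo.stalkLift a (fun _ ha => thetaGeo F E k ⟨a, ha⟩)
    (fun _ _ h ha s => (thetaGeo_res F E k h ⟨a, ha⟩ s).symm)

theorem thetaStalk_smul (a : M) (f : FunStalk n a) (x : (preJet n F E k).geo.Stalk a) :
    thetaStalk F E k a (f • x) = evalStalk n a f • thetaStalk F E k a x :=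
  (preJet n F E k).geo.stalkLift_smul a _ _
    (fun _ ha f s => thetaGeo_smul F E k ⟨a, ha⟩ f s) f x

/-- Evaluation of a section of the sheaf of jets at a point, as a jet. -/
def thetaSec {U : Opens M} (a : U) : (jetSheaf n F E k).obj U →+ JetSpace n F E k (a : M) where
  toFun σ := thetaStalk F E k (a : M) (σ.1 a)
  map_zero' := map_zero (thetaStalk F E k (a : M))
  map_add' σ τ := map_add (thetaStalk F E k (a : M)) (σ.1 a) (τ.1 a)

theorem thetaSec_smul {U : Opens M} (a : U) (f : Cinf n U) (σ : (jetSheaf n F E k).obj U) :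
    thetaSec F E k a (f • σ) = f a • thetaSec F E k a σ :=
  thetaStalk_smul F E k a (funGerm n U a f) (σ.1 a)

theorem thetaSec_res {U V : Opens M} (h : V ≤ U) (a : V) (σ : (jetSheaf n F E k).obj U) :
    thetaSec F E k a ((jetSheaf n F E k).res h σ) = thetaSec F E k ⟨a.1, h a.2⟩ σ := rfl

/-- The map induced by `g ⊗ ψ ↦ g(a) j^k_a ψ` on the stalk of the sheaf of jets. -/
def thetaJetStalk (a : M) : (jetSheaf n F E k).Stalk a →+ JetSpace n F E k a :=
  (jetSheaf n F E k).stalkLift a (fun _ ha => thetaSec F E k ⟨a, ha⟩) (fun _ _ _ _ _ => rfl)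

theorem thetaJetStalk_smul (a : M) (f : FunStalk n a) (x : (jetSheaf n F E k).Stalk a) :
    thetaJetStalk F E k a (f • x) = evalStalk n a f • thetaJetStalk F E k a x :=
  (jetSheaf n F E k).stalkLift_smul a _ _
    (fun _ ha f s => thetaSec_smul F E k ⟨a, ha⟩ f s) f x

/-- The canonical map from the fiber of the sheaf of jets to the jet space. -/
def thetaFiber (a : M) : JetFiber n F E k a →ₗ[ℝ] JetSpace n F E k a :=
  { QuotientAddGroup.lift (maxIdeal n a • ⊤ :
      Submodule (FunStalk n a) ((jetSheaf n F E k).Stalk a)).toAddSubgroup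
      (thetaJetStalk F E k a) (by
        intro x hx
        refine Submodule.smul_induction_on (p := fun x => thetaJetStalk F E k a x = 0) hx
          (fun f hf t _ => ?_) (fun x y hx hy => ?_)
        · rw [thetaJetStalk_smul, show evalStalk n a f = 0 from hf, zero_smul]
        · rw [map_add, hx, hy, add_zero]) with
    map_smul' := by
      intro c v
      obtain ⟨x, rfl⟩ := Submodule.Quotient.mk_surjective _ v
      refine (thetaJetStalk_smul F E k a (algebraMap ℝ (FunStalk n a) c) x).trans ?_
      rw [evalStalk_algebraMap]
      rfl }

/-- The section of the sheaf of jets determined by an element of `C^∞(U) ⊗ Γ_E(U)`. -/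
def jetClassX (U : Opens M) : XX n F E U →ₗ[Cinf n U] (jetSheaf n F E k).obj U :=
  ((preJet n F E k).geo.toSff U).comp (((preJet n F E k).toGeo U).comp (preJetMk F E k U))

theorem jetClassX_res {U V : Opens M} (h : V ≤ U) (x : XX n F E U) :
    (jetSheaf n F E k).res h (jetClassX F E k U x) = jetClassX F E k V (resXX n F E h x) := by
  refine Subtype.ext (funext fun b => ?_)
  exact ((preJet n F E k).geo.germ_res h b
    ((preJet n F E k).toGeo U (preJetMk F E k U x))).symm

theorem thetaSec_jetClassX {U : Opens M} (a : U) (x : XX n F E U) :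
    thetaSec F E k a (jetClassX F E k U x) = thetaX F E a k x := rfl

theorem exists_res_eq_jetClassX {U : Opens M} (σ : (jetSheaf n F E k).obj U) {a : M}
    (ha : a ∈ U) : ∃ (V : Opens M) (h : V ≤ U) (x : XX n F E V), a ∈ V ∧
      (jetSheaf n F E k).res h σ = jetClassX F E k V x := by
  obtain ⟨V, h, t, haV, ht⟩ := (preJet n F E k).geo.exists_res_eq_toSff σ ha
  obtain ⟨s, rfl⟩ := toGeo_surjective _ V t
  obtain ⟨x, rfl⟩ := preJetMk_surjective F E k V s
  exact ⟨V, h, x, haV, ht⟩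

theorem exists_value_jetClassX {a : M} (v : JetFiber n F E k a) :
    ∃ (V : Opens M) (ha : a ∈ V) (x : XX n F E V),
      v = (jetSheaf n F E k).value V ⟨a, ha⟩ (jetClassX F E k V x) := by
  obtain ⟨U, haU, σ, rfl⟩ := (jetSheaf n F E k).value_surjective v
  obtain ⟨V, h, x, haV, hx⟩ := exists_res_eq_jetClassX F E k σ haU
  refine ⟨V, haV, x, ?_⟩
  rw [← hx, ModPresheaf.value_res]

theorem value_jetClassX_eq_zero {U : Opens M} (a : U) {x : XX n F E U}
    (hx : x ∈ VV n F E k U ⊔ (vanishingIdeal n U a • ⊤ : Submodule (Cinf n U) (XX n F E U))) :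
    (jetSheaf n F E k).value U a (jetClassX F E k U x) = 0 := by
  obtain ⟨y, hy, z, hz, rfl⟩ := Submodule.mem_sup.1 hx
  refine ModPresheaf.value_eq_zero_of_mem _ a ?_
  have h1 : jetClassX F E k U y = 0 := by
    change (preJet n F E k).geo.toSff U ((preJet n F E k).toGeo U (preJetMk F E k U y)) = 0
    rw [preJetMk_eq_zero F E k hy, map_zero, map_zero]
  rw [map_add, h1, zero_add]
  refine Submodule.smul_induction_on hz (fun f hf t _ => ?_) (fun x y hx hy => ?_)
  · rw [map_smul]
    exact Submodule.smul_mem_smul hf Submodule.mem_top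
  · rw [map_add]
    exact add_mem hx hy

/-- A linear map on a fiber is determined by the values on the classes `[h ⊗ ψ]`. -/
theorem fiber_hom_ext {a : M} {A : Type*} [AddCommGroup A] [Module ℝ A]
    {L L' : JetFiber n F E k a →ₗ[ℝ] A}
    (h : ∀ (U : Opens M) (ha : a ∈ U) (h : Cinf n U) (ψ : Sections n F E U),
      L ((jetSheaf n F E k).value U ⟨a, ha⟩ (jetClass n F E k U h ψ)) =
        L' ((jetSheaf n F E k).value U ⟨a, ha⟩ (jetClass n F E k U h ψ))) : L = L' := by
  ext v
  obtain ⟨V, ha, x, rfl⟩ := exists_value_jetClassX F E k v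
  induction x using TensorProduct.induction_on with
  | zero =>
    have h0 : (jetSheaf n F E k).value V ⟨a, ha⟩ (jetClassX F E k V 0) = 0 :=
      value_jetClassX_eq_zero F E k ⟨a, ha⟩ (zero_mem _)
    rw [h0, map_zero, map_zero]
  | tmul g ψ => exact h V ha g ψ
  | add x y hx hy => rw [map_add, ModPresheaf.value_add, map_add, map_add, hx, hy]

end Canonical

/-! ### Bijectivity of the canonical map on fibers, and detection of sections by their jets -/

section CanonicalEquiv

variable {n : ℕ} {M : Type*} [TopologicalSpace M] [ChartedSpace (EuclideanSpace ℝ (Fin n)) M]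
  [IsManifold (𝓡 n) ∞ M]
  (F : Type*) [NormedAddCommGroup F] [NormedSpace ℝ F] [FiniteDimensional ℝ F]
  (E : M → Type*) [TopologicalSpace (TotalSpace F E)] [∀ x, TopologicalSpace (E x)]
  [∀ x, AddCommGroup (E x)] [∀ x, Module ℝ (E x)] [FiberBundle F E] [VectorBundle ℝ F E]
  (k : ℕ)

section Chart

variable {e : OpenPartialHomeomorph M (EuclideanSpace ℝ (Fin n))}
  (he : e ∈ IsManifold.maximalAtlas (𝓡 n) ∞ M)
  {Φ : Fin (Module.finrank ℝ F) → (x : M) → E x}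
  (hΦ : IsLocalFrameOn (𝓡 n) F ∞ Φ e.source)

/-- The coordinate functions of an element of `𝒳(U) / 𝒱_(k)(U)`. -/
def coordP : (preJet n F E k).obj (chartOpens e) →ₗ[Cinf n (chartOpens e)]
    (Fin (Module.finrank ℝ F) × JetIndex n k → Cinf n (chartOpens e)) :=
  (VV n F E k (chartOpens e)).liftQ (coordX he hΦ k le_rfl)
    (fun _ hx => coordX_eq_zero_of_mem_VV he hΦ k le_rfl hx)

theorem coordP_mk (x : XX n F E (chartOpens e)) :
    coordP F E k he hΦ (preJetMk F E k _ x) = coordX he hΦ k le_rfl x := rfl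

/-- In a chart onto `ℝ^n`, the elements of `𝒳(U) / 𝒱_(k)(U)` without coordinates vanish at all
points to all orders. -/
theorem mem_bullet_of_coordP_eq_zero (htarget : e.target = univ)
    {s : (preJet n F E k).obj (chartOpens e)} (hs : coordP F E k he hΦ s = 0) :
    s ∈ (preJet n F E k).bullet (chartOpens e) := by
  simp only [ModPresheaf.bullet, Submodule.mem_iInf]
  intro q a
  set I := vanishingIdeal n (chartOpens e) a
  let b : Fin (Module.finrank ℝ F) × JetIndex n k → (preJet n F E k).obj (chartOpens e) :=
    fun p => preJetMk F E k _ (jetFrame he hΦ k p)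
  let N : Submodule (Cinf n (chartOpens e)) ((preJet n F E k).obj (chartOpens e)) :=
    Submodule.span _ (range b)
  -- Taylor's formula at `a`, with the 𝒱_(k) part already zero in the quotient.
  -- `top_le_sup_pow_smul` then improves `I` to `I ^ q`.
  have h1 : ⊤ ≤ N ⊔ I • (⊤ : Submodule (Cinf n (chartOpens e)) _) := by
    intro t _
    obtain ⟨x, rfl⟩ := preJetMk_surjective F E k _ t
    obtain ⟨v, hv⟩ := exists_jetFrame_decomp he hΦ k htarget a x
    obtain ⟨y, hy, z, hz, hyz⟩ := Submodule.mem_sup.1 hv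
    have h2 : x = (∑ p, algebraMap ℝ (Cinf n (chartOpens e)) (v p) • jetFrame he hΦ k p) +
        (y + z) := by
      simp only [algebraMap_smul]
      rw [hyz]
      abel
    rw [h2, map_add, map_add, preJetMk_eq_zero F E k hy, zero_add, map_sum]
    refine add_mem (Submodule.mem_sup_left (Submodule.sum_mem _ fun p _ => ?_))
      (Submodule.mem_sup_right ?_)
    · rw [map_smul]
      exact Submodule.smul_mem _ _ (Submodule.subset_span ⟨p, rfl⟩)
    · refine Submodule.smul_induction_on hz (fun f hf t _ => ?_) (fun x y hx hy => ?_)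
      · rw [map_smul]
        exact Submodule.smul_mem_smul hf Submodule.mem_top
      · rw [map_add]
        exact add_mem hx hy
  obtain ⟨y, hy, r, hr, rfl⟩ :=
    Submodule.mem_sup.1 (top_le_sup_pow_smul I N h1 q (Submodule.mem_top (x := s)))
  obtain ⟨c, rfl⟩ := (Submodule.mem_span_range_iff_exists_fun _).1 hy
  -- The coordinates are C^∞-linear, so they map (J^a)^q Q into functions in (J^a)^q. Those of the
  -- frame part are its coefficients `c`, and total coordinate zero gives c = -(coordinates of `r`).
  have h3 : ∀ p, coordP F E k he hΦ r p ∈ I ^ q := by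
    refine Submodule.smul_induction_on hr (fun f hf t _ p => ?_) (fun x y hx hy p => ?_)
    · rw [map_smul]
      exact Ideal.mul_mem_right _ _ hf
    · rw [map_add]
      exact add_mem (hx p) (hy p)
  have h4 : coordP F E k he hΦ (∑ p, c p • b p) = c := by
    have : ∑ p, c p • b p = preJetMk F E k _ (∑ p, c p • jetFrame he hΦ k p) := by
      rw [map_sum]
      simp only [map_smul]
      rfl
    rw [this, coordP_mk, coordX_sum_jetFrame]
  rw [map_add, h4] at hs
  refine add_mem (Submodule.sum_mem _ fun p _ => Submodule.smul_mem_smul ?_ Submodule.mem_top) hr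
  rw [eq_neg_of_add_eq_zero_left hs]
  exact neg_mem (h3 p)

theorem jetClassX_eq_zero_of_chart
    (he : e ∈ IsManifold.maximalAtlas (𝓡 n) ∞ M)
    (hΦ : IsLocalFrameOn (𝓡 n) F ∞ Φ e.source) (htarget : e.target = univ)
    {x : XX n F E (chartOpens e)}
    (hx : ∀ a : chartOpens e, thetaX F E a k x = 0) : jetClassX F E k (chartOpens e) x = 0 := by
  have h1 : coordP F E k he hΦ (preJetMk F E k _ x) = 0 := by
    rw [coordP_mk]
    funext p
    ext a
    rw [coordX_apply, hx, map_zero]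
    rfl
  have h2 : (preJet n F E k).toGeo _ (preJetMk F E k (chartOpens e) x) = 0 :=
    (Submodule.Quotient.mk_eq_zero _).2 (mem_bullet_of_coordP_eq_zero F E k he hΦ htarget h1)
  change (preJet n F E k).geo.toSff _ ((preJet n F E k).toGeo _ (preJetMk F E k _ x)) = 0
  rw [h2, map_zero]

/-- The terms of 𝒱_(k) + J^a ▷ 𝒳 are killed by Θ_a and by the value in the fiber alike. Modulo them
only the jet frame remains, and its independence at `a` forces the coefficients to be 0. -/
theorem value_jetClassX_eq_zero_of_chart
    (he : e ∈ IsManifold.maximalAtlas (𝓡 n) ∞ M)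
    (hΦ : IsLocalFrameOn (𝓡 n) F ∞ Φ e.source) (htarget : e.target = univ)
    {x : XX n F E (chartOpens e)} (a : chartOpens e) (hx : thetaX F E a k x = 0) :
    (jetSheaf n F E k).value _ a (jetClassX F E k (chartOpens e) x) = 0 := by
  obtain ⟨v, hv⟩ := exists_jetFrame_decomp he hΦ k htarget a x
  have h0 : thetaX F E a k (x - ∑ p, v p • jetFrame he hΦ k p) = 0 := by
    obtain ⟨y, hy, z, hz, hyz⟩ := Submodule.mem_sup.1 hv
    rw [← hyz, map_add, thetaX_eq_zero_of_mem_VV F E a k hy, zero_add]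
    refine Submodule.smul_induction_on hz (fun f hf t _ => ?_) (fun x y hx hy => ?_)
    · rw [thetaX_smul, (mem_vanishingIdeal n).1 hf, zero_smul]
    · rw [map_add, hx, hy, add_zero]
  rw [map_sub, hx, zero_sub, neg_eq_zero, map_sum] at h0
  have h1 := congrArg (jetCoordEquiv he hΦ k a) h0
  simp only [map_sum, map_smul, jetCoordEquiv_thetaX_jetFrame, map_zero] at h1
  have h2 : ∀ p, v p = 0 := by
    intro p
    have := congrFun h1 p
    simpa [Finset.sum_apply, Pi.single_apply] using this
  simp only [h2, zero_smul, Finset.sum_const_zero, sub_zero] at hv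
  exact value_jetClassX_eq_zero F E k a hv

end Chart

variable [ContMDiffVectorBundle ∞ F E (𝓡 n)]

/-- Equality in a sheafification is local, and framed charts onto ℝ^n form a basis of the topology.
-/
theorem jetClassX_eq_zero {U : Opens M} {x : XX n F E U}
    (hx : ∀ a : U, thetaX F E a k x = 0) : jetClassX F E k U x = 0 := by
  refine (preJet n F E k).geo.sff_ext fun a ha => ?_
  obtain ⟨e, he, hae, heU, htgt, Φ, hΦ⟩ := exists_framed_chart (n := n) F E a (U.2.mem_nhds ha)
  have h : chartOpens e ≤ U := heU
  refine ⟨chartOpens e, h, hae, ?_⟩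
  have h1 := jetClassX_res F E k h x
  rw [jetClassX_eq_zero_of_chart F E k he hΦ htgt fun b => ?_] at h1
  · exact h1.trans (map_zero ((jetSheaf n F E k).res h)).symm
  · rw [thetaX_resXX]
    exact hx _

/-- Every fiber element is the value of a class from some 𝒳(V), which restricts to a framed chart
onto ℝ^n; every jet is the image of the class of some 1 ⊗ ψ. -/
theorem thetaFiber_bijective (a : M) : Function.Bijective (thetaFiber (n := n) F E k a) := by
  constructor
  · rw [← LinearMap.ker_eq_bot, LinearMap.ker_eq_bot']
    intro v hv
    obtain ⟨V, haV, x, rfl⟩ := exists_value_jetClassX F E k v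
    obtain ⟨e, he, hae, heV, htgt, Φ, hΦ⟩ := exists_framed_chart (n := n) F E a (V.2.mem_nhds haV)
    have h : chartOpens e ≤ V := heV
    have h1 := value_jetClassX_eq_zero_of_chart F E k he hΦ htgt (x := resXX n F E h x)
      ⟨a, hae⟩ (by rw [thetaX_resXX]; exact hv)
    rwa [← jetClassX_res, ModPresheaf.value_res] at h1
  · intro v
    obtain ⟨U, ha, ψ, rfl⟩ := exists_jetAt F E k v
    refine ⟨(jetSheaf n F E k).value U ⟨a, ha⟩ (jetClassX F E k U (1 ⊗ₜ ψ)), ?_⟩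
    refine (thetaX_tmul F E ⟨a, ha⟩ k 1 ψ).trans ?_
    exact one_smul ℝ _

/-- The canonical isomorphism from the fiber of the sheaf of jets to the jet space. -/
def fiberEquiv (a : M) : JetFiber n F E k a ≃ₗ[ℝ] JetSpace n F E k a :=
  LinearEquiv.ofBijective _ (thetaFiber_bijective F E k a)

theorem fiberEquiv_value {U : Opens M} (a : U) (σ : (jetSheaf n F E k).obj U) :
    fiberEquiv F E k (a : M) ((jetSheaf n F E k).value U a σ) = thetaSec F E k a σ := rfl

theorem fiberEquiv_jetClass (U : Opens M) (a : U) (h : Cinf n U) (ψ : Sections n F E U) :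
    fiberEquiv F E k (a : M) ((jetSheaf n F E k).value U a (jetClass n F E k U h ψ)) =
      h a • jetAt n F E k U a ψ :=
  thetaX_tmul F E a k h ψ

attribute [irreducible] fiberEquiv

/-- A section of the sheaf of jets is determined by the field of jets it defines. -/
theorem thetaSec_injective {U : Opens M} {σ τ : (jetSheaf n F E k).obj U}
    (h : ∀ a : U, thetaSec F E k a σ = thetaSec F E k a τ) : σ = τ := by
  refine (preJet n F E k).geo.sff_ext fun a ha => ?_
  obtain ⟨V, hV, x, haV, hx⟩ := exists_res_eq_jetClassX F E k (σ - τ) ha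
  refine ⟨V, hV, haV, ?_⟩
  have h1 : jetClassX F E k V x = 0 := jetClassX_eq_zero F E k fun b => by
    rw [← thetaSec_jetClassX, ← hx, thetaSec_res, map_sub, h, sub_self]
  rw [h1, map_sub, sub_eq_zero] at hx
  exact hx

end CanonicalEquiv

/-! ### Vector bundles from fiberwise linear coordinate systems -/

section SmoothCoords

variable (n : ℕ) {M : Type*} [TopologicalSpace M] [ChartedSpace (EuclideanSpace ℝ (Fin n)) M]
  (P : Type*) [Fintype P] [DecidableEq P]

/-- A family of fiberwise linear coordinate systems on a family `V` of vector spaces over `M`,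
each of them over an open set, with smooth coordinate changes. -/
structure SmoothCoords (V : M → Type*) [∀ a, AddCommGroup (V a)] [∀ a, Module ℝ (V a)] where
  ι : Type*
  base : ι → Opens M
  coord : ι → ∀ a, V a ≃ₗ[ℝ] (P → ℝ)
  indexAt : M → ι
  mem_indexAt : ∀ a, a ∈ base (indexAt a)
  smooth : ∀ i j (p : P), ContMDiffOn (𝓡 n) 𝓘(ℝ, P → ℝ) ∞
    (fun a => coord j a ((coord i a).symm (Pi.single p 1))) (base i ∩ base j)

variable {n P} {V : M → Type*} [∀ a, AddCommGroup (V a)] [∀ a, Module ℝ (V a)]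

namespace SmoothCoords

variable (C : SmoothCoords n P V)

/-- The pretrivialization given by one of the coordinate systems. -/
def pretriv (i : C.ι) : Pretrivialization (P → ℝ) (π (P → ℝ) V) where
  toFun p := (p.1, C.coord i p.1 p.2)
  invFun q := ⟨q.1, (C.coord i q.1).symm q.2⟩
  source := π (P → ℝ) V ⁻¹' (C.base i : Set M)
  target := (C.base i : Set M) ×ˢ univ
  map_source' p hp := ⟨hp, mem_univ _⟩
  map_target' q hq := hq.1
  left_inv' p _ := by
    obtain ⟨a, v⟩ := p
    simp
  right_inv' q _ := by simp
  open_target := (C.base i).2.prod isOpen_univ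
  baseSet := C.base i
  open_baseSet := (C.base i).2
  source_eq := rfl
  target_eq := rfl
  proj_toFun _ _ := rfl

theorem pretriv_symm (i : C.ι) {b : M} (hb : b ∈ C.base i) (v : P → ℝ) :
    (C.pretriv i).symm b v = (C.coord i b).symm v := by
  have h := (C.pretriv i).mk_symm (b := b) hb v
  exact TotalSpace.mk_inj.1 h

/-- The coordinate change between two of the coordinate systems, as a family of continuous linear
maps. -/
def change (i j : C.ι) (b : M) : (P → ℝ) →L[ℝ] (P → ℝ) :=
  ∑ p, (ContinuousLinearMap.proj (R := ℝ) (φ := fun _ : P => ℝ) p).smulRight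
    (C.coord j b ((C.coord i b).symm (Pi.single p 1)))

theorem change_apply (i j : C.ι) (b : M) (v : P → ℝ) :
    C.change i j b v = C.coord j b ((C.coord i b).symm v) := by
  conv_rhs => rw [pi_eq_sum_univ' v]
  simp only [change, _root_.sum_apply, ContinuousLinearMap.smulRight_apply, map_sum,
    map_smul, ContinuousLinearMap.proj_apply]

theorem contMDiffOn_change (i j : C.ι) :
    ContMDiffOn (𝓡 n) 𝓘(ℝ, (P → ℝ) →L[ℝ] (P → ℝ)) ∞ (C.change i j)
      ((C.base i : Set M) ∩ C.base j) := by
  refine contMDiffOn_finsetSum fun p _ => ?_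
  exact (ContinuousLinearMap.smulRightL ℝ (P → ℝ) (P → ℝ)
    (ContinuousLinearMap.proj (R := ℝ) (φ := fun _ : P => ℝ) p)).contMDiff.comp_contMDiffOn
      (C.smooth i j p)

/-- The topology of the fibers. -/
@[reducible]
def fiberTopology (a : M) : TopologicalSpace (V a) :=
  TopologicalSpace.induced (C.coord (C.indexAt a) a) inferInstance

/-- The vector prebundle given by the coordinate systems. -/
def prebundle : letI := C.fiberTopology; VectorPrebundle ℝ (P → ℝ) V :=
  letI := C.fiberTopology
  { pretrivializationAtlas := range C.pretriv
    pretrivialization_linear' := by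
      rintro _ ⟨i, rfl⟩
      exact ⟨fun b _ => ⟨map_add (C.coord i b), map_smul (C.coord i b)⟩⟩
    pretrivializationAt := fun a => C.pretriv (C.indexAt a)
    mem_base_pretrivializationAt := C.mem_indexAt
    pretrivialization_mem_atlas := fun a => ⟨_, rfl⟩
    exists_coordChange := by
      rintro _ ⟨i, rfl⟩ _ ⟨j, rfl⟩
      refine ⟨C.change i j, (C.contMDiffOn_change i j).continuousOn, fun b hb v => ?_⟩
      rw [C.change_apply, C.pretriv_symm i hb.1]
      rfl
    totalSpaceMk_isInducing := fun b => by
      have h : Topology.IsInducing (C.coord (C.indexAt b) b) := ⟨rfl⟩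
      exact Topology.isInducing_const_prod.2 h }

theorem isContMDiff_prebundle : letI := C.fiberTopology; C.prebundle.IsContMDiff (𝓡 n) ∞ :=
  letI := C.fiberTopology
  ⟨by
    rintro _ ⟨i, rfl⟩ _ ⟨j, rfl⟩
    refine ⟨C.change i j, C.contMDiffOn_change i j, fun b hb v => ?_⟩
    rw [C.change_apply, C.pretriv_symm i hb.1]
    rfl⟩

/-- `V` carries a smooth vector bundle structure whose atlas of trivializations contains the given
coordinate systems. -/
theorem exists_bundle :
    ∃ (_ : TopologicalSpace (TotalSpace (P → ℝ) V)) (_ : ∀ a, TopologicalSpace (V a))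
      (_ : FiberBundle (P → ℝ) V) (_ : VectorBundle ℝ (P → ℝ) V)
      (_ : ContMDiffVectorBundle ∞ (P → ℝ) V (𝓡 n)),
      ∀ i, ∃ t ∈ trivializationAtlas (P → ℝ) V, t.baseSet = C.base i ∧
        ∀ a v, t ⟨a, v⟩ = (a, C.coord i a v) := by
  let := C.fiberTopology
  have := C.isContMDiff_prebundle
  exact ⟨C.prebundle.totalSpaceTopology, C.fiberTopology, C.prebundle.toFiberBundle,
    C.prebundle.toVectorBundle, C.prebundle.contMDiffVectorBundle (IB := 𝓡 n), fun i =>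
    ⟨C.prebundle.trivializationOfMemPretrivializationAtlas ⟨i, rfl⟩, ⟨_, ⟨i, rfl⟩, rfl⟩, rfl,
      fun _ _ => rfl⟩⟩

/-- Coordinate systems carried over along fiberwise linear isomorphisms. -/
def transport {W : M → Type*} [∀ a, AddCommGroup (W a)] [∀ a, Module ℝ (W a)]
    (Ψ : ∀ a, W a ≃ₗ[ℝ] V a) : SmoothCoords n P W where
  ι := C.ι
  base := C.base
  coord i a := (Ψ a).trans (C.coord i a)
  indexAt := C.indexAt
  mem_indexAt := C.mem_indexAt
  smooth i j p := by
    simpa using C.smooth i j p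

end SmoothCoords
end SmoothCoords

/-! ### Smoothness of bundle maps and sections in trivializations -/

section Maps

variable {n : ℕ} {M : Type*} [TopologicalSpace M] [ChartedSpace (EuclideanSpace ℝ (Fin n)) M]
  {K : Type*} [NormedAddCommGroup K] [NormedSpace ℝ K]
  {V : M → Type*} [∀ a, AddCommGroup (V a)] [∀ a, Module ℝ (V a)]
  [TopologicalSpace (TotalSpace K V)] [∀ a, TopologicalSpace (V a)] [FiberBundle K V]
  [VectorBundle ℝ K V] [ContMDiffVectorBundle ∞ K V (𝓡 n)]
  {W : M → Type*} [∀ a, AddCommGroup (W a)] [∀ a, Module ℝ (W a)]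
  [TopologicalSpace (TotalSpace K W)] [∀ a, TopologicalSpace (W a)] [FiberBundle K W]
  [VectorBundle ℝ K W] [ContMDiffVectorBundle ∞ K W (𝓡 n)]

/-- A fiberwise map that is the identity in trivializations around every point is smooth. -/
theorem contMDiff_of_trivializations_eq [IsManifold (𝓡 n) ∞ M] (f : ∀ a, V a → W a)
    (h : ∀ a, ∃ t ∈ trivializationAtlas K V, ∃ t' ∈ trivializationAtlas K W,
      a ∈ t.baseSet ∧ a ∈ t'.baseSet ∧ ∀ b v, (t' ⟨b, f b v⟩).2 = (t ⟨b, v⟩).2) :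
    ContMDiff ((𝓡 n).prod 𝓘(ℝ, K)) ((𝓡 n).prod 𝓘(ℝ, K)) ∞
      (fun p : TotalSpace K V => TotalSpace.mk' K p.1 (f p.1 p.2)) := by
  rintro ⟨a, v⟩
  obtain ⟨t, ht, t', ht', ha, ha', hf⟩ := h a
  have : MemTrivializationAtlas t := ⟨ht⟩
  have : MemTrivializationAtlas t' := ⟨ht'⟩
  rw [Bundle.Trivialization.contMDiffAt_iff (e := t') (by exact t'.mem_source.2 ha')]
  refine ⟨Bundle.contMDiff_proj V ⟨a, v⟩, ?_⟩
  have hv : (⟨a, v⟩ : TotalSpace K V) ∈ t.source := t.mem_source.2 ha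
  have h1 := (t.contMDiffOn (IB := 𝓡 n) (n := ∞)).contMDiffAt (t.open_source.mem_nhds hv)
  exact h1.snd.congr_of_eventuallyEq (Filter.Eventually.of_forall fun p => hf p.1 p.2)

/-- Smoothness of a section at a point, in a trivialization. -/
theorem contMDiffAt_section_iff_of_mem_atlas [IsManifold (𝓡 n) ∞ M]
    {t : Trivialization K (π K V)}
    (ht : t ∈ trivializationAtlas K V) (U : Opens M) (s : ∀ x : U, V (x : M)) (a : U)
    (ha : (a : M) ∈ t.baseSet) :
    ContMDiffAt (𝓡 n) ((𝓡 n).prod 𝓘(ℝ, K)) ∞ (fun x : U => TotalSpace.mk' K (x : M) (s x)) a ↔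
      ContMDiffAt (𝓡 n) 𝓘(ℝ, K) ∞ (fun x : U => (t ⟨x, s x⟩).2) a := by
  have : MemTrivializationAtlas t := ⟨ht⟩
  rw [Bundle.Trivialization.contMDiffAt_iff (e := t) (by exact t.mem_source.2 ha)]
  exact and_iff_right (contMDiff_subtype_val a)

/-- Smoothness on an open set at a point can be checked on a smaller open set. -/
theorem contMDiffAt_comp_inclusion_iff {G : Type*} [NormedAddCommGroup G] [NormedSpace ℝ G]
    {U W : Opens M} (h : W ≤ U) (f : U → G) (a : W) :
    ContMDiffAt (𝓡 n) 𝓘(ℝ, G) ∞ (fun b : W => f ⟨b, h b.2⟩) a ↔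
      ContMDiffAt (𝓡 n) 𝓘(ℝ, G) ∞ f ⟨a, h a.2⟩ := by
  classical
  let g : M → G := fun b => if hb : b ∈ U then f ⟨b, hb⟩ else 0
  have h1 : f = fun b : U => g b := by
    funext b
    simp [g]
  rw [h1, contMDiffAt_subtype_iff (U := U) (f := g)]
  exact contMDiffAt_subtype_iff (U := W) (f := g)

end Maps

/-! ### Framed charts, the jet bundles and gluing of jet fields -/

section JetBundle

variable {n : ℕ} {M : Type*} [TopologicalSpace M] [ChartedSpace (EuclideanSpace ℝ (Fin n)) M]
  [IsManifold (𝓡 n) ∞ M]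
  (F : Type*) [NormedAddCommGroup F] [NormedSpace ℝ F] [FiniteDimensional ℝ F]
  (E : M → Type*) [TopologicalSpace (TotalSpace F E)] [∀ x, TopologicalSpace (E x)]
  [∀ x, AddCommGroup (E x)] [∀ x, Module ℝ (E x)] [FiberBundle F E] [VectorBundle ℝ F E]
  (k : ℕ)

variable (n) in
/-- A chart of `M` with a local frame of `E` over its domain. -/
structure FramedChart where
  chart : OpenPartialHomeomorph M (EuclideanSpace ℝ (Fin n))
  mem_maximalAtlas : chart ∈ IsManifold.maximalAtlas (𝓡 n) ∞ M
  frame : Fin (Module.finrank ℝ F) → (x : M) → E x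
  isLocalFrameOn : IsLocalFrameOn (𝓡 n) F ∞ frame chart.source

variable {F E} in
/-- The coordinates on the jet spaces over the domain of a framed chart. -/
def FramedChart.jetCoords (c : FramedChart n F E) (a : chartOpens c.chart) :
    JetSpace n F E k (a : M) ≃ₗ[ℝ] JetModel n F k :=
  jetCoordEquiv c.mem_maximalAtlas c.isLocalFrameOn k a

variable {F E} in
/-- The coordinates of the jets of an element of `C^∞(U) ⊗ Γ_E(U)` are smooth. -/
theorem FramedChart.contMDiff_jetCoords (c : FramedChart n F E) {U : Opens M}
    (hU : U ≤ chartOpens c.chart) (x : XX n F E U) :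
    ContMDiff (𝓡 n) 𝓘(ℝ, JetModel n F k) ∞
      (fun a : U => c.jetCoords k ⟨a, hU a.2⟩ (thetaX F E a k x)) :=
  contMDiff_pi_space.2 fun p =>
    (coordX c.mem_maximalAtlas c.isLocalFrameOn k hU x p).contMDiff

variable {F E} in
/-- A field of jets with smooth coordinates in a framed chart comes from a section of the sheaf of
jets. -/
theorem FramedChart.exists_thetaSec_eq (c : FramedChart n F E) {U : Opens M}
    (hU : chartOpens c.chart ≤ U) (S : ∀ a : U, JetSpace n F E k (a : M))
    (h : ContMDiff (𝓡 n) 𝓘(ℝ, JetModel n F k) ∞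
      (fun b : chartOpens c.chart => c.jetCoords k b (S ⟨b, hU b.2⟩))) :
    ∃ σ : (jetSheaf n F E k).obj (chartOpens c.chart), ∀ b : chartOpens c.chart,
      thetaSec F E k b σ = S ⟨b, hU b.2⟩ := by
  obtain ⟨f, hf⟩ : ∃ f : Fin (Module.finrank ℝ F) × JetIndex n k → Cinf n (chartOpens c.chart),
      ∀ p b, f p b = c.jetCoords k b (S ⟨b, hU b.2⟩) p :=
    ⟨fun p => ⟨_, contMDiff_pi_space.1 h p⟩, fun _ _ => rfl⟩
  refine ⟨jetClassX F E k _ (∑ p, f p • jetFrame c.mem_maximalAtlas c.isLocalFrameOn k p),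
    fun b => (c.jetCoords k b).injective (funext fun p => ?_)⟩
  rw [← hf, thetaSec_jetClassX]
  exact congrArg (fun g : Cinf n (chartOpens c.chart) => g b)
    (congrFun (coordX_sum_jetFrame c.mem_maximalAtlas c.isLocalFrameOn k f) p)

variable [ContMDiffVectorBundle ∞ F E (𝓡 n)]

theorem exists_framedChart_subset (a : M) {W : Set M} (hW : W ∈ nhds a) :
    ∃ c : FramedChart n F E, a ∈ c.chart.source ∧ c.chart.source ⊆ W := by
  obtain ⟨e, he, hae, heW, -, Φ, hΦ⟩ := exists_framed_chart (n := n) F E a hW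
  exact ⟨⟨e, he, Φ, hΦ⟩, hae, heW⟩

/-- A framed chart around a given point. -/
def framedChartAt (a : M) : FramedChart n F E :=
  (exists_framedChart_subset F E a Filter.univ_mem).choose

theorem mem_framedChartAt_source (a : M) : a ∈ (framedChartAt (n := n) F E a).chart.source :=
  (exists_framedChart_subset F E a Filter.univ_mem).choose_spec.1

variable {F E} in
open scoped Classical in
/-- The coordinates `jetCoords`, continued arbitrarily to the whole of `M`. -/
def FramedChart.jetCoordsExt (c : FramedChart n F E) (a : M) :
    JetSpace n F E k a ≃ₗ[ℝ] JetModel n F k :=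
  if ha : a ∈ c.chart.source then c.jetCoords k ⟨a, ha⟩ else
    (framedChartAt F E a).jetCoords k ⟨a, mem_framedChartAt_source F E a⟩

variable {F E} in
theorem FramedChart.jetCoordsExt_eq (c : FramedChart n F E) {a : M} (ha : a ∈ c.chart.source) :
    c.jetCoordsExt k a = c.jetCoords k ⟨a, ha⟩ := dif_pos ha

/-- The coordinate systems on the jet spaces given by the framed charts. -/
def jetSmoothCoords :
    SmoothCoords n (Fin (Module.finrank ℝ F) × JetIndex n k) (JetSpace n F E k) where
  ι := FramedChart n F E
  base c := chartOpens c.chart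
  coord c := c.jetCoordsExt k
  indexAt := framedChartAt F E
  mem_indexAt := mem_framedChartAt_source F E
  smooth c d p := by
    intro a ha
    refine ContMDiffAt.contMDiffWithinAt ?_
    refine (contMDiffAt_subtype_iff (U := chartOpens c.chart ⊓ chartOpens d.chart)
      (x := ⟨a, ha⟩)).1 ?_
    -- Column `p` of the coordinate change is the coordinate vector in `d` of the `p`-th jet frame
    -- element of `c`. That is a fixed element of 𝒳 over the overlap, so its coordinates are smooth.
    refine ((d.contMDiff_jetCoords k inf_le_right (resXX n F E inf_le_left
      (jetFrame c.mem_maximalAtlas c.isLocalFrameOn k p))).congr fun b => ?_) _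
    have hc : (b : M) ∈ c.chart.source := b.2.1
    have hd : (b : M) ∈ d.chart.source := b.2.2
    rw [d.jetCoordsExt_eq k hd, c.jetCoordsExt_eq k hc, thetaX_resXX]
    refine congrArg (d.jetCoords k ⟨b, hd⟩) ?_
    rw [LinearEquiv.symm_apply_eq]
    exact (jetCoordEquiv_thetaX_jetFrame c.mem_maximalAtlas c.isLocalFrameOn k ⟨b, hc⟩ p).symm

/-- Sections of the sheaf of jets that locally define a given field of jets can be glued. -/
theorem exists_thetaSec_eq {U : Opens M} (S : ∀ a : U, JetSpace n F E k (a : M))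
    (h : ∀ a : U, ∃ (V : Opens M) (hV : V ≤ U) (_ : (a : M) ∈ V) (σ : (jetSheaf n F E k).obj V),
      ∀ b : V, thetaSec F E k b σ = S ⟨b, hV b.2⟩) :
    ∃ τ : (jetSheaf n F E k).obj U, ∀ a : U, thetaSec F E k a τ = S a := by
  choose V hV haV σ hσ using h
  obtain ⟨τ, hτ⟩ := (preJet n F E k).geo.sff_glue V hV haV σ fun a b hb => by
    -- On overlaps the local lifts define the same jets, hence coincide as sections of the sheaf.
    have h1 : (jetSheaf n F E k).res (inf_le_left : V a ⊓ V b ≤ V a) (σ a) =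
        (jetSheaf n F E k).res (inf_le_right : V a ⊓ V b ≤ V b) (σ b) :=
      thetaSec_injective F E k fun x => (hσ a ⟨x, x.2.1⟩).trans (hσ b ⟨x, x.2.2⟩).symm
    exact congrFun (congrArg Subtype.val h1) ⟨b, hb, haV b⟩
  exact ⟨τ, fun a => (congrArg (thetaSec F E k ⟨a, haV a⟩) (hτ a)).trans (hσ a ⟨a, haV a⟩)⟩

/-! ### Smooth sections of the bundle with fibers `JetFiber` -/

section Sections

variable [TopologicalSpace (TotalSpace (JetModel n F k) (JetFiber n F E k))]
  [∀ a, TopologicalSpace (JetFiber n F E k a)]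
  [FiberBundle (JetModel n F k) (JetFiber n F E k)]
  [VectorBundle ℝ (JetModel n F k) (JetFiber n F E k)]
  [ContMDiffVectorBundle ∞ (JetModel n F k) (JetFiber n F E k) (𝓡 n)]

variable (n) in
/-- The framed charts induce trivializations of the bundle with fibers `JetFiber`. -/
def HasFramedTrivializations : Prop :=
  ∀ c : FramedChart n F E, ∃ t ∈ trivializationAtlas (JetModel n F k) (JetFiber n F E k),
    t.baseSet = c.chart.source ∧
      ∀ a v, t ⟨a, v⟩ = (a, c.jetCoordsExt k a (fiberEquiv F E k a v))

variable {F E k} in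
theorem contMDiffAt_jetSection_iff (ht : HasFramedTrivializations n F E k)
    (c : FramedChart n F E) {U : Opens M} (hU : chartOpens c.chart ≤ U)
    {s : ∀ a : U, JetFiber n F E k (a : M)} {S : ∀ a : U, JetSpace n F E k (a : M)}
    (hS : ∀ a : U, fiberEquiv F E k (a : M) (s a) = S a) (a : chartOpens c.chart) :
    ContMDiffAt (𝓡 n) ((𝓡 n).prod 𝓘(ℝ, JetModel n F k)) ∞
      (fun x : U => TotalSpace.mk' (JetModel n F k) (x : M) (s x)) ⟨a, hU a.2⟩ ↔
    ContMDiffAt (𝓡 n) 𝓘(ℝ, JetModel n F k) ∞ (fun b : chartOpens c.chart =>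
      c.jetCoords k b (S ⟨b, hU b.2⟩)) a := by
  obtain ⟨t, hta, hb, hts⟩ := ht c
  rw [contMDiffAt_section_iff_of_mem_atlas hta U s ⟨a, hU a.2⟩ (hb ▸ a.2),
    ← contMDiffAt_comp_inclusion_iff hU]
  have h : (fun b : chartOpens c.chart => (t ⟨b, s ⟨b, hU b.2⟩⟩).2) =
      fun b : chartOpens c.chart => c.jetCoords k b (S ⟨b, hU b.2⟩) := by
    funext b
    rw [hts, c.jetCoordsExt_eq k b.2]
    exact congrArg (c.jetCoords k b) (hS ⟨b, hU b.2⟩)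
  exact Iff.of_eq (congrArg (fun f => ContMDiffAt (𝓡 n) 𝓘(ℝ, JetModel n F k) ∞ f a) h)

variable {F E k} in
-- Locally the section is the class of an element of some 𝒳(V), whose jets have smooth coordinates
-- in every framed chart.
theorem isSmoothSection_value (ht : HasFramedTrivializations n F E k)
    {U : Opens M} (σ : (jetSheaf n F E k).obj U) :
    IsSmoothSection n (JetModel n F k) U fun a => (jetSheaf n F E k).value U a σ := by
  intro a
  obtain ⟨V, hV, x, haV, hx⟩ := exists_res_eq_jetClassX F E k σ a.2
  obtain ⟨c, hac, hcV⟩ := exists_framedChart_subset (n := n) F E (a : M) (V.2.mem_nhds haV)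
  have hcV' : chartOpens c.chart ≤ V := hcV
  refine (contMDiffAt_jetSection_iff ht c (hcV'.trans hV) (fun a => fiberEquiv_value F E k a σ)
    ⟨a, hac⟩).2 ?_
  refine ((c.contMDiff_jetCoords k le_rfl (resXX n F E hcV' x)).congr fun b => ?_) _
  refine congrArg (c.jetCoords k b) ?_
  rw [thetaX_resXX, ← thetaSec_jetClassX, ← hx]
  rfl

variable {F E k} in
-- In a framed chart the smooth coordinates serve as coefficients of the jet frame, which gives
-- local lifts of the field of jets; uniqueness glues them.
theorem exists_value_eq_of_isSmoothSection (ht : HasFramedTrivializations n F E k)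
    {U : Opens M} {s : ∀ a : U, JetFiber n F E k (a : M)}
    (hs : IsSmoothSection n (JetModel n F k) U s) :
    ∃ σ : (jetSheaf n F E k).obj U, ∀ a, (jetSheaf n F E k).value U a σ = s a := by
  obtain ⟨S, hS⟩ : ∃ S : ∀ a : U, JetSpace n F E k (a : M),
    ∀ a : U, fiberEquiv F E k (a : M) (s a) = S a := ⟨_, fun _ => rfl⟩
  obtain ⟨τ, hτ⟩ := exists_thetaSec_eq F E k S fun a => by
    obtain ⟨c, hac, hcU⟩ := exists_framedChart_subset (n := n) F E (a : M) (U.2.mem_nhds a.2)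
    obtain ⟨σ, hσ⟩ := c.exists_thetaSec_eq k hcU S fun b =>
      (contMDiffAt_jetSection_iff ht c hcU hS b).1 (hs _)
    exact ⟨chartOpens c.chart, hcU, hac, σ, hσ⟩
  refine ⟨τ, fun a => (fiberEquiv F E k (a : M)).injective ?_⟩
  rw [fiberEquiv_value, hτ a, hS a]

variable {F E k} in
theorem isSheafOfSections_jetSheaf (ht : HasFramedTrivializations n F E k) :
    IsSheafOfSections (jetSheaf n F E k) (JetModel n F k) := by
  intro U
  refine ⟨fun σ _ => isSmoothSection_value ht σ, fun σ _ τ _ h => ?_, fun s hs => ?_⟩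
  · refine thetaSec_injective F E k fun a => ?_
    rw [← fiberEquiv_value, ← fiberEquiv_value]
    exact congrArg (fiberEquiv F E k (a : M)) (congrFun h a)
  · obtain ⟨σ, hσ⟩ := exists_value_eq_of_isSmoothSection ht hs
    exact ⟨σ, mem_univ _, funext hσ⟩

end Sections

variable {F E k} in
theorem hasJetTrivializations_of_framedCharts
    [TopologicalSpace (TotalSpace (JetModel n F k) (JetSpace n F E k))]
    [∀ a, TopologicalSpace (JetSpace n F E k a)]
    [FiberBundle (JetModel n F k) (JetSpace n F E k)]
    (ht : ∀ c : FramedChart n F E,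
      ∃ t ∈ trivializationAtlas (JetModel n F k) (JetSpace n F E k),
        t.baseSet = c.chart.source ∧ ∀ a v, t ⟨a, v⟩ = (a, c.jetCoordsExt k a v)) :
    HasJetTrivializations n F E k := by
  intro e he Φ hΦ
  obtain ⟨t, hta, hb, hts⟩ := ht ⟨e, he, Φ, hΦ⟩
  refine ⟨t, hta, hb, fun U a ha ψ => ?_⟩
  rw [hts, FramedChart.jetCoordsExt_eq k _ ha]
  exact congrArg (Prod.mk (a : M)) (jetCoordEquiv_jetAt he hΦ k U ha a.2 ψ)

end JetBundle

end JetLimit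

end

theorem mainTheorem9 (n : ℕ) {M : Type*} [TopologicalSpace M] [T2Space M]
    [SecondCountableTopology M] [ChartedSpace (EuclideanSpace ℝ (Fin n)) M]
    [IsManifold (𝓡 n) ∞ M]
    (F : Type*) [NormedAddCommGroup F] [NormedSpace ℝ F] [FiniteDimensional ℝ F]
    (E : M → Type*) [TopologicalSpace (TotalSpace F E)] [∀ x, TopologicalSpace (E x)]
    [∀ x, AddCommGroup (E x)] [∀ x, Module ℝ (E x)] [FiberBundle F E] [VectorBundle ℝ F E]
    [ContMDiffVectorBundle ∞ F E (𝓡 n)] (k : ℕ) :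
    -- the smooth vector bundle with fibers `JetFiber` whose sheaf of sections is `jetSheaf`
    ∃ (_ : TopologicalSpace (TotalSpace (JetModel n F k) (JetFiber n F E k)))
      (_ : ∀ a, TopologicalSpace (JetFiber n F E k a))
      (_ : FiberBundle (JetModel n F k) (JetFiber n F E k))
      (_ : VectorBundle ℝ (JetModel n F k) (JetFiber n F E k))
      (_ : ContMDiffVectorBundle ∞ (JetModel n F k) (JetFiber n F E k) (𝓡 n))
      -- the classical jet bundle
      (_ : TopologicalSpace (TotalSpace (JetModel n F k) (JetSpace n F E k)))
      (_ : ∀ a, TopologicalSpace (JetSpace n F E k a))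
      (_ : FiberBundle (JetModel n F k) (JetSpace n F E k))
      (_ : VectorBundle ℝ (JetModel n F k) (JetSpace n F E k))
      (_ : ContMDiffVectorBundle ∞ (JetModel n F k) (JetSpace n F E k) (𝓡 n)),
      IsSheafOfSections (jetSheaf n F E k) (JetModel n F k) ∧
      HasJetTrivializations n F E k ∧
      -- the canonical fiberwise isomorphism, and its smoothness
      ∃ Ψ : ∀ a : M, JetFiber n F E k a ≃ₗ[ℝ] JetSpace n F E k a,
        (∀ (U : Opens M) (a : U) (h : Cinf n U) (ψ : Sections n F E U),
          Ψ a ((jetSheaf n F E k).value U a (jetClass n F E k U h ψ)) =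
            h a • jetAt n F E k U a ψ) ∧
        (∀ Ψ' : ∀ a : M, JetFiber n F E k a →ₗ[ℝ] JetSpace n F E k a,
          (∀ (U : Opens M) (a : U) (h : Cinf n U) (ψ : Sections n F E U),
            Ψ' a ((jetSheaf n F E k).value U a (jetClass n F E k U h ψ)) =
              h a • jetAt n F E k U a ψ) → ∀ a v, Ψ' a v = Ψ a v) ∧
        ContMDiff ((𝓡 n).prod 𝓘(ℝ, JetModel n F k)) ((𝓡 n).prod 𝓘(ℝ, JetModel n F k)) ∞
          (fun p : TotalSpace (JetModel n F k) (JetFiber n F E k) =>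
            TotalSpace.mk' (JetModel n F k) p.1 (Ψ p.1 p.2)) ∧
        ContMDiff ((𝓡 n).prod 𝓘(ℝ, JetModel n F k)) ((𝓡 n).prod 𝓘(ℝ, JetModel n F k)) ∞
          (fun p : TotalSpace (JetModel n F k) (JetSpace n F E k) =>
            TotalSpace.mk' (JetModel n F k) p.1 ((Ψ p.1).symm p.2)) := by
  -- The sheaf fibers carry the coordinates of the jet spaces pulled back along Ψ. In matching
  -- trivializations Ψ and its inverse are then the identity, which settles smoothness below.
  obtain ⟨i1, i2, i3, i4, i5, ht⟩ :=
    ((jetSmoothCoords F E k).transport (fiberEquiv (n := n) F E k)).exists_bundle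
  obtain ⟨j1, j2, j3, j4, j5, ht'⟩ := (jetSmoothCoords (n := n) F E k).exists_bundle
  refine ⟨i1, i2, i3, i4, i5, j1, j2, j3, j4, j5, isSheafOfSections_jetSheaf ht,
    hasJetTrivializations_of_framedCharts ht', fiberEquiv F E k, fiberEquiv_jetClass F E k,
    fun Ψ' h a v => ?_, ?_, ?_⟩
  -- Uniqueness holds because the classes [h ⊗ ψ]|_a span the fiber.
  · exact LinearMap.congr_fun (fiber_hom_ext F E k (L := Ψ' a)
      (L' := (fiberEquiv F E k a).toLinearMap) fun U ha f ψ =>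
        (h U ⟨a, ha⟩ f ψ).trans (fiberEquiv_jetClass F E k U ⟨a, ha⟩ f ψ).symm) v
  · refine contMDiff_of_trivializations_eq (fun a => fiberEquiv F E k a) fun a => ?_
    obtain ⟨t, hta, hb, hts⟩ := ht (framedChartAt F E a)
    obtain ⟨t', hta', hb', hts'⟩ := ht' (framedChartAt F E a)
    refine ⟨t, hta, t', hta', hb ▸ mem_framedChartAt_source F E a,
      hb' ▸ mem_framedChartAt_source F E a, fun b v => ?_⟩
    rw [hts, hts']
    rfl
  · refine contMDiff_of_trivializations_eq (fun a => (fiberEquiv F E k a).symm) fun a => ?_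
    obtain ⟨t, hta, hb, hts⟩ := ht (framedChartAt F E a)
    obtain ⟨t', hta', hb', hts'⟩ := ht' (framedChartAt F E a)
    refine ⟨t', hta', t, hta, hb' ▸ mem_framedChartAt_source F E a,
      hb ▸ mem_framedChartAt_source F E a, fun b v => ?_⟩
    rw [hts, hts']
    exact congrArg ((jetSmoothCoords (n := n) F E k).coord _ b)
      ((fiberEquiv F E k b).apply_symm_apply v)
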